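/- **Setting.** Functions on $\mathbb T^2=\mathbb R^2/(2\pi\mathbb Z)^2$ are identified with periodic functions; $\nabla^\perp=(\partial_2,-\partial_1)$, $\operatorname{curl} f=\partial_1f_2-\partial_2f_1$. Fix the following. * A finite set $\Lambda\subset\mathbb S^1\cap\mathbb Q^2$ with $-\Lambda=\Lambda$, for each $k\in\Lambda$ an orthonormal basis $(k,\bar k)$ with $\overline{-k}=-\bar k$, an integer $N_\Lambda\ge 1$ with $N_\Lambda\Lambda\subset\mathbb Z^2$, and smooth functions $a_k=a_{-k}$ on the ball of radius $10^{-3}$ (Frobenius norm) around $\mathrm{Id}$ in the symmetric $2\times2$ matrices with $R=\sum_{k\in\Lambda}a_k^2(R)\,\bar k\otimes\bar k$ on that ball. * A smooth even $2\pi$-periodic $\phi:\mathbb R\to\mathbb R$ with $\frac1{2\pi}\int_0^{2\pi}\phi^2=1$ and support in $[-\frac1{100},\frac1{100}]+2\pi\mathbb Z$. * Nonnegative kernels $\varphi\in C_c^\infty(-1,0)$, $\psi\in C_c^\infty(B_1(0))$ on $\mathbb R$, $\mathbb R^2$ with integral one; $\varphi_\epsilon(t)=\epsilon^{-1}\varphi(t/\epsilon)$,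 $\psi_\epsilon(x)=\epsilon^{-2}\psi(x/\epsilon)$. * A Littlewood–Paley partition defining the blocks $\Delta_j$ ($j\ge-1$), and $\|f\|_{B^s_{\infty,1}}=\sum_{j\ge -1}2^{js}\|\Delta_jf\|_{L^\infty(\mathbb T^2)}$. * Constants $K_0,K_1,\dots$ For $C_0>0$ and $a,b\in\mathbb N$ put $\lambda_j=N_\Lambda^4a^{b^j}$ and $\ell_j=\lambda_j^{-50}$ ($j\ge1$), where $a^b$ is a fourth power of an integer. Let $\phi_{k,l}(x)=\phi(\lambda_l^{1/4}k\cdot x)$, $\Omega_{k,l}=\operatorname{spt}\phi_{k,l}$, $\widetilde\Omega_{k,l}=\{x:d(x,\Omega_{k,l})<\frac1{100}\lambda_l^{-1/4}\}$, $\Omega_j=\bigcap_{2\le l\le j}\bigcup_{k\in\Lambda}\Omega_{k,l}$, $\widetilde\Omega_j=\bigcap_{2\le l\le j}\bigcup_{k\in\Lambda}\widetilde\Omega_{k,l}$ (so $\Omega_1=\widetilde\Omega_1=\mathbb R^2$). Let $\chi_j$ ($j\ge1$) be smooth periodic cutoffs with $\chi_j=1$ on $\Omega_j$, $\chi_j=0$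 outside $\widetilde\Omega_j$, $\chi_{j+1}=1$ on $\operatorname{spt}\chi_j\cap\bigcup_k\Omega_{k,j+1}$, and $|D^n\chi_j|\le K_n\lambda_j^{n/4}$ for all $n\ge0$. **Flows.** Define recursively $w^{(p)}_m=\Delta v_m$, $\mathcal Rw^{(p)}_m=\nabla v_m+(\nabla v_m)^{\mathsf T}$, where $v_1=-\lambda_1^{-1}e^{-\lambda_1^2t}\sin(\lambda_1x_1)e_2$ (so $w^{(p)}_1=\lambda_1e^{-\lambda_1^2t}\sin(\lambda_1x_1)e_2$) and, for $m\ge2$, $$v_m=-\lambda_m^{-3}e^{-\lambda_m^2t}\,\nabla^\perp\Big(\sum_{k\in\Lambda}a_{(k,m)}\,\chi_{m-1}\,\phi_{k,m}\,\operatorname{curl}\big(\mathrm i\,e^{\mathrm i\lambda_mk\cdot x}\bar k\big)\Big),$$ $$a_{(k,m)}(t,x)=(2000C_0)^{1/2}\int_t^{t+\ell_{m-1}}\Big(a_k\big(\mathrm{Id}+\tfrac{\mathcal Rw^{(p)}_{m-1}}{1000C_0}\big)*\psi_{\ell_{m-1}}\Big)(x,s)\,\varphi_{\ell_{m-1}}(t-s)\,ds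 .$$ Put $w^{(s)}_m=e^{-2\lambda_m^2t}\,w^{(p)}_{m-1}$ for $m\ge2$. **Statement.** There are constants $C>0$ and $C_*$, depending only on the fixed objects, such that for every $C_0\ge C_*$ there is $L=L(C_0)$ such that for all integers $a,b\ge L$ with $a^b$ a fourth power, all cutoffs $(\chi_j)$ as above and all $q\ge1$: the flows $w^{(p)}_{2q}$, $w^{(s)}_{2q}$ are smooth on $[0,\infty)\times\mathbb T^2$, and there exist a smooth vector field $F^{(1)}_{2q}$ and a smooth function $P^{(1)}_{2q}$ on $[0,\infty)\times\mathbb T^2$ with $$\operatorname{div}\big(w^{(p)}_{2q}\otimes w^{(p)}_{2q}\big)+\partial_tw^{(s)}_{2q}=F^{(1)}_{2q}+\nabla P^{(1)}_{2q}\qquad\text{on }[0,\infty)\times\mathbb T^2,$$ and, for each component of $F^{(1)}_{2q}$, $$\|F^{(1)}_{2q}\|_{L^1([0,\infty);B^{-1/2}_{\infty,1})}\le C\,C_0\,\lambda_{2q-1}^{-15},\qquad \|F^{(1)}_{2q}\|_{L^1([0,\infty);B^{0}_{\infty,1})}\le C\,C_0\,\lambda_{2q}^{1/4}.$$ -/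

import Mathlib

open scoped ContDiff Matrix

attribute [local instance] Matrix.frobeniusNormedAddCommGroup Matrix.frobeniusNormedSpace

noncomputable section

namespace HeatFlow

/-- The plane. Functions on the torus `ℝ² / (2πℤ)²` are `2π`-periodic functions on it. -/
abbrev E2 : Type := EuclideanSpace ℝ (Fin 2)

/-- `2π`-periodicity in both variables. -/
def Periodic2 {F : Type*} (f : E2 → F) : Prop :=
  ∀ (i : Fin 2) (x : E2), f (x + EuclideanSpace.single i (2 * Real.pi)) = f x

/-! ### Differential operators in the space variable -/

/-- The partial derivative `∂ᵢ f`. -/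
def pd {F : Type*} [NormedAddCommGroup F] [NormedSpace ℝ F] (i : Fin 2) (f : E2 → F) (x : E2) : F :=
  fderiv ℝ f x (EuclideanSpace.single i 1)

/-- The Laplacian of a scalar function. -/
def lap (f : E2 → ℝ) (x : E2) : ℝ := ∑ i, pd i (pd i f) x

/-- `∇^⊥ f = (∂₂ f, -∂₁ f)`. -/
def perpGrad (f : E2 → ℝ) (x : E2) : Fin 2 → ℝ := ![pd 1 f x, -pd 0 f x]

/-- `curl f = ∂₁ f₂ - ∂₂ f₁`, for complex vector fields. -/
def curl (f : E2 → Fin 2 → ℂ) (x : E2) : ℂ := pd 0 (fun y => f y 1) x - pd 1 (fun y => f y 0) x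

/-- `∇v + (∇v)ᵀ`. -/
def symGrad (v : E2 → Fin 2 → ℝ) (x : E2) : Matrix (Fin 2) (Fin 2) ℝ :=
  Matrix.of fun i j => pd i (fun y => v y j) x + pd j (fun y => v y i) x

/-- The divergence of a matrix field, `(div T)ᵢ = ∑ⱼ ∂ⱼ Tᵢⱼ`. -/
def divT (T : E2 → Matrix (Fin 2) (Fin 2) ℝ) (x : E2) (i : Fin 2) : ℝ :=
  ∑ j, pd j (fun y => T y i j) x

/-! ### The fixed ingredients of the construction -/

/-- The symmetric matrices in the ball of radius `10⁻³` around the identity. -/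
def symBall : Set (Matrix (Fin 2) (Fin 2) ℝ) :=
  {R | R.IsSymm ∧ ‖R - 1‖ < 1 / 1000}

/-- A finite symmetric set `Λ` of rational unit vectors `k`, each completed to an orthonormal basis
`(k, k̄)`, a positive integer `N` with `N Λ ⊆ ℤ²`, and smooth coefficients `a_k` such that
`R = ∑ a_k(R)² k̄ ⊗ k̄` for every symmetric `R` near the identity. -/
structure GeometricData where
  Λ : Finset E2
  bar : E2 → E2
  N : ℕ
  coef : E2 → Matrix (Fin 2) (Fin 2) ℝ → ℝ
  norm_eq_one : ∀ k ∈ Λ, ‖k‖ = 1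
  neg_mem : ∀ k ∈ Λ, -k ∈ Λ
  norm_bar : ∀ k ∈ Λ, ‖bar k‖ = 1
  inner_bar : ∀ k ∈ Λ, inner ℝ k (bar k) = 0
  bar_neg : ∀ k ∈ Λ, bar (-k) = -bar k
  N_pos : 0 < N
  N_mul : ∀ k ∈ Λ, ∀ i, ∃ n : ℤ, (N : ℝ) * k i = n
  coef_neg : ∀ k ∈ Λ, ∀ R ∈ symBall, coef (-k) R = coef k R
  coef_smooth : ∀ k ∈ Λ, ContDiffOn ℝ ∞ (coef k) symBall
  decomposition : ∀ R ∈ symBall,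
    R = ∑ k ∈ Λ, (coef k R) ^ 2 • Matrix.vecMulVec (fun i => bar k i) (fun i => bar k i)

/-- The one-dimensional profile: smooth, even, `2π`-periodic, concentrated near `2πℤ`, and such that
its square has mean one over a period. -/
structure Profile where
  toFun : ℝ → ℝ
  smooth : ContDiff ℝ ∞ toFun
  even : ∀ s, toFun (-s) = toFun s
  periodic : Function.Periodic toFun (2 * Real.pi)
  mean_sq : (1 / (2 * Real.pi)) * ∫ s in (0 : ℝ)..(2 * Real.pi), toFun s ^ 2 = 1
  support : tsupport toFun ⊆
    ⋃ m : ℤ, Set.Icc (2 * Real.pi * m - 1 / 100) (2 * Real.pi * m + 1 / 100)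

/-- Standard mollifying kernels in time (supported in `(-1, 0)`) and in space. -/
structure Mollifiers where
  time : ℝ → ℝ
  space : E2 → ℝ
  time_smooth : ContDiff ℝ ∞ time
  space_smooth : ContDiff ℝ ∞ space
  time_nonneg : ∀ s, 0 ≤ time s
  space_nonneg : ∀ x, 0 ≤ space x
  time_support : tsupport time ⊆ Set.Ioo (-1) 0
  space_support : tsupport space ⊆ Metric.ball 0 1
  time_integral : ∫ s, time s = 1
  space_integral : ∫ x, space x = 1

/-- `φ_ε(t) = ε⁻¹ φ(t / ε)`. -/
def Mollifiers.timeScaled (M : Mollifiers) (ε t : ℝ) : ℝ := ε⁻¹ * M.time (t / ε)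

/-- `ψ_ε(x) = ε⁻² ψ(x / ε)`. -/
def Mollifiers.spaceScaled (M : Mollifiers) (ε : ℝ) (x : E2) : ℝ :=
  (ε ^ 2)⁻¹ * M.space (ε⁻¹ • x)

/-! ### Parameters, building blocks and cutoffs -/

/-- `λ_q = N⁴ a^{b^q}`. -/
def lam (G : GeometricData) (a b q : ℕ) : ℝ := (G.N : ℝ) ^ 4 * (a : ℝ) ^ (b ^ q)

/-- `ℓ_q = λ_q^{-50}`. -/
def ell (G : GeometricData) (a b q : ℕ) : ℝ := (lam G a b q ^ 50)⁻¹

/-- `φ_{k,l}(x) = φ(λ_l^{1/4} k · x)`. -/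
def block (G : GeometricData) (φ : Profile) (a b l : ℕ) (k x : E2) : ℝ :=
  φ.toFun (lam G a b l ^ (1 / 4 : ℝ) * inner ℝ k x)

/-- `Ω_{k,l}`, the (closed) support of `φ_{k,l}`. -/
def Omega (G : GeometricData) (φ : Profile) (a b l : ℕ) (k : E2) : Set E2 :=
  tsupport (block G φ a b l k)

/-- `Ω̃_{k,l}`, the open neighbourhood of `Ω_{k,l}` of width `λ_l^{-1/4} / 100`. -/
def OmegaTilde (G : GeometricData) (φ : Profile) (a b l : ℕ) (k : E2) : Set E2 :=
  Metric.thickening ((1 / 100) * lam G a b l ^ (-(1 / 4) : ℝ)) (Omega G φ a b l k)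

/-- `Ω_j`. The blocks enter the flows from level `2` on; `Ω_1` is the whole plane. -/
def OmegaInter (G : GeometricData) (φ : Profile) (a b j : ℕ) : Set E2 :=
  ⋂ l ∈ Set.Icc 2 j, ⋃ k ∈ G.Λ, Omega G φ a b l k

/-- `Ω̃_j`. -/
def OmegaTildeInter (G : GeometricData) (φ : Profile) (a b j : ℕ) : Set E2 :=
  ⋂ l ∈ Set.Icc 2 j, ⋃ k ∈ G.Λ, OmegaTilde G φ a b l k

/-- Smooth cutoffs `χ_j`, `j ≥ 1`, equal to one on `Ω_j`, vanishing outside `Ω̃_j`, with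
`|D^n χ_j| ≤ K_n λ_j^{n/4}`, and nested: `χ_{j+1} = 1` on `spt χ_j ∩ ⋃_k Ω_{k,j+1}`. -/
structure IsCutoffSequence (G : GeometricData) (φ : Profile) (a b : ℕ) (K : ℕ → ℝ)
    (χ : ℕ → E2 → ℝ) : Prop where
  smooth : ∀ j, 1 ≤ j → ContDiff ℝ ∞ (χ j)
  periodic : ∀ j, 1 ≤ j → Periodic2 (χ j)
  eq_one : ∀ j, 1 ≤ j → ∀ x ∈ OmegaInter G φ a b j, χ j x = 1
  eq_zero : ∀ j, 1 ≤ j → ∀ x, x ∉ OmegaTildeInter G φ a b j → χ j x = 0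
  nested : ∀ j, 1 ≤ j → ∀ x ∈ tsupport (χ j),
    x ∈ (⋃ k ∈ G.Λ, Omega G φ a b (j + 1) k) → χ (j + 1) x = 1
  bound : ∀ j, 1 ≤ j → ∀ (n : ℕ) (x : E2),
    ‖iteratedFDeriv ℝ n (χ j) x‖ ≤ K n * lam G a b j ^ ((n : ℝ) / 4)

/-! ### The flows -/

/-- The amplitude
`(2000 C₀)^{1/2} ∫_t^{t+ℓ} (A(Id + R / (1000 C₀)) * ψ_ℓ)(s, x) φ_ℓ(t - s) ds`. -/
def amplitude (M : Mollifiers) (C₀ ℓ : ℝ) (A : Matrix (Fin 2) (Fin 2) ℝ → ℝ)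
    (R : ℝ → E2 → Matrix (Fin 2) (Fin 2) ℝ) (t : ℝ) (x : E2) : ℝ :=
  Real.sqrt (2000 * C₀) * ∫ s in t..(t + ℓ),
    (∫ y : E2, A (1 + (1 / (1000 * C₀)) • R s (x - y)) * M.spaceScaled ℓ y) * M.timeScaled ℓ (t - s)

/-- The scalar function `∑_k a_{(k,m)} χ_{m-1} φ_{k,m} curl(i e^{i λ_m k·x} k̄)` for `m = n + 1`, where
`R` stands for `𝓡 w^{(p)}_n`. The terms for `k` and `-k` are complex conjugates of each other (in the
range where the coefficients are even in `k`), so that the sum is real. -/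
def stream (G : GeometricData) (φ : Profile) (M : Mollifiers) (C₀ : ℝ) (a b : ℕ) (χ : ℕ → E2 → ℝ)
    (n : ℕ) (R : ℝ → E2 → Matrix (Fin 2) (Fin 2) ℝ) (t : ℝ) (x : E2) : ℝ :=
  (∑ k ∈ G.Λ,
    ((amplitude M C₀ (ell G a b n) (G.coef k) R t x * χ n x * block G φ a b (n + 1) k x : ℝ) : ℂ) *
      curl (fun y i => Complex.I *
        Complex.exp (Complex.I * ((lam G a b (n + 1) * inner ℝ k y : ℝ) : ℂ)) *
          ((G.bar k i : ℝ) : ℂ)) x).re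

/-- The periodic mean-zero vector potential `v_m = Δ⁻¹ w^{(p)}_m`:
`v_1 = -λ_1⁻¹ e^{-λ_1² t} sin(λ_1 x_1) e_2`, and for `m ≥ 2`
`v_m = -λ_m⁻³ e^{-λ_m² t} ∇^⊥ (∑_k a_{(k,m)} χ_{m-1} φ_{k,m} curl(i e^{i λ_m k·x} k̄))`, with amplitudes
built on `𝓡 w^{(p)}_{m-1} = ∇v_{m-1} + (∇v_{m-1})ᵀ`. -/
def potential (G : GeometricData) (φ : Profile) (M : Mollifiers) (C₀ : ℝ) (a b : ℕ)
    (χ : ℕ → E2 → ℝ) : ℕ → ℝ → E2 → Fin 2 → ℝ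
  | 0 => fun _ _ _ => 0
  | 1 => fun t x =>
      ![0, -(lam G a b 1)⁻¹ * Real.exp (-(lam G a b 1) ^ 2 * t) * Real.sin (lam G a b 1 * x 0)]
  | n + 2 => fun t x i =>
      -(lam G a b (n + 2) ^ 3)⁻¹ * Real.exp (-(lam G a b (n + 2)) ^ 2 * t) *
        perpGrad (stream G φ M C₀ a b χ (n + 1)
          (fun s => symGrad (potential G φ M C₀ a b χ (n + 1) s)) t) x i

/-- The heat-dominated flow `w^{(p)}_m = Δ v_m`; in particular
`w^{(p)}_1 = λ_1 e^{-λ_1² t} sin(λ_1 x_1) e_2`. -/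
def wP (G : GeometricData) (φ : Profile) (M : Mollifiers) (C₀ : ℝ) (a b : ℕ) (χ : ℕ → E2 → ℝ)
    (m : ℕ) (t : ℝ) (x : E2) (i : Fin 2) : ℝ :=
  lap (fun y => potential G φ M C₀ a b χ m t y i) x

/-- The inverse-cascade flow `w^{(s)}_m = e^{-2 λ_m² t} w^{(p)}_{m-1}`, for `m ≥ 2`. -/
def wS (G : GeometricData) (φ : Profile) (M : Mollifiers) (C₀ : ℝ) (a b : ℕ) (χ : ℕ → E2 → ℝ)
    (m : ℕ) (t : ℝ) (x : E2) (i : Fin 2) : ℝ :=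
  Real.exp (-2 * (lam G a b m) ^ 2 * t) * wP G φ M C₀ a b χ (m - 1) t x i

/-! ### Nonhomogeneous Besov norms on the torus -/

/-- The low-frequency function of a dyadic partition of unity: smooth, one on the ball of radius
`3/4` and zero outside the ball of radius `4/3`. -/
structure LittlewoodPaley where
  toFun : E2 → ℝ
  smooth : ContDiff ℝ ∞ toFun
  eq_one : ∀ ξ, ‖ξ‖ ≤ 3 / 4 → toFun ξ = 1
  eq_zero : ∀ ξ, 4 / 3 ≤ ‖ξ‖ → toFun ξ = 0

/-- An integer frequency as a vector of the plane. -/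
def freq (n : Fin 2 → ℤ) : E2 := WithLp.toLp 2 fun i => (n i : ℝ)

/-- The Fourier coefficient `(2π)⁻² ∫_{[0,2π)²} f(x) e^{-i n·x} dx`. -/
def fourierCoef (f : E2 → ℝ) (n : Fin 2 → ℤ) : ℂ :=
  (((2 * Real.pi) ^ 2 : ℝ) : ℂ)⁻¹ *
    ∫ x in {x : E2 | ∀ i, x i ∈ Set.Ico 0 (2 * Real.pi)},
      (f x : ℂ) * Complex.exp (-(Complex.I * ((inner ℝ (freq n) x : ℝ) : ℂ)))

/-- The symbol of the dyadic block `Δ_{j-1}`, for `j = 0, 1, 2, …`. -/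
def LittlewoodPaley.symbol (θ : LittlewoodPaley) : ℕ → E2 → ℝ
  | 0 => θ.toFun
  | j + 1 => fun ξ => θ.toFun (((2 : ℝ) ^ (j + 1))⁻¹ • ξ) - θ.toFun (((2 : ℝ) ^ j)⁻¹ • ξ)

/-- The dyadic block `Δ_{j-1} f` of a periodic function (the sum has finitely many nonzero terms). -/
def LittlewoodPaley.delta (θ : LittlewoodPaley) (j : ℕ) (f : E2 → ℝ) (x : E2) : ℂ :=
  ∑' n : Fin 2 → ℤ, ((θ.symbol j (freq n) : ℝ) : ℂ) * fourierCoef f n *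
    Complex.exp (Complex.I * ((inner ℝ (freq n) x : ℝ) : ℂ))

/-- The norm of `B^s_{∞,1}`, namely `∑_{j ≥ -1} 2^{js} ‖Δ_j f‖_{L^∞}`. -/
def LittlewoodPaley.besov (θ : LittlewoodPaley) (s : ℝ) (f : E2 → ℝ) : ENNReal :=
  ∑' j : ℕ, ENNReal.ofReal ((2 : ℝ) ^ (((j : ℝ) - 1) * s)) * ⨆ x : E2, ‖θ.delta j f x‖ₑ

/-- The norm of `L¹([0,∞); B^s_{∞,1})`. -/
def LittlewoodPaley.L1besov (θ : LittlewoodPaley) (s : ℝ) (f : ℝ → E2 → ℝ) : ENNReal :=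
  ∫⁻ t in Set.Ioi (0 : ℝ), θ.besov s (f t)

/-- Smoothness on `[0, ∞) × ℝ²`. -/
def SmoothST {F : Type*} [NormedAddCommGroup F] [NormedSpace ℝ F] (f : ℝ → E2 → F) : Prop :=
  ContDiffOn ℝ ∞ (fun p : ℝ × E2 => f p.1 p.2) (Set.Ici 0 ×ˢ Set.univ)

end HeatFlow

end

/-!
Outside the decay in time, the flow of level `m ≥ 2` is `λ⁻² ∇^⊥ ΔU`, where `λ = λ_m` and `U` is a sum
of plane waves of frequency `λ` whose amplitudes have frequencies at most of order `λ^{1/4}`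
(`Step.stream_eq`, `Step.potential_succ`). Such a `U` is almost an eigenfunction of the Laplacian,
and the Euler nonlinearity of a flow `∇^⊥ Y` is a gradient minus the product of `(Δ + λ²) Y` and
`∇Y` (`div_perp_tensor`). In this product the highest power of `λ` cancels. What remains at the
next order (`helm_mul_dX_eq`) consists of products of waves: for different directions these
oscillate at a frequency comparable to `λ`, while the interactions of a direction with itself and
with its opposite leave a part without fast oscillation.

That part is what the construction aims at. By the geometric decomposition the squares of the
amplitudes add up to `2000 C₀ (Id + 𝓡 / (1000 C₀))` after the square `φ²` of the profile is replaced
by its mean one and the mollified coefficients by the original ones; hence, up to a gradient, the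
divergence is `2 div (∇V + (∇V)ᵀ) = 2 ΔV`, with `V` the divergence-free potential of the previous
level (`selfInteraction_eq`). It carries the factor `λ² e^{-2λ²t}` and cancels the derivative of the
weight in `∂_t (e^{-2λ²t} ΔV)` (`Step.identity`). The cutoffs do no harm since the previous flow
vanishes wherever they are not one.

The error consists of terms of lower order, of interactions of different directions, of the
fluctuation `φ² - 1`, of the mollification error and of `λ⁻² ∂_t ΔV`. Each is bounded uniformly in
time in `B^0_{∞,1}` and `B^{-1/2}_{∞,1}` (`exists_errorTerm_bound`), and the common factor
`λ² e^{-2λ²t}` has integral `1/2` (`LittlewoodPaley.L1besov_le`). A term that oscillates at a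
frequency `ρ` is, up to lower order, the divergence of a field smaller by a factor `ρ`, and therefore
gains `ρ^{-1/2}` in the norm of negative order (`exists_besovConst`). For these bounds the
Littlewood–Paley blocks of periodic functions are written as convolutions with a Schwartz function
(`LittlewoodPaley.delta_eq_blockOp`).

The constant in the final bounds must not depend on `C₀`. All constants that enter through the
amplitudes are of the form `c √C₀` with `c` independent of `C₀`; in particular the stream functions
have size of order `√C₀`, so that `𝓡 / (1000 C₀)` is small for large `C₀` and the decomposition
applies at every level (`exists_steps`). Constants that do depend on `C₀` are absorbed in powers of
`λ_{m-1}`, and these are negligible against `λ_m^{1/4}` when `b` is large (`lam_pow_le`).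

All functions are extended smoothly to negative times, with bounded derivatives, so that the
computations can be carried out in the algebra `Sm` of smooth functions on space-time.
-/

noncomputable section

namespace HeatFlow

/-! ### Scaled bounds on derivatives -/

/-- `SB N C D f`: the function `f` is smooth and its derivatives satisfy `‖Dʲ f‖ ≤ C Dʲ` for
`j ≤ N`. The number `C` is the amplitude of `f` and `D` its frequency. -/
structure SB {E F : Type*} [NormedAddCommGroup E] [NormedSpace ℝ E] [NormedAddCommGroup F]
    [NormedSpace ℝ F] (N : ℕ) (C D : ℝ) (f : E → F) : Prop where
  smooth : ContDiff ℝ ∞ f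
  bound : ∀ j, j ≤ N → ∀ x, ‖iteratedFDeriv ℝ j f x‖ ≤ C * D ^ j

namespace SB

variable {E F G : Type*} [NormedAddCommGroup E] [NormedSpace ℝ E] [NormedAddCommGroup F]
  [NormedSpace ℝ F] [NormedAddCommGroup G] [NormedSpace ℝ G] {N : ℕ} {C D C' D' : ℝ}

lemma norm_le {f : E → F} (h : SB N C D f) (x : E) : ‖f x‖ ≤ C := by
  simpa using h.bound 0 (Nat.zero_le _) x

lemma nonneg {f : E → F} (h : SB N C D f) : 0 ≤ C := (norm_nonneg _).trans (h.norm_le 0)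

lemma mono {f : E → F} (h : SB N C D f) (hD : 0 ≤ D) (hC : C ≤ C') (hDD : D ≤ D') :
    SB N C' D' f :=
  ⟨h.smooth, fun j hj x => (h.bound j hj x).trans
    (mul_le_mul hC (pow_le_pow_left₀ hD hDD j) (pow_nonneg hD j) (h.nonneg.trans hC))⟩

lemma mono_left {f : E → F} (h : SB N C D f) (hD : 0 ≤ D) (hC : C ≤ C') : SB N C' D f :=
  h.mono hD hC le_rfl

lemma order {M : ℕ} {f : E → F} (h : SB N C D f) (hM : M ≤ N) : SB M C D f :=
  ⟨h.smooth, fun j hj x => h.bound j (hj.trans hM) x⟩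

lemma const (N : ℕ) (hD : 0 ≤ D) (c : F) : SB N ‖c‖ D (fun _ : E => c) := by
  refine ⟨contDiff_const, fun j _ x => ?_⟩
  rcases Nat.eq_zero_or_pos j with rfl | hj
  · simp
  · rw [iteratedFDeriv_const_of_ne (by omega)]
    simp only [Pi.zero_apply, norm_zero]
    positivity

lemma add {f g : E → F} (hf : SB N C D f) (hg : SB N C' D g) :
    SB N (C + C') D (fun x => f x + g x) := by
  refine ⟨hf.smooth.add hg.smooth, fun j hj x => ?_⟩
  have : (fun x => f x + g x) = f + g := rfl
  rw [this, iteratedFDeriv_add_apply (hf.smooth.contDiffAt.of_le (by exact_mod_cast le_top))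
    (hg.smooth.contDiffAt.of_le (by exact_mod_cast le_top)), add_mul]
  exact (norm_add_le _ _).trans (add_le_add (hf.bound j hj x) (hg.bound j hj x))

lemma clm_comp {f : E → F} (L : F →L[ℝ] G) (hf : SB N C D f) :
    SB N (‖L‖ * C) D (fun x => L (f x)) := by
  refine ⟨L.contDiff.comp hf.smooth, fun j hj x => ?_⟩
  have := L.norm_iteratedFDeriv_comp_left (f := f) (x := x)
    (hf.smooth.contDiffAt) (n := j) (by exact_mod_cast le_top)
  refine (this).trans ?_
  rw [mul_assoc]
  exact mul_le_mul_of_nonneg_left (hf.bound j hj x) (norm_nonneg _)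

lemma const_mul {f : E → ℝ} (c : ℝ) (hf : SB N C D f) :
    SB N (|c| * C) D (fun x => c * f x) := by
  have h := hf.clm_comp (c • ContinuousLinearMap.id ℝ ℝ)
  have hn : ‖c • ContinuousLinearMap.id ℝ ℝ‖ = |c| := by
    rw [norm_smul, ContinuousLinearMap.norm_id, mul_one, Real.norm_eq_abs]
  rw [hn] at h
  exact h

lemma smul_const {f : E → ℝ} (v : F) (hf : SB N C D f) :
    SB N (‖v‖ * C) D (fun x => f x • v) := by
  have h := hf.clm_comp ((ContinuousLinearMap.id ℝ ℝ).smulRight v)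
  simpa using h

lemma neg {f : E → ℝ} (hf : SB N C D f) : SB N C D (fun x => -f x) := by
  simpa using hf.const_mul (-1)

lemma sub {f g : E → ℝ} (hf : SB N C D f) (hg : SB N C' D g) :
    SB N (C + C') D (fun x => f x - g x) := by
  simpa [sub_eq_add_neg] using hf.add hg.neg

lemma sum {ι : Type*} {s : Finset ι} {f : ι → E → F} {c : ι → ℝ} (hD : 0 ≤ D)
    (h : ∀ i ∈ s, SB N (c i) D (f i)) : SB N (∑ i ∈ s, c i) D (fun x => ∑ i ∈ s, f i x) := by
  classical
  induction s using Finset.induction_on with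
  | empty => simpa using SB.const (E := E) N hD (0 : F)
  | insert i s hi ih =>
    simp only [Finset.sum_insert hi]
    exact (h i (Finset.mem_insert_self i s)).add
      (ih fun j hj => h j (Finset.mem_insert_of_mem hj))

lemma sum_const {ι : Type*} {s : Finset ι} {f : ι → E → F} (hD : 0 ≤ D)
    (h : ∀ i ∈ s, SB N C D (f i)) : SB N (s.card * C) D (fun x => ∑ i ∈ s, f i x) := by
  simpa using SB.sum hD h

lemma mul {f g : E → ℝ} (hf : SB N C D f) (hg : SB N C' D' g) :
    SB N (C * C') (D + D') (fun x => f x * g x) := by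
  refine ⟨hf.smooth.mul hg.smooth, fun j hj x => ?_⟩
  refine (norm_iteratedFDeriv_mul_le hf.smooth hg.smooth x (n := j)
    (by exact_mod_cast le_top)).trans ?_
  rw [add_pow, Finset.mul_sum]
  refine Finset.sum_le_sum fun i hi => ?_
  have hi' : i ≤ j := Nat.lt_succ_iff.1 (Finset.mem_range.1 hi)
  have h1 := hf.bound i (hi'.trans hj) x
  have h2 := hg.bound (j - i) ((Nat.sub_le _ _).trans hj) x
  have h3 := mul_le_mul h1 h2 (norm_nonneg _) ((norm_nonneg _).trans h1)
  calc _ = (j.choose i : ℝ) * (‖iteratedFDeriv ℝ i f x‖ * ‖iteratedFDeriv ℝ (j - i) g x‖) := by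
        ring
    _ ≤ (j.choose i : ℝ) * (C * D ^ i * (C' * D' ^ (j - i))) :=
        mul_le_mul_of_nonneg_left h3 (Nat.cast_nonneg _)
    _ = _ := by ring

lemma comp_clm {f : F → G} (hf : SB N C D f) (hD : 0 ≤ D) (L : E →L[ℝ] F) (hL : ‖L‖ ≤ D') :
    SB N C (D * D') (fun x => f (L x)) := by
  refine ⟨hf.smooth.comp L.contDiff, fun j hj x => ?_⟩
  have h1 : (fun x => f (L x)) = f ∘ L := rfl
  rw [h1, L.iteratedFDeriv_comp_right hf.smooth x (by exact_mod_cast le_top)]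
  refine ((ContinuousMultilinearMap.norm_compContinuousLinearMap_le _ _).trans ?_)
  rw [Finset.prod_const, Finset.card_univ, Fintype.card_fin, mul_pow, ← mul_assoc]
  exact mul_le_mul (hf.bound j hj _) (pow_le_pow_left₀ (norm_nonneg _) hL j)
    (by positivity) (mul_nonneg hf.nonneg (pow_nonneg hD j))

lemma comp {g : F → G} {f : E → F} (hg : SB N C 1 g) (hf : ContDiff ℝ ∞ f)
    (hD : ∀ j, 1 ≤ j → j ≤ N → ∀ x, ‖iteratedFDeriv ℝ j f x‖ ≤ D ^ j) (hD0 : 0 ≤ D) :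
    SB N (N.factorial * C) D (fun x => g (f x)) := by
  refine ⟨hg.smooth.comp hf, fun j hj x => ?_⟩
  have h := norm_iteratedFDeriv_comp_le hg.smooth hf (n := j) (by exact_mod_cast le_top) x
    (C := C) (D := D) (fun i hi => by simpa using hg.bound i (hi.trans hj) (f x))
    (fun i h1 hi => hD i h1 (hi.trans hj) x)
  refine h.trans (mul_le_mul_of_nonneg_right (mul_le_mul_of_nonneg_right ?_ hg.nonneg)
    (pow_nonneg hD0 j))
  exact_mod_cast Nat.factorial_le hj

protected lemma fderiv {f : E → F} (hf : SB (N + 1) C D f) : SB N (C * D) D (fun x => fderiv ℝ f x) := by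
  refine ⟨hf.smooth.fderiv_right (by exact_mod_cast le_top), fun j hj x => ?_⟩
  rw [show (fun x => fderiv ℝ f x) = fderiv ℝ f from rfl, norm_iteratedFDeriv_fderiv]
  refine (hf.bound (j + 1) (by omega) x).trans (le_of_eq ?_)
  ring

lemma fderiv_apply {f : E → F} (hf : SB (N + 1) C D f) (v : E) (hv : ‖v‖ ≤ 1) (hD : 0 ≤ D) :
    SB N (C * D) D (fun x => fderiv ℝ f x v) := by
  have h := hf.fderiv.clm_comp (ContinuousLinearMap.apply ℝ F v)
  refine h.mono_left hD ?_
  have h1 : ‖ContinuousLinearMap.apply ℝ F v‖ ≤ 1 := by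
    refine ContinuousLinearMap.opNorm_le_bound _ zero_le_one fun L => ?_
    simp only [ContinuousLinearMap.apply_apply]
    exact (L.le_opNorm v).trans (by nlinarith [norm_nonneg L])
  exact (mul_le_mul_of_nonneg_right h1 hf.fderiv.nonneg).trans (by rw [one_mul])

lemma of_forall_exists {f : E → F} (hf : ContDiff ℝ ∞ f)
    (h : ∀ j, ∃ C, ∀ x, ‖iteratedFDeriv ℝ j f x‖ ≤ C) (N : ℕ) : ∃ C, 0 ≤ C ∧ SB N C 1 f := by
  choose c hc using h
  refine ⟨∑ j ∈ Finset.range (N + 1), |c j|, by positivity, hf, fun j hj x => ?_⟩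
  rw [one_pow, mul_one]
  refine ((hc j x).trans (le_abs_self _)).trans ?_
  exact Finset.single_le_sum (f := fun j => |c j|) (fun i _ => abs_nonneg _)
    (Finset.mem_range.2 (by omega))

lemma of_hasCompactSupport {f : E → F} (hf : ContDiff ℝ ∞ f) (h : HasCompactSupport f) (N : ℕ) :
    ∃ C, 0 ≤ C ∧ SB N C 1 f :=
  of_forall_exists hf (fun j => (h.iteratedFDeriv j).exists_bound_of_continuous
    (hf.continuous_iteratedFDeriv (by exact_mod_cast le_top))) N

/-- A smooth periodic function of one variable has bounded derivatives. -/
lemma of_periodic {f : ℝ → ℝ} {T : ℝ} (hT : 0 < T) (hf : ContDiff ℝ ∞ f)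
    (h : Function.Periodic f T) (N : ℕ) : ∃ C, 0 ≤ C ∧ SB N C 1 f := by
  refine of_forall_exists hf (fun j => ?_) N
  have hc : Continuous (iteratedFDeriv ℝ j f) :=
    hf.continuous_iteratedFDeriv (by exact_mod_cast le_top)
  obtain ⟨C, hC⟩ := (isCompact_Icc (a := (0 : ℝ)) (b := T)).exists_bound_of_continuousOn
    hc.continuousOn
  have hp : Function.Periodic (iteratedFDeriv ℝ j f) T := by
    intro x
    rw [← iteratedFDeriv_comp_add_right j T x]
    congr 1
    funext y
    exact h y
  refine ⟨C, fun x => ?_⟩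
  obtain ⟨y, hy, hxy⟩ := hp.exists_mem_Ico₀ hT x
  rw [hxy]
  exact hC y ⟨hy.1, hy.2.le⟩

end SB

section

open MeasureTheory

/-! ### Fourier series of periodic functions on the plane -/

/-- The exponential `x ↦ e^{i ξ·x}`. -/
def planeExp (ξ x : E2) : ℂ := Complex.exp (Complex.I * ((inner ℝ ξ x : ℝ) : ℂ))

lemma continuous_planeExp (ξ : E2) : Continuous (planeExp ξ) := by
  unfold planeExp
  fun_prop

lemma norm_planeExp (ξ x : E2) : ‖planeExp ξ x‖ = 1 := by
  rw [planeExp, mul_comm, Complex.norm_exp_ofReal_mul_I]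

lemma planeExp_sub (ξ x y : E2) : planeExp ξ (x - y) = planeExp ξ x * planeExp (-ξ) y := by
  rw [planeExp, planeExp, planeExp, ← Complex.exp_add, inner_sub_right, inner_neg_left]
  push_cast
  ring_nf

lemma planeExp_freq (n : Fin 2 → ℤ) (x : E2) :
    planeExp (freq n) x = ∏ i, Complex.exp (Complex.I * (n i * x i : ℝ)) := by
  rw [planeExp, ← Complex.exp_sum]
  congr 1
  simp [PiLp.inner_apply, freq, Fin.sum_univ_two, mul_add]
  ring

/-- The fundamental square `[0, 2π)²`. -/
def cell : Set E2 := {x : E2 | ∀ i, x i ∈ Set.Ico 0 (2 * Real.pi)}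

lemma setIntegral_cell (f : (Fin 2 → ℝ) → ℂ) :
    ∫ x in cell, f (WithLp.ofLp x) =
      ∫ u, f u ∂(Measure.pi fun _ : Fin 2 => volume.restrict (Set.Ico (0 : ℝ) (2 * Real.pi))) := by
  have h1 : cell = WithLp.ofLp ⁻¹' (Set.univ.pi fun _ : Fin 2 => Set.Ico (0 : ℝ) (2 * Real.pi)) := by
    ext x; simp [cell]
  have h := (PiLp.volume_preserving_ofLp (Fin 2)).setIntegral_preimage_emb
    (MeasurableEquiv.toLp 2 (Fin 2 → ℝ)).symm.measurableEmbedding f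
    (Set.univ.pi fun _ : Fin 2 => Set.Ico (0 : ℝ) (2 * Real.pi))
  rw [h1, ← Measure.restrict_pi_pi]
  exact h

lemma volume_cell : volume cell = ENNReal.ofReal ((2 * Real.pi) ^ 2) := by
  have h1 : cell = WithLp.ofLp ⁻¹' (Set.univ.pi fun _ : Fin 2 => Set.Ico (0 : ℝ) (2 * Real.pi)) := by
    ext x; simp [cell]
  rw [h1, (PiLp.volume_preserving_ofLp (Fin 2)).measure_preimage
    (MeasurableSet.univ_pi fun _ => measurableSet_Ico).nullMeasurableSet, volume_pi_pi]
  simp [ENNReal.ofReal_pow Real.two_pi_pos.le]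

/-- Fourier coefficients of complex functions. -/
def fourierCoefC (f : E2 → ℂ) (n : Fin 2 → ℤ) : ℂ :=
  (((2 * Real.pi) ^ 2 : ℝ) : ℂ)⁻¹ * ∫ x in cell, f x * planeExp (-freq n) x

lemma fourierCoefC_ofReal (f : E2 → ℝ) (n : Fin 2 → ℤ) :
    fourierCoefC (fun x => (f x : ℂ)) n = fourierCoef f n := by
  simp only [fourierCoefC, fourierCoef, cell, planeExp, inner_neg_left]
  push_cast
  simp only [mul_neg]

lemma integral_Ico_exp (k : ℤ) :
    ∫ s in Set.Ico (0 : ℝ) (2 * Real.pi), Complex.exp (Complex.I * (k * s : ℝ)) =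
      if k = 0 then ((2 * Real.pi : ℝ) : ℂ) else 0 := by
  rw [integral_Ico_eq_integral_Ioc, ← intervalIntegral.integral_of_le Real.two_pi_pos.le]
  split_ifs with hk
  · simp [hk]
  · have hc : Complex.I * (k : ℂ) ≠ 0 := by simp [hk]
    have h := integral_exp_mul_complex (a := 0) (b := 2 * Real.pi) hc
    have h2 : Complex.exp (Complex.I * (k : ℂ) * ((2 * Real.pi : ℝ) : ℂ)) = 1 := by
      rw [Complex.exp_eq_one_iff]
      exact ⟨k, by push_cast; ring⟩
    rw [h2] at h
    simp only [Complex.ofReal_zero, mul_zero, Complex.exp_zero, sub_self, zero_div] at h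
    rw [← h]
    congr 1
    funext s
    push_cast
    ring_nf

lemma fourierCoefC_planeExp (m n : Fin 2 → ℤ) :
    fourierCoefC (planeExp (freq m)) n = if m = n then 1 else 0 := by
  have h1 : ∀ x : E2, planeExp (freq m) x * planeExp (-freq n) x =
      ∏ i, Complex.exp (Complex.I * ((m i - n i : ℤ) * x i : ℝ)) := by
    intro x
    have : -freq n = freq (-n) := by
      ext i; simp [freq]
    rw [this, planeExp_freq, planeExp_freq, ← Finset.prod_mul_distrib]
    refine Finset.prod_congr rfl fun i _ => ?_
    rw [← Complex.exp_add]
    congr 1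
    push_cast [Pi.neg_apply]
    ring
  have h2 := setIntegral_cell fun u => ∏ i, Complex.exp (Complex.I * ((m i - n i : ℤ) * u i : ℝ))
  have h3 := integral_fintype_prod_eq_prod (𝕜 := ℂ)
    (μ := fun _ : Fin 2 => volume.restrict (Set.Ico (0 : ℝ) (2 * Real.pi)))
    (fun (i : Fin 2) (s : ℝ) => Complex.exp (Complex.I * ((m i - n i : ℤ) * s : ℝ)))
  rw [fourierCoefC]
  simp only [h1]
  rw [h2, h3]
  simp only [integral_Ico_exp]
  have hpi : ((2 * Real.pi : ℝ) : ℂ) ≠ 0 := by exact_mod_cast Real.two_pi_pos.ne'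
  split_ifs with hmn
  · subst hmn
    simp only [sub_self, if_true, Finset.prod_const, Finset.card_univ, Fintype.card_fin]
    rw [Complex.ofReal_pow]
    exact inv_mul_cancel₀ (pow_ne_zero 2 hpi)
  · obtain ⟨i, hi⟩ := Function.ne_iff.1 hmn
    rw [Finset.prod_eq_zero (Finset.mem_univ i), mul_zero]
    rw [if_neg (sub_ne_zero.2 hi)]

lemma integrableOn_cell {f : E2 → ℂ} (hf : Continuous f) : IntegrableOn f cell := by
  have hb : Bornology.IsBounded cell := by
    refine (Metric.isBounded_iff_subset_closedBall 0).2 ⟨Real.sqrt (2 * (2 * Real.pi) ^ 2), ?_⟩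
    intro x hx
    rw [mem_closedBall_zero_iff, EuclideanSpace.norm_eq]
    refine Real.sqrt_le_sqrt ?_
    rw [Fin.sum_univ_two]
    have h0 := hx 0
    have h1 := hx 1
    simp only [Real.norm_eq_abs, sq_abs]
    nlinarith [h0.1, h0.2, h1.1, h1.2]
  exact (hf.continuousOn.integrableOn_compact hb.isCompact_closure).mono_set subset_closure

lemma fourierCoefC_add {f g : E2 → ℂ} (hf : Continuous f) (hg : Continuous g) (n : Fin 2 → ℤ) :
    fourierCoefC (fun x => f x + g x) n = fourierCoefC f n + fourierCoefC g n := by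
  simp only [fourierCoefC, add_mul]
  have h := integral_add (integrableOn_cell (hf.mul (continuous_planeExp (-freq n))))
    (integrableOn_cell (hg.mul (continuous_planeExp (-freq n))))
  simp only [Pi.mul_apply] at h
  rw [h, mul_add]

lemma fourierCoefC_smul (c : ℂ) (f : E2 → ℂ) (n : Fin 2 → ℤ) :
    fourierCoefC (fun x => c * f x) n = c * fourierCoefC f n := by
  simp only [fourierCoefC, mul_assoc]
  rw [integral_const_mul]
  ring

lemma norm_fourierCoefC_le {f : E2 → ℂ} {A : ℝ} (hf : ∀ x, ‖f x‖ ≤ A) (n : Fin 2 → ℤ) :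
    ‖fourierCoefC f n‖ ≤ A := by
  have hpi : (0 : ℝ) < (2 * Real.pi) ^ 2 := by positivity
  have h := norm_setIntegral_le_of_norm_le_const (μ := volume) (s := cell)
    (f := fun x => f x * planeExp (-freq n) x) (C := A)
    (by rw [volume_cell]; exact ENNReal.ofReal_lt_top)
    (fun x _ => by rw [norm_mul, norm_planeExp, mul_one]; exact hf x)
  rw [Measure.real, volume_cell, ENNReal.toReal_ofReal hpi.le] at h
  rw [fourierCoefC, norm_mul, norm_inv, Complex.norm_real, Real.norm_of_nonneg hpi.le,
    inv_mul_le_iff₀ hpi, mul_comm]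
  exact h

/-- The covering map from the plane to the torus. -/
def torusProj (x : E2) : UnitAddTorus (Fin 2) := fun i => ((x i / (2 * Real.pi) : ℝ) : UnitAddCircle)

lemma isOpenQuotientMap_torusProj : IsOpenQuotientMap torusProj := by
  have h1 : IsOpenQuotientMap (Pi.map fun (_ : Fin 2) (s : ℝ) => (s : UnitAddCircle)) :=
    IsOpenQuotientMap.piMap fun _ => QuotientAddGroup.isOpenQuotientMap_mk
  let e1 : E2 ≃ₜ (Fin 2 → ℝ) := (EuclideanSpace.equiv (Fin 2) ℝ).toHomeomorph
  let e2 : E2 ≃ₜ E2 := Homeomorph.smulOfNeZero (2 * Real.pi)⁻¹ (inv_ne_zero Real.two_pi_pos.ne')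
  have h2 := h1.comp (e2.trans e1).isOpenQuotientMap
  convert h2 using 1
  funext x i
  simp [torusProj, e1, e2, div_eq_inv_mul]

lemma Periodic2.eq_of_torusProj_eq {F : Type*} {f : E2 → F} (hf : Periodic2 f) {x y : E2}
    (h : torusProj x = torusProj y) : f x = f y := by
  have h1 : ∀ i, ∃ n : ℤ, x i = y i + n * (2 * Real.pi) := by
    intro i
    have h2 : ((x i / (2 * Real.pi) - y i / (2 * Real.pi) : ℝ) : UnitAddCircle) = 0 := by
      rw [AddCircle.coe_sub, sub_eq_zero]
      exact congrFun h i
    obtain ⟨n, hn⟩ := (AddCircle.coe_eq_zero_iff _).1 h2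
    refine ⟨n, ?_⟩
    have hpi := Real.two_pi_pos.ne'
    rw [zsmul_eq_mul, mul_one, ← sub_div, eq_div_iff hpi] at hn
    linarith
  choose n hn using h1
  have hp : ∀ i, Function.Periodic f (EuclideanSpace.single i (2 * Real.pi)) := fun i x => hf i x
  have hx : x = y + n 0 • EuclideanSpace.single (0 : Fin 2) (2 * Real.pi)
      + n 1 • EuclideanSpace.single (1 : Fin 2) (2 * Real.pi) := by
    ext i
    fin_cases i
    · simp [hn 0]
    · simp [hn 1]
  rw [hx, (hp 1).zsmul, (hp 0).zsmul]

/-- Continuous periodic functions are uniformly approximated by trigonometric polynomials: this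
is the closure induction principle resulting from it. -/
lemma Periodic2.trig_induction {P : (E2 → ℂ) → Prop}
    (hexp : ∀ n, P (planeExp (freq n)))
    (hadd : ∀ f g : E2 → ℂ, Continuous f → Continuous g → P f → P g → P (fun x => f x + g x))
    (hsmul : ∀ (c : ℂ) (f : E2 → ℂ), Continuous f → P f → P (fun x => c * f x))
    (hlim : ∀ f : E2 → ℂ, Continuous f →
      (∀ ε : ℝ, 0 < ε → ∃ g : E2 → ℂ, Continuous g ∧ P g ∧ ∀ x, ‖f x - g x‖ ≤ ε) → P f)
    {f : E2 → ℂ} (hf : Continuous f) (hper : Periodic2 f) : P f := by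
  have hq := isOpenQuotientMap_torusProj
  have hsec : ∀ x, f (Function.surjInv hq.surjective (torusProj x)) = f x := fun x =>
    hper.eq_of_torusProj_eq (Function.surjInv_eq hq.surjective _)
  let F : C(UnitAddTorus (Fin 2), ℂ) := ⟨fun y => f (Function.surjInv hq.surjective y),
    hq.isQuotientMap.continuous_iff.2 (by
      have : (fun y => f (Function.surjInv hq.surjective y)) ∘ torusProj = f := funext hsec
      rw [this]; exact hf)⟩
  have hF : ∀ x, F (torusProj x) = f x := hsec
  have hmono : ∀ n x, UnitAddTorus.mFourier n (torusProj x) = planeExp (freq n) x := by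
    intro n x
    rw [planeExp_freq]
    simp only [UnitAddTorus.mFourier, ContinuousMap.coe_mk, torusProj]
    refine Finset.prod_congr rfl fun i _ => ?_
    rw [fourier_coe_apply]
    congr 1
    have : (Real.pi : ℂ) ≠ 0 := by exact_mod_cast Real.pi_pos.ne'
    push_cast
    field_simp
  have hspan : ∀ g ∈ Submodule.span ℂ (Set.range (UnitAddTorus.mFourier (d := Fin 2))),
      P (fun x => g (torusProj x)) := by
    intro g hg
    induction hg using Submodule.span_induction with
    | mem g hg =>
      obtain ⟨n, rfl⟩ := hg
      simp only [hmono]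
      exact hexp n
    | zero =>
      have := hsmul 0 _ (continuous_planeExp (freq 0)) (hexp 0)
      simpa using this
    | add g h _ _ ihg ihh =>
      exact hadd _ _ (g.continuous.comp hq.continuous) (h.continuous.comp hq.continuous) ihg ihh
    | smul c g _ ih => exact hsmul c _ (g.continuous.comp hq.continuous) ih
  refine hlim f hf fun ε hε => ?_
  have hcl : F ∈ (Submodule.span ℂ (Set.range (UnitAddTorus.mFourier (d := Fin 2)))).topologicalClosure := by
    rw [UnitAddTorus.span_mFourier_closure_eq_top]; trivial
  obtain ⟨g, hg, hd⟩ := Metric.mem_closure_iff.1 hcl ε hε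
  refine ⟨fun x => g (torusProj x), g.continuous.comp hq.continuous, hspan g hg, fun x => ?_⟩
  rw [← hF, ← dist_eq_norm]
  exact (ContinuousMap.dist_apply_le_dist _).trans hd.le

end

section

open MeasureTheory

/-! ### Littlewood–Paley blocks as convolutions -/

/-- The low-frequency symbol is the Fourier transform of a Schwartz function. -/
lemma LittlewoodPaley.exists_kernel (θ : LittlewoodPaley) :
    ∃ H : SchwartzMap E2 ℂ, ∀ ξ : E2, ∫ z, H z * planeExp (-ξ) z = (θ.toFun ξ : ℂ) := by
  have hs : ContDiff ℝ ∞ fun ξ : E2 => (θ.toFun ((2 * Real.pi) • ξ) : ℂ) :=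
    Complex.ofRealCLM.contDiff.comp (θ.smooth.comp (contDiff_const_smul _))
  have hc : HasCompactSupport fun ξ : E2 => (θ.toFun ((2 * Real.pi) • ξ) : ℂ) := by
    refine HasCompactSupport.intro (isCompact_closedBall (0 : E2) (4 / 3)) fun ξ hξ => ?_
    rw [mem_closedBall_zero_iff, not_le] at hξ
    rw [θ.eq_zero, Complex.ofReal_zero]
    rw [norm_smul, Real.norm_of_nonneg Real.two_pi_pos.le]
    nlinarith [Real.pi_gt_three]
  let H : SchwartzMap E2 ℂ := FourierTransformInv.fourierInv (hc.toSchwartzMap hs)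
  refine ⟨H, fun ξ => ?_⟩
  have h1 : FourierTransform.fourier H = hc.toSchwartzMap hs :=
    FourierTransform.fourier_fourierInv_eq (hc.toSchwartzMap hs)
  have h2 := congrArg (fun g : SchwartzMap E2 ℂ => g ((2 * Real.pi)⁻¹ • ξ)) h1
  simp only [SchwartzMap.fourier_coe] at h2
  rw [Real.fourier_eq'] at h2
  have hpi := Real.two_pi_pos.ne'
  have h3 : (hc.toSchwartzMap hs) ((2 * Real.pi)⁻¹ • ξ) = (θ.toFun ξ : ℂ) := by
    change (θ.toFun ((2 * Real.pi) • (2 * Real.pi)⁻¹ • ξ) : ℂ) = _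
    rw [smul_smul, mul_inv_cancel₀ hpi, one_smul]
  rw [← h3, ← h2]
  refine integral_congr_ae (Filter.Eventually.of_forall fun v => ?_)
  simp only [planeExp, smul_eq_mul]
  rw [mul_comm]
  congr 2
  rw [inner_smul_right, inner_neg_left, real_inner_comm, mul_comm Complex.I]
  congr 2
  field_simp

/-- The average `∫ H(z) f(x - r z) dz`. -/
def lowPass (H : SchwartzMap E2 ℂ) (r : ℝ) (f : E2 → ℂ) (x : E2) : ℂ :=
  ∫ z, H z * f (x - r • z)

lemma integrable_lowPass (H : SchwartzMap E2 ℂ) (r : ℝ) {f : E2 → ℂ} (hf : Continuous f) {A : ℝ}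
    (hA : ∀ x, ‖f x‖ ≤ A) (x : E2) : Integrable fun z => H z * f (x - r • z) := by
  refine H.integrable.mul_bdd (c := A) (by fun_prop) (Filter.Eventually.of_forall fun z => hA _)

lemma norm_lowPass_le (H : SchwartzMap E2 ℂ) (r : ℝ) {f : E2 → ℂ} {A : ℝ}
    (hA : ∀ x, ‖f x‖ ≤ A) (x : E2) : ‖lowPass H r f x‖ ≤ A * ∫ z, ‖H z‖ := by
  rw [lowPass, ← integral_const_mul]
  refine norm_integral_le_of_norm_le (H.integrable.norm.const_mul A)
    (Filter.Eventually.of_forall fun z => ?_)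
  rw [norm_mul, mul_comm]
  exact mul_le_mul_of_nonneg_right (hA _) (norm_nonneg _)

lemma LittlewoodPaley.finite_support (θ : LittlewoodPaley) {r : ℝ} (hr : 0 < r) :
    {n : Fin 2 → ℤ | θ.toFun (r • freq n) ≠ 0}.Finite := by
  obtain ⟨B, hB⟩ := exists_nat_ge (4 / 3 / r)
  refine (Set.finite_Icc (fun _ : Fin 2 => -(B : ℤ)) (fun _ => (B : ℤ))).subset fun n hn => ?_
  have h1 : ‖r • freq n‖ < 4 / 3 := by
    by_contra h
    exact hn (θ.eq_zero _ (not_lt.1 h))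
  rw [norm_smul, Real.norm_of_nonneg hr.le] at h1
  have h2 : ∀ i, |(n i : ℝ)| ≤ B := by
    intro i
    have h3 : ‖freq n i‖ ≤ ‖freq n‖ := PiLp.norm_apply_le _ i
    have h4 : ‖freq n‖ < 4 / 3 / r := by
      rw [lt_div_iff₀ hr]; linarith
    have h5 : ‖freq n i‖ = |(n i : ℝ)| := by simp [freq]
    linarith
  refine ⟨fun i => ?_, fun i => ?_⟩
  · have := (abs_le.1 (h2 i)).1
    exact_mod_cast this
  · have := (abs_le.1 (h2 i)).2
    exact_mod_cast this

/-- On periodic functions the Fourier multiplier with symbol `θ(r ·)` is the convolution with the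
rescaled kernel of `θ`. -/
lemma LittlewoodPaley.hasSum_lowPass (θ : LittlewoodPaley) {H : SchwartzMap E2 ℂ}
    (hH : ∀ ξ : E2, ∫ z, H z * planeExp (-ξ) z = (θ.toFun ξ : ℂ)) {r : ℝ} (hr : 0 < r)
    {f : E2 → ℂ} (hf : Continuous f) (hper : Periodic2 f) (x : E2) :
    HasSum (fun n => (θ.toFun (r • freq n) : ℂ) * fourierCoefC f n * planeExp (freq n) x)
      (lowPass H r f x) := by
  set S := (θ.finite_support hr).toFinset with hS
  have hz : ∀ n ∉ S, θ.toFun (r • freq n) = 0 := by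
    intro n hn
    by_contra h
    exact hn ((θ.finite_support hr).mem_toFinset.2 h)
  suffices h : lowPass H r f x =
      ∑ n ∈ S, (θ.toFun (r • freq n) : ℂ) * fourierCoefC f n * planeExp (freq n) x by
    rw [h]
    exact hasSum_sum_of_ne_finset_zero fun n hn => by simp [hz n hn]
  suffices h : (∃ A, ∀ y, ‖f y‖ ≤ A) ∧ lowPass H r f x =
      ∑ n ∈ S, (θ.toFun (r • freq n) : ℂ) * fourierCoefC f n * planeExp (freq n) x from h.2
  refine hper.trig_induction (P := fun f => (∃ A, ∀ y, ‖f y‖ ≤ A) ∧ lowPass H r f x =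
      ∑ n ∈ S, (θ.toFun (r • freq n) : ℂ) * fourierCoefC f n * planeExp (freq n) x) ?_ ?_ ?_ ?_ hf
  · intro m
    refine ⟨⟨1, fun y => (norm_planeExp _ _).le⟩, ?_⟩
    simp only [fourierCoefC_planeExp, mul_ite, mul_one, mul_zero, ite_mul, zero_mul,
      Finset.sum_ite_eq]
    have h1 : lowPass H r (planeExp (freq m)) x =
        (θ.toFun (r • freq m) : ℂ) * planeExp (freq m) x := by
      rw [lowPass, ← hH, ← integral_mul_const]
      refine integral_congr_ae (Filter.Eventually.of_forall fun z => ?_)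
      simp only [planeExp_sub]
      have : planeExp (-freq m) (r • z) = planeExp (-(r • freq m)) z := by
        simp [planeExp, inner_smul_left, inner_smul_right]
      rw [this]
      ring
    split_ifs with hm
    · exact h1
    · rw [h1, hz m hm]; simp
  · rintro f g hf hg ⟨⟨A, hA⟩, hf1⟩ ⟨⟨B, hB⟩, hg1⟩
    refine ⟨⟨A + B, fun x => (norm_add_le _ _).trans (add_le_add (hA x) (hB x))⟩, ?_⟩
    simp only [fourierCoefC_add hf hg, mul_add, add_mul, Finset.sum_add_distrib]
    rw [← hf1, ← hg1, lowPass, lowPass, lowPass,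
      ← integral_add (integrable_lowPass H r hf hA x) (integrable_lowPass H r hg hB x)]
    simp only [mul_add]
  · rintro c f hf ⟨⟨A, hA⟩, hf1⟩
    refine ⟨⟨‖c‖ * A, fun x => by
      rw [norm_mul]; exact mul_le_mul_of_nonneg_left (hA x) (norm_nonneg _)⟩, ?_⟩
    have h1 : lowPass H r (fun x => c * f x) x = c * lowPass H r f x := by
      rw [lowPass, lowPass, ← integral_const_mul]
      refine integral_congr_ae (Filter.Eventually.of_forall fun z => ?_)
      ring
    rw [h1, hf1, Finset.mul_sum]
    refine Finset.sum_congr rfl fun n _ => ?_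
    rw [fourierCoefC_smul]
    ring
  · intro f hf h
    have hbd : ∃ A, ∀ y, ‖f y‖ ≤ A := by
      obtain ⟨g, -, ⟨⟨A, hA⟩, -⟩, hfg⟩ := h 1 one_pos
      refine ⟨1 + A, fun x => ?_⟩
      have := norm_add_le (f x - g x) (g x)
      rw [sub_add_cancel] at this
      exact this.trans (add_le_add (hfg x) (hA x))
    refine ⟨hbd, ?_⟩
    obtain ⟨A, hA⟩ := hbd
    set c1 := ∫ z, ‖H z‖ with hc1
    set c2 := ∑ n ∈ S, |θ.toFun (r • freq n)| with hc2
    have hc1' : 0 ≤ c1 := integral_nonneg fun _ => norm_nonneg _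
    have hc2' : 0 ≤ c2 := Finset.sum_nonneg fun _ _ => abs_nonneg _
    rw [← sub_eq_zero, ← norm_le_zero_iff]
    refine le_of_forall_pos_le_add fun ε hε => ?_
    obtain ⟨g, hg, ⟨⟨B, hB⟩, hg1⟩, hfg⟩ := h (ε / (c1 + c2 + 1)) (by positivity)
    have hfg' : Continuous fun y => f y - g y := hf.sub hg
    have e1 : lowPass H r f x = lowPass H r (fun y => f y - g y) x + lowPass H r g x := by
      rw [lowPass, lowPass, lowPass, ← integral_add (integrable_lowPass H r hfg' hfg x)
        (integrable_lowPass H r hg hB x)]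
      refine integral_congr_ae (Filter.Eventually.of_forall fun z => ?_)
      ring
    have e2 : ∀ n, fourierCoefC f n = fourierCoefC (fun y => f y - g y) n + fourierCoefC g n := by
      intro n
      rw [← fourierCoefC_add hfg' hg]
      simp only [sub_add_cancel]
    rw [e1, hg1]
    simp only [e2, mul_add, add_mul, Finset.sum_add_distrib]
    rw [add_sub_add_right_eq_sub, zero_add]
    refine (norm_sub_le _ _).trans ?_
    have h1 := norm_lowPass_le H r hfg x
    have h2 : ‖∑ n ∈ S, (θ.toFun (r • freq n) : ℂ) * fourierCoefC (fun y => f y - g y) n *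
        planeExp (freq n) x‖ ≤ c2 * (ε / (c1 + c2 + 1)) := by
      rw [hc2, Finset.sum_mul]
      refine norm_sum_le_of_le _ fun n _ => ?_
      rw [norm_mul, norm_mul, norm_planeExp, mul_one, Complex.norm_real, Real.norm_eq_abs]
      exact mul_le_mul_of_nonneg_left (norm_fourierCoefC_le hfg n) (abs_nonneg _)
    refine (add_le_add h1 h2).trans ?_
    have : ε / (c1 + c2 + 1) * c1 + c2 * (ε / (c1 + c2 + 1)) = ε * ((c1 + c2) / (c1 + c2 + 1)) := by
      ring
    rw [this]
    refine mul_le_of_le_one_right hε.le ((div_le_one (by positivity)).2 (by linarith))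

/-- The blocks `Δ_{j-1}` as convolution operators on complex functions. -/
def blockOp (H : SchwartzMap E2 ℂ) : ℕ → (E2 → ℂ) → E2 → ℂ
  | 0, f, x => lowPass H 1 f x
  | j + 1, f, x => lowPass H ((2 : ℝ) ^ (j + 1))⁻¹ f x - lowPass H ((2 : ℝ) ^ j)⁻¹ f x

lemma LittlewoodPaley.delta_eq_blockOp (θ : LittlewoodPaley) {H : SchwartzMap E2 ℂ}
    (hH : ∀ ξ : E2, ∫ z, H z * planeExp (-ξ) z = (θ.toFun ξ : ℂ))
    {f : E2 → ℝ} (hf : Continuous f) (hper : Periodic2 f) (j : ℕ) (x : E2) :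
    θ.delta j f x = blockOp H j (fun y => (f y : ℂ)) x := by
  have hf' : Continuous fun y => (f y : ℂ) := by fun_prop
  have hper' : Periodic2 fun y => (f y : ℂ) := fun i y => by simp only [hper i y]
  have key := fun (r : ℝ) (hr : 0 < r) => θ.hasSum_lowPass hH hr hf' hper' x
  simp only [fourierCoefC_ofReal] at key
  cases j with
  | zero =>
    have := (key 1 one_pos).tsum_eq
    simp only [one_smul] at this
    exact this
  | succ j =>
    have := ((key _ (inv_pos.2 (pow_pos two_pos (j + 1)))).sub
      (key _ (inv_pos.2 (pow_pos two_pos j)))).tsum_eq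
    rw [blockOp, ← this, LittlewoodPaley.delta]
    congr 1
    funext n
    simp only [LittlewoodPaley.symbol, planeExp]
    push_cast
    ring

end

section

open MeasureTheory

/-! ### Bounds on Besov norms -/

/-- The `B^s_{∞,1}` norm computed with convolution operators; it makes sense without
periodicity. -/
def kernelBesov (H : SchwartzMap E2 ℂ) (s : ℝ) (f : E2 → ℝ) : ENNReal :=
  ∑' j : ℕ, ENNReal.ofReal ((2 : ℝ) ^ (((j : ℝ) - 1) * s)) *
    ⨆ x : E2, ‖blockOp H j (fun y => (f y : ℂ)) x‖ₑ

lemma LittlewoodPaley.besov_eq_kernelBesov (θ : LittlewoodPaley) {H : SchwartzMap E2 ℂ}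
    (hH : ∀ ξ : E2, ∫ z, H z * planeExp (-ξ) z = (θ.toFun ξ : ℂ)) (s : ℝ)
    {f : E2 → ℝ} (hf : Continuous f) (hper : Periodic2 f) :
    θ.besov s f = kernelBesov H s f := by
  simp only [LittlewoodPaley.besov, kernelBesov, θ.delta_eq_blockOp hH hf hper]

lemma lowPass_add (H : SchwartzMap E2 ℂ) (r : ℝ) {f g : E2 → ℝ} (hf : Continuous f)
    (hg : Continuous g) {A B : ℝ} (hA : ∀ x, ‖f x‖ ≤ A) (hB : ∀ x, ‖g x‖ ≤ B) (x : E2) :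
    lowPass H r (fun y => ((f y + g y : ℝ) : ℂ)) x =
      lowPass H r (fun y => (f y : ℂ)) x + lowPass H r (fun y => (g y : ℂ)) x := by
  rw [lowPass, lowPass, lowPass, ← integral_add
    (integrable_lowPass H r (by fun_prop : Continuous fun y => (f y : ℂ)) (A := A)
      (fun y => by simpa using hA y) x)
    (integrable_lowPass H r (by fun_prop : Continuous fun y => (g y : ℂ)) (A := B)
      (fun y => by simpa using hB y) x)]
  simp only [Complex.ofReal_add, mul_add]

lemma blockOp_add (H : SchwartzMap E2 ℂ) (j : ℕ) {f g : E2 → ℝ} (hf : Continuous f)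
    (hg : Continuous g) {A B : ℝ} (hA : ∀ x, ‖f x‖ ≤ A) (hB : ∀ x, ‖g x‖ ≤ B) (x : E2) :
    blockOp H j (fun y => ((f y + g y : ℝ) : ℂ)) x =
      blockOp H j (fun y => (f y : ℂ)) x + blockOp H j (fun y => (g y : ℂ)) x := by
  cases j with
  | zero => exact lowPass_add H 1 hf hg hA hB x
  | succ j =>
    simp only [blockOp, lowPass_add H _ hf hg hA hB x]
    ring

lemma kernelBesov_add_le (H : SchwartzMap E2 ℂ) (s : ℝ) {f g : E2 → ℝ} (hf : Continuous f)
    (hg : Continuous g) {A B : ℝ} (hA : ∀ x, ‖f x‖ ≤ A) (hB : ∀ x, ‖g x‖ ≤ B) :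
    kernelBesov H s (fun y => f y + g y) ≤ kernelBesov H s f + kernelBesov H s g := by
  rw [kernelBesov, kernelBesov, kernelBesov, ← ENNReal.tsum_add]
  refine ENNReal.tsum_le_tsum fun j => ?_
  rw [← mul_add]
  refine mul_le_mul_right ?_ _
  refine iSup_le fun x => ?_
  rw [blockOp_add H j hf hg hA hB x]
  exact (enorm_add_le _ _).trans (add_le_add (le_iSup (fun x => ‖blockOp H j
    (fun y => (f y : ℂ)) x‖ₑ) x) (le_iSup (fun x => ‖blockOp H j (fun y => (g y : ℂ)) x‖ₑ) x))

/-- Summation of a sequence that grows geometrically up to an index `J` and decays geometrically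
from there on. -/
lemma tsum_le_of_geometric_peak {τ : ℝ} (hτ : 1 < τ) {b : ℕ → ENNReal} {X : ℝ} (hX : 0 ≤ X)
    (J : ℕ) (h1 : ∀ j, j < J → b j ≤ ENNReal.ofReal (X * (τ ^ j / τ ^ J)))
    (h2 : ∀ j, J ≤ j → b j ≤ ENNReal.ofReal (X * (τ ^ J / τ ^ j))) :
    ∑' j, b j ≤ ENNReal.ofReal (2 * τ / (τ - 1) * X) := by
  have hτ0 : 0 < τ := by linarith
  have hτ1 : 0 < τ - 1 := by linarith
  have e1 : ∑ j ∈ Finset.range J, b j ≤ ENNReal.ofReal (X * (τ / (τ - 1))) := by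
    refine (Finset.sum_le_sum fun j hj => h1 j (Finset.mem_range.1 hj)).trans ?_
    rw [← ENNReal.ofReal_sum_of_nonneg (fun j _ => by positivity)]
    refine ENNReal.ofReal_le_ofReal ?_
    rw [← Finset.mul_sum, ← Finset.sum_div]
    refine mul_le_mul_of_nonneg_left ?_ hX
    rw [geom_sum_eq hτ.ne', div_div, div_le_div_iff₀ (by positivity) hτ1]
    have : 0 < τ ^ J := by positivity
    nlinarith [mul_pos hτ1 this, mul_pos (mul_pos hτ1 this) hτ1]
  have e2 : ∑' j, b (j + J) ≤ ENNReal.ofReal (X * (τ / (τ - 1))) := by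
    have hg : HasSum (fun j : ℕ => X * τ⁻¹ ^ j) (X * (1 - τ⁻¹)⁻¹) :=
      (hasSum_geometric_of_lt_one (by positivity) (inv_lt_one_of_one_lt₀ hτ)).mul_left X
    have hv : (1 - τ⁻¹)⁻¹ = τ / (τ - 1) := by
      field_simp
    rw [hv] at hg
    rw [← hg.tsum_eq, ENNReal.ofReal_tsum_of_nonneg (fun j => by positivity) hg.summable]
    refine ENNReal.tsum_le_tsum fun j => (h2 (j + J) (Nat.le_add_left _ _)).trans ?_
    refine ENNReal.ofReal_le_ofReal (le_of_eq ?_)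
    rw [pow_add, inv_pow]
    field_simp
  rw [← (ENNReal.summable (f := fun j => b (j + J))).sum_add_tsum_nat_add']
  refine (add_le_add e1 e2).trans ?_
  rw [← ENNReal.ofReal_add (by positivity) (by positivity)]
  exact ENNReal.ofReal_le_ofReal (le_of_eq (by ring))

lemma norm_lowPass_pd_le (H : SchwartzMap E2 ℂ) {r : ℝ} (hr : 0 < r) {F : E2 → ℝ}
    (hF : ContDiff ℝ 1 F) {A B : ℝ} (hA : ∀ x, ‖F x‖ ≤ A) (hB : ∀ x, ‖fderiv ℝ F x‖ ≤ B)
    (i : Fin 2) (x : E2) :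
    ‖lowPass H r (fun y => ((pd i F y : ℝ) : ℂ)) x‖ ≤
      r⁻¹ * (A * ∫ z, ‖SchwartzMap.fderivCLM ℝ E2 ℂ H z‖) := by
  set v : E2 := EuclideanSpace.single i 1 with hv
  have hvn : ‖v‖ = 1 := by simp [hv]
  set f : E2 → ℂ := fun z => (F (x - r • z) : ℂ) with hf
  have hd : ∀ z, HasFDerivAt f (-(r • (Complex.ofRealCLM.comp (fderiv ℝ F (x - r • z))))) z := by
    intro z
    have h0 : HasFDerivAt (fun z : E2 => x - r • z) (-(r • ContinuousLinearMap.id ℝ E2)) z :=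
      ((hasFDerivAt_id z).const_smul r).const_sub x
    have h1 := ((hF.differentiable one_ne_zero (x - r • z)).hasFDerivAt).comp z h0
    have h2 := Complex.ofRealCLM.hasFDerivAt.comp z h1
    exact h2.congr_fderiv (by ext w; simp)
  have hfd : ∀ z, fderiv ℝ f z v = -(r : ℂ) * ((pd i F (x - r • z) : ℝ) : ℂ) := by
    intro z
    rw [(hd z).fderiv]
    simp [pd, hv]
  have hpb : ∀ y, ‖pd i F y‖ ≤ B := fun y => by
    refine ((fderiv ℝ F y).le_opNorm _).trans ?_
    rw [← hv, hvn, mul_one]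
    exact hB y
  have hpc : Continuous fun y => ((pd i F y : ℝ) : ℂ) := by
    have : Continuous fun y => pd i F y := (hF.continuous_fderiv one_ne_zero).clm_apply
      continuous_const
    fun_prop
  have hint := integrable_lowPass H r hpc (A := B) (fun y => by simpa using hpb y) x
  have hFc := hF.continuous
  have hdH : Integrable fun z => (fderiv ℝ H z) v := by
    have h := (SchwartzMap.fderivCLM ℝ E2 ℂ H).integrable (μ := volume)
    exact h.apply_continuousLinearMap v
  have hle : ∀ z, ‖(fderiv ℝ H z) v * f z‖ ≤ A * ‖SchwartzMap.fderivCLM ℝ E2 ℂ H z‖ := by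
    intro z
    rw [norm_mul, mul_comm]
    refine mul_le_mul (by simpa [hf] using hA (x - r • z)) ?_ (norm_nonneg _)
      ((norm_nonneg _).trans (hA 0))
    refine ((fderiv ℝ H z).le_opNorm _).trans ?_
    rw [hvn, mul_one]
    exact le_rfl
  have hparts := integral_mul_fderiv_eq_neg_fderiv_mul_of_integrable (μ := volume)
    (f := fun z => H z) (g := f) (v := v)
    (by
      refine hdH.mul_bdd (c := A) (by fun_prop) (Filter.Eventually.of_forall fun z => ?_)
      simpa [hf] using hA (x - r • z))
    (by
      simp only [hfd]
      have h := hint.const_mul (-(r : ℂ))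
      refine h.congr (Filter.Eventually.of_forall fun z => ?_)
      ring)
    (by
      exact integrable_lowPass H r (by fun_prop : Continuous fun y => (F y : ℂ)) (A := A)
        (fun y => by simpa using hA y) x)
    (fun z _ => H.differentiableAt) (fun z _ => (hd z).differentiableAt)
  simp only [hfd] at hparts
  have h1 : ∫ z, H z * (-(r : ℂ) * ((pd i F (x - r • z) : ℝ) : ℂ)) =
      -(r : ℂ) * lowPass H r (fun y => ((pd i F y : ℝ) : ℂ)) x := by
    rw [lowPass, ← integral_const_mul]
    refine integral_congr_ae (Filter.Eventually.of_forall fun z => ?_)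
    ring
  rw [h1] at hparts
  have hr' : (r : ℂ) ≠ 0 := by exact_mod_cast hr.ne'
  have h2 : lowPass H r (fun y => ((pd i F y : ℝ) : ℂ)) x =
      (r : ℂ)⁻¹ * ∫ z, (fderiv ℝ H z) v * f z := by
    have h3 := congrArg (fun w => -(r : ℂ)⁻¹ * w) hparts
    simp only [neg_mul_neg, ← mul_assoc, inv_mul_cancel₀ hr', one_mul] at h3
    exact h3
  rw [h2, norm_mul, norm_inv, Complex.norm_real, Real.norm_of_nonneg hr.le, ← integral_const_mul]
  refine mul_le_mul_of_nonneg_left ?_ (inv_nonneg.2 hr.le)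
  exact norm_integral_le_of_norm_le
    (((SchwartzMap.fderivCLM ℝ E2 ℂ H).integrable (μ := volume)).norm.const_mul A)
    (Filter.Eventually.of_forall hle)

lemma norm_lowPass_sub_le (H : SchwartzMap E2 ℂ) (hH1 : ∫ z, H z = 1) {r : ℝ} (hr : 0 < r)
    {f : E2 → ℝ} (hf : Differentiable ℝ f) {A B : ℝ} (hA : ∀ x, ‖f x‖ ≤ A)
    (hB : ∀ x, ‖fderiv ℝ f x‖ ≤ B) (x : E2) :
    ‖lowPass H r (fun y => (f y : ℂ)) x - f x‖ ≤ r * B * ∫ z, ‖z‖ * ‖H z‖ := by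
  have hfc := hf.continuous
  have h1 : lowPass H r (fun y => (f y : ℂ)) x - f x =
      ∫ z, H z * ((f (x - r • z) - f x : ℝ) : ℂ) := by
    have h2 : (f x : ℂ) = ∫ z, H z * (f x : ℂ) := by rw [integral_mul_const, hH1, one_mul]
    rw [h2, lowPass, ← integral_sub (integrable_lowPass H r
      (by fun_prop : Continuous fun y => (f y : ℂ)) (A := A) (fun y => by simpa using hA y) x)
      (H.integrable.mul_const _)]
    refine integral_congr_ae (Filter.Eventually.of_forall fun z => ?_)
    push_cast
    ring
  rw [h1, ← integral_const_mul]
  refine norm_integral_le_of_norm_le ?_ (Filter.Eventually.of_forall fun z => ?_)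
  · have := (H.integrable_pow_mul volume 1).const_mul (r * B)
    simpa using this
  · rw [norm_mul, Complex.norm_real]
    have h3 := Convex.norm_image_sub_le_of_norm_fderiv_le (𝕜 := ℝ) (f := f) (s := Set.univ)
      (x := x) (y := x - r • z) (C := B) (fun y _ => hf y) (fun y _ => hB y) convex_univ
      trivial trivial
    have h4 : ‖x - r • z - x‖ = r * ‖z‖ := by
      rw [sub_sub_cancel_left, norm_neg, norm_smul, Real.norm_of_nonneg hr.le]
    rw [h4] at h3
    nlinarith [norm_nonneg (H z)]

/-- The three basic estimates on dyadic blocks: they are bounded, they gain `2⁻ʲ` on functions with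
bounded gradient, and lose `2ʲ` on divergences of bounded vector fields. -/
lemma exists_blockOp_bound (H : SchwartzMap E2 ℂ) (hH1 : ∫ z, H z = 1) :
    ∃ c : ℝ, 0 < c ∧
      (∀ (f : E2 → ℝ) (A : ℝ), (∀ x, ‖f x‖ ≤ A) → ∀ j x,
        ‖blockOp H j (fun y => (f y : ℂ)) x‖ ≤ c * A) ∧
      (∀ (f : E2 → ℝ) (B : ℝ), Differentiable ℝ f → (∀ x, ‖f x‖ ≤ B) →
        (∀ x, ‖fderiv ℝ f x‖ ≤ B) → ∀ j x,
        ‖blockOp H j (fun y => (f y : ℂ)) x‖ ≤ c * (B / 2 ^ j)) ∧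
      (∀ (F : Fin 2 → E2 → ℝ) (A B : ℝ), (∀ i, ContDiff ℝ 1 (F i)) → (∀ i x, ‖F i x‖ ≤ A) →
        (∀ i x, ‖fderiv ℝ (F i) x‖ ≤ B) → ∀ j x,
        ‖blockOp H j (fun y => ((pd 0 (F 0) y + pd 1 (F 1) y : ℝ) : ℂ)) x‖ ≤ c * (A * 2 ^ j)) := by
  set a := ∫ z, ‖H z‖ with ha
  set m := ∫ z, ‖z‖ * ‖H z‖ with hm
  set d := ∫ z, ‖SchwartzMap.fderivCLM ℝ E2 ℂ H z‖ with hd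
  have ha0 : 0 ≤ a := integral_nonneg fun _ => norm_nonneg _
  have hm0 : 0 ≤ m := integral_nonneg fun _ => mul_nonneg (norm_nonneg _) (norm_nonneg _)
  have hd0 : 0 ≤ d := integral_nonneg fun _ => norm_nonneg _
  refine ⟨2 * a + 3 * m + 4 * d + 1, by positivity, ?_, ?_, ?_⟩
  · intro f A hA j x
    have hA0 : 0 ≤ A := (norm_nonneg _).trans (hA 0)
    have h := fun r => norm_lowPass_le H r (f := fun y => (f y : ℂ)) (A := A)
      (fun y => by simpa using hA y) x
    have h2 : ‖blockOp H j (fun y => (f y : ℂ)) x‖ ≤ A * a + A * a := by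
      cases j with
      | zero => exact (h 1).trans (le_add_of_nonneg_left (by positivity))
      | succ j => exact (norm_sub_le _ _).trans (add_le_add (h _) (h _))
    refine h2.trans ?_
    nlinarith [mul_nonneg hA0 hm0, mul_nonneg hA0 hd0]
  · intro f B hf hA hB j x
    have hB0 : 0 ≤ B := (norm_nonneg _).trans (hA 0)
    cases j with
    | zero =>
      have h := norm_lowPass_le H 1 (f := fun y => (f y : ℂ)) (A := B)
        (fun y => by simpa using hA y) x
      refine h.trans ?_
      rw [pow_zero, div_one]
      nlinarith [mul_nonneg hB0 hm0, mul_nonneg hB0 hd0, mul_nonneg hB0 ha0]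
    | succ j =>
      have h := fun (r : ℝ) (hr : 0 < r) => norm_lowPass_sub_le H hH1 hr hf hA hB x
      have h1 := h _ (inv_pos.2 (pow_pos two_pos (j + 1)))
      have h2 := h _ (inv_pos.2 (pow_pos two_pos j))
      have h3 := (norm_sub_le _ _).trans (add_le_add h1 h2)
      rw [sub_sub_sub_cancel_right] at h3
      refine h3.trans ?_
      have h4 : ((2 : ℝ) ^ (j + 1))⁻¹ * B * m + ((2 : ℝ) ^ j)⁻¹ * B * m =
          3 * m * (B / 2 ^ (j + 1)) := by
        rw [pow_succ]; field_simp; ring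
      rw [← hm, h4]
      refine mul_le_mul_of_nonneg_right ?_ (by positivity)
      linarith
  · intro F A B hF hA hB j x
    have hA0 : 0 ≤ A := (norm_nonneg _).trans (hA 0 0)
    have hpb : ∀ i y, ‖pd i (F i) y‖ ≤ B := fun i y => by
      refine ((fderiv ℝ (F i) y).le_opNorm _).trans ?_
      rw [show ‖(EuclideanSpace.single i 1 : E2)‖ = 1 by simp, mul_one]
      exact hB i y
    have hpc : ∀ i, Continuous fun y => pd i (F i) y := fun i =>
      ((hF i).continuous_fderiv one_ne_zero).clm_apply continuous_const
    have h : ∀ r : ℝ, 0 < r → ‖lowPass H r (fun y => ((pd 0 (F 0) y + pd 1 (F 1) y : ℝ) : ℂ)) x‖ ≤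
        r⁻¹ * (2 * (A * d)) := by
      intro r hr
      rw [lowPass_add H r (hpc 0) (hpc 1) (hpb 0) (hpb 1)]
      refine (norm_add_le _ _).trans ((add_le_add
        (norm_lowPass_pd_le H hr (hF 0) (hA 0) (hB 0) 0 x)
        (norm_lowPass_pd_le H hr (hF 1) (hA 1) (hB 1) 1 x)).trans (le_of_eq ?_))
      ring
    have hAd : 0 ≤ A * d := mul_nonneg hA0 hd0
    have h2 : ‖blockOp H j (fun y => ((pd 0 (F 0) y + pd 1 (F 1) y : ℝ) : ℂ)) x‖ ≤
        4 * d * (A * 2 ^ j) := by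
      cases j with
      | zero =>
        refine (h 1 one_pos).trans ?_
        rw [inv_one, pow_zero]
        linarith
      | succ j =>
        have h3 := (norm_sub_le _ _).trans (add_le_add
          (h _ (inv_pos.2 (pow_pos two_pos (j + 1)))) (h _ (inv_pos.2 (pow_pos two_pos j))))
        refine h3.trans ?_
        rw [inv_inv, inv_inv, pow_succ]
        have : (0 : ℝ) < 2 ^ j := by positivity
        nlinarith [mul_nonneg hAd this.le]
    refine h2.trans (mul_le_mul_of_nonneg_right ?_ (by positivity))
    linarith

lemma iSup_enorm_le {f : E2 → ℂ} {A : ℝ} (h : ∀ x, ‖f x‖ ≤ A) :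
    ⨆ x, ‖f x‖ₑ ≤ ENNReal.ofReal A :=
  iSup_le fun x => by
    rw [← ofReal_norm]
    exact ENNReal.ofReal_le_ofReal (h x)

lemma two_rpow_weight (j : ℕ) :
    (2 : ℝ) ^ (((j : ℝ) - 1) * (-(1 / 2))) = Real.sqrt 2 / Real.sqrt 2 ^ j := by
  have h2 : Real.sqrt 2 = (2 : ℝ) ^ (1 / 2 : ℝ) := Real.sqrt_eq_rpow 2
  rw [h2, ← Real.rpow_natCast, ← Real.rpow_mul two_pos.le, ← Real.rpow_sub two_pos]
  congr 1
  ring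

lemma one_lt_sqrt_two : (1 : ℝ) < Real.sqrt 2 := by
  rw [Real.lt_sqrt zero_le_one]; norm_num

/-- Besov bounds for a function with bounds on its size and gradient, and for a divergence. In the
last two, `ρ` plays the role of a frequency: the function is of size `X`, its gradient of size
`X ρ`, and it is the divergence of a field of size `X / ρ`. -/
lemma exists_kernelBesov_bound (H : SchwartzMap E2 ℂ) (hH1 : ∫ z, H z = 1) :
    ∃ c : ℝ, 0 < c ∧
      (∀ (f : E2 → ℝ) (A : ℝ), (∀ x, ‖f x‖ ≤ A) →
        kernelBesov H (-(1 / 2)) f ≤ ENNReal.ofReal (c * A)) ∧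
      (∀ (f : E2 → ℝ) (A B Z : ℝ), Differentiable ℝ f → (∀ x, ‖f x‖ ≤ A) →
        (∀ x, ‖fderiv ℝ f x‖ ≤ B) → A ≤ B → 0 ≤ Z → A * B ≤ Z ^ 2 →
        kernelBesov H 0 f ≤ ENNReal.ofReal (c * Z)) ∧
      (∀ (F : Fin 2 → E2 → ℝ) (X ρ M : ℝ), (∀ i, ContDiff ℝ 1 (F i)) → 1 ≤ ρ →
        Differentiable ℝ (fun y => pd 0 (F 0) y + pd 1 (F 1) y) →
        (∀ i x, ‖F i x‖ ≤ X / ρ) → (∀ i x, ‖fderiv ℝ (F i) x‖ ≤ M) →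
        (∀ x, ‖pd 0 (F 0) x + pd 1 (F 1) x‖ ≤ X) →
        (∀ x, ‖fderiv ℝ (fun y => pd 0 (F 0) y + pd 1 (F 1) y) x‖ ≤ X * ρ) →
        kernelBesov H 0 (fun y => pd 0 (F 0) y + pd 1 (F 1) y) ≤ ENNReal.ofReal (c * X) ∧
        kernelBesov H (-(1 / 2)) (fun y => pd 0 (F 0) y + pd 1 (F 1) y) ≤
          ENNReal.ofReal (c * (X / Real.sqrt ρ))) := by
  obtain ⟨c, hc, h1, h2, h3⟩ := exists_blockOp_bound H hH1
  set τ := Real.sqrt 2 with hτ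
  have hτ1 : 1 < τ := one_lt_sqrt_two
  have hτ0 : 0 < τ := by linarith
  have hτ2 : τ ^ 2 = 2 := Real.sq_sqrt two_pos.le
  set k := 2 * τ / (τ - 1) with hk
  have hk1 : 4 ≤ k := by
    rw [hk, le_div_iff₀ (by linarith)]
    have : τ < 2 := by nlinarith
    linarith
  have hk2 : (2 : ℝ) * 2 / (2 - 1) ≤ k := by norm_num; exact hk1
  have hb2 : ∀ {b : ℕ → ENNReal} {X : ℝ}, 0 ≤ X → (J : ℕ) →
      (∀ j, j < J → b j ≤ ENNReal.ofReal (X * ((2 : ℝ) ^ j / 2 ^ J))) →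
      (∀ j, J ≤ j → b j ≤ ENNReal.ofReal (X * ((2 : ℝ) ^ J / 2 ^ j))) →
      ∑' j, b j ≤ ENNReal.ofReal (k * X) := fun hX J h1 h2 =>
    (tsum_le_of_geometric_peak one_lt_two hX J h1 h2).trans
      (ENNReal.ofReal_le_ofReal (mul_le_mul_of_nonneg_right hk2 hX))
  have hpow : ∀ j : ℕ, (2 : ℝ) ^ j = τ ^ j * τ ^ j := fun j => by
    rw [← mul_pow, ← sq, hτ2]
  refine ⟨k * (2 * c), by positivity, ?_, ?_, ?_⟩
  · intro f A hA
    have hA0 : 0 ≤ A := (norm_nonneg _).trans (hA 0)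
    rw [kernelBesov, mul_assoc]
    refine tsum_le_of_geometric_peak hτ1 (by positivity) 0 (fun j hj => absurd hj (by omega))
      fun j _ => ?_
    refine (mul_le_mul_right (iSup_enorm_le (h1 f A hA j)) _).trans ?_
    rw [← ENNReal.ofReal_mul (by positivity), two_rpow_weight]
    refine ENNReal.ofReal_le_ofReal ?_
    rw [pow_zero, div_mul_eq_mul_div, mul_div_assoc', mul_one]
    refine div_le_div_of_nonneg_right ?_ (by positivity)
    have : τ ≤ 2 := by nlinarith
    nlinarith [mul_nonneg hc.le hA0]
  · intro f A B Z hf hA hB hAB hZ hZ2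
    have hA0 : 0 ≤ A := (norm_nonneg _).trans (hA 0)
    rw [kernelBesov, mul_assoc]
    refine tsum_le_of_geometric_peak hτ1 (by positivity) 0 (fun j hj => absurd hj (by omega))
      fun j _ => ?_
    have hle : ∀ x, ‖blockOp H j (fun y => (f y : ℂ)) x‖ ≤ c * (Z / τ ^ j) := by
      intro x
      have e1 := h1 f A hA j x
      have e2 := h2 f B hf (fun x => (hA x).trans hAB) hB j x
      set N := ‖blockOp H j (fun y => (f y : ℂ)) x‖
      have hN : 0 ≤ N := norm_nonneg _
      refine abs_le_of_sq_le_sq' ?_ (by positivity) |>.2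
      have e3 : N * N ≤ (c * A) * (c * (B / 2 ^ j)) :=
        mul_le_mul e1 e2 hN (by positivity)
      have e4 : (c * A) * (c * (B / 2 ^ j)) = c ^ 2 * (A * B) / 2 ^ j := by ring
      have e5 : (c * (Z / τ ^ j)) ^ 2 = c ^ 2 * Z ^ 2 / 2 ^ j := by
        rw [hpow]; field_simp
      rw [e5, sq]
      rw [e4] at e3
      refine e3.trans (div_le_div_of_nonneg_right ?_ (by positivity))
      exact mul_le_mul_of_nonneg_left hZ2 (by positivity)
    refine (mul_le_mul_right (iSup_enorm_le hle) _).trans ?_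
    rw [mul_zero, Real.rpow_zero, ENNReal.ofReal_one, one_mul]
    refine ENNReal.ofReal_le_ofReal ?_
    rw [pow_zero]
    have : 0 ≤ c * (Z / τ ^ j) := by positivity
    calc c * (Z / τ ^ j) ≤ 2 * (c * (Z / τ ^ j)) := by linarith
      _ = _ := by ring
  · intro F X ρ M hF hρ hdiff hFX hFM hX hXρ
    have hX0 : 0 ≤ X := (norm_nonneg _).trans (hX 0)
    have hρ0 : 0 < ρ := by linarith
    constructor
    · obtain ⟨J, hJ1, hJ2⟩ := exists_nat_pow_near hρ one_lt_two
      rw [kernelBesov, mul_assoc]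
      refine hb2 (by positivity) J (fun j _ => ?_) fun j _ => ?_
      · refine (mul_le_mul_right (iSup_enorm_le (h3 F _ M hF hFX hFM j)) _).trans ?_
        rw [mul_zero, Real.rpow_zero, ENNReal.ofReal_one, one_mul]
        refine ENNReal.ofReal_le_ofReal ?_
        have : X / ρ * 2 ^ j ≤ X * (2 ^ j / 2 ^ J) := by
          rw [div_mul_eq_mul_div, mul_div_assoc]
          refine mul_le_mul_of_nonneg_left ?_ hX0
          exact div_le_div_of_nonneg_left (by positivity) (by positivity) hJ1
        have h4 := mul_le_mul_of_nonneg_left this hc.le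
        have h5 : 0 ≤ c * (X * ((2 : ℝ) ^ j / 2 ^ J)) := by positivity
        linarith
      · refine (mul_le_mul_right (iSup_enorm_le (h2 _ (X * ρ) hdiff
          (fun x => (hX x).trans (le_mul_of_one_le_right hX0 hρ)) hXρ j)) _).trans ?_
        rw [mul_zero, Real.rpow_zero, ENNReal.ofReal_one, one_mul]
        refine ENNReal.ofReal_le_ofReal ?_
        rw [pow_succ] at hJ2
        have : X * ρ / 2 ^ j ≤ 2 * (X * (2 ^ J / 2 ^ j)) := by
          rw [mul_div_assoc', mul_div_assoc']
          refine div_le_div_of_nonneg_right ?_ (by positivity)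
          nlinarith
        have h4 := mul_le_mul_of_nonneg_left this hc.le
        linarith
    · set σ := Real.sqrt ρ with hσ
      have hσ1 : 1 ≤ σ := by rw [hσ, Real.one_le_sqrt]; exact hρ
      have hσ0 : 0 < σ := by linarith
      have hσ2 : σ ^ 2 = ρ := Real.sq_sqrt hρ0.le
      obtain ⟨J, hJ1, hJ2⟩ := exists_nat_pow_near hσ1 hτ1
      rw [kernelBesov, mul_assoc]
      refine tsum_le_of_geometric_peak hτ1 (by positivity) J (fun j _ => ?_) fun j _ => ?_
      · refine (mul_le_mul_right (iSup_enorm_le (h3 F _ M hF hFX hFM j)) _).trans ?_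
        rw [← ENNReal.ofReal_mul (by positivity), two_rpow_weight]
        refine ENNReal.ofReal_le_ofReal ?_
        have e1 : τ / τ ^ j * (c * (X / ρ * 2 ^ j)) = τ * c * (X / σ) * (τ ^ j / σ) := by
          rw [hpow, ← hσ2]; field_simp
        have e2 : τ ^ j / σ ≤ τ ^ j / τ ^ J :=
          div_le_div_of_nonneg_left (by positivity) (by positivity) hJ1
        have e3 : τ * c * (X / σ) ≤ 2 * c * (X / σ) := by
          have : τ ≤ 2 := by nlinarith
          gcongr
        rw [e1]
        exact mul_le_mul e3 e2 (by positivity) (by positivity)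
      · refine (mul_le_mul_right (iSup_enorm_le (h1 _ X hX j)) _).trans ?_
        rw [← ENNReal.ofReal_mul (by positivity), two_rpow_weight]
        refine ENNReal.ofReal_le_ofReal ?_
        have e1 : τ / τ ^ j * (c * X) = τ * c * (X / σ) * (σ / τ ^ j) := by
          field_simp
        have e2 : σ / τ ^ j ≤ τ * (τ ^ J / τ ^ j) := by
          rw [mul_div_assoc']
          refine div_le_div_of_nonneg_right ?_ (by positivity)
          rw [pow_succ] at hJ2
          linarith
        rw [e1]
        calc τ * c * (X / σ) * (σ / τ ^ j) ≤ τ * c * (X / σ) * (τ * (τ ^ J / τ ^ j)) :=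
              mul_le_mul_of_nonneg_left e2 (by positivity)
          _ = τ ^ 2 * c * (X / σ) * (τ ^ J / τ ^ j) := by ring
          _ = _ := by rw [hτ2]

end

/-! ### The algebra of smooth functions of time and space -/

/-- Time and space. -/
abbrev ST : Type := ℝ × E2

/-- The algebra of smooth functions on space-time. -/
def smoothAlg : Subalgebra ℝ (ST → ℝ) where
  carrier := {f | ContDiff ℝ ∞ f}
  mul_mem' := fun {f g} (hf : ContDiff ℝ ∞ f) (hg : ContDiff ℝ ∞ g) => hf.mul hg
  add_mem' := fun {f g} (hf : ContDiff ℝ ∞ f) (hg : ContDiff ℝ ∞ g) => hf.add hg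
  algebraMap_mem' := fun c => (contDiff_const : ContDiff ℝ ∞ fun _ : ST => c)

/-- Smooth functions on space-time. -/
abbrev Sm : Type := smoothAlg

namespace Sm

lemma smooth (f : Sm) : ContDiff ℝ ∞ f.1 := f.2

lemma differentiable (f : Sm) : Differentiable ℝ f.1 := f.smooth.differentiable (by simp)

lemma continuous (f : Sm) : Continuous f.1 := f.smooth.continuous

@[ext] lemma ext {f g : Sm} (h : ∀ p, f.1 p = g.1 p) : f = g := Subtype.ext (funext h)

@[simp] lemma add_val (f g : Sm) (p : ST) : (f + g).1 p = f.1 p + g.1 p := rfl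
@[simp] lemma sub_val (f g : Sm) (p : ST) : (f - g).1 p = f.1 p - g.1 p := rfl
@[simp] lemma mul_val (f g : Sm) (p : ST) : (f * g).1 p = f.1 p * g.1 p := rfl
@[simp] lemma neg_val (f : Sm) (p : ST) : (-f).1 p = -f.1 p := rfl
@[simp] lemma smul_val (c : ℝ) (f : Sm) (p : ST) : (c • f).1 p = c * f.1 p := rfl
@[simp] lemma one_val (p : ST) : (1 : Sm).1 p = 1 := rfl

@[simp] lemma pow_val (f : Sm) (n : ℕ) (p : ST) : (f ^ n).1 p = f.1 p ^ n := by
  rw [SubmonoidClass.coe_pow, Pi.pow_apply]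

@[simp] lemma sum_val {ι : Type*} (s : Finset ι) (f : ι → Sm) (p : ST) :
    (∑ i ∈ s, f i).1 p = ∑ i ∈ s, (f i).1 p := by
  rw [AddSubmonoidClass.coe_finsetSum, Finset.sum_apply]

end Sm

/-- The derivative in a fixed direction of space-time. -/
def Dv (v : ST) : Derivation ℝ Sm Sm :=
  Derivation.mk'
    { toFun := fun f => ⟨fun p => fderiv ℝ f.1 p v,
        (f.smooth.fderiv_right (m := ∞) (by simp)).clm_apply contDiff_const⟩
      map_add' := fun f g => by
        ext p
        have h := fderiv_add (f.differentiable p) (g.differentiable p)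
        change fderiv ℝ (f.1 + g.1) p v = _
        rw [h]; rfl
      map_smul' := fun c f => by
        ext p
        have h := fderiv_const_smul (f.differentiable p) c
        change fderiv ℝ (c • f.1) p v = _
        rw [h]; rfl }
    (fun f g => by
      ext p
      have h := fderiv_mul (f.differentiable p) (g.differentiable p)
      change fderiv ℝ (f.1 * g.1) p v = _
      rw [h]; rfl)

lemma Dv_val (v : ST) (f : Sm) (p : ST) : (Dv v f).1 p = fderiv ℝ f.1 p v := rfl

lemma Dv_mul (v : ST) (f g : Sm) : Dv v (f * g) = f * Dv v g + g * Dv v f := by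
  rw [Derivation.leibniz, smul_eq_mul, smul_eq_mul]

lemma Dv_sq (v : ST) (f : Sm) : Dv v (f ^ 2) = 2 * f * Dv v f := by
  rw [sq, Dv_mul]; ring

lemma Dv_comm (v w : ST) (f : Sm) : Dv v (Dv w f) = Dv w (Dv v f) := by
  ext p
  have h : ∀ u, (Dv u f).1 = fun q => fderiv ℝ f.1 q u := fun u => rfl
  have hd : DifferentiableAt ℝ (fderiv ℝ f.1) p :=
    ((f.smooth.fderiv_right (m := ∞) (by simp)).differentiable (by simp)) p
  rw [Dv_val, Dv_val, h, h, fderiv_clm_apply hd (differentiableAt_const _),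
    fderiv_clm_apply hd (differentiableAt_const _)]
  simp only [fderiv_fun_const, Pi.zero_apply, ContinuousLinearMap.comp_zero, zero_add,
    ContinuousLinearMap.flip_apply]
  exact (f.smooth.contDiffAt.isSymmSndFDerivAt (by
    simpa using (ENat.LEInfty.out : (2 : WithTop ℕ∞) ≤ ∞))) v w

/-- A partial derivative in space. -/
abbrev dX (i : Fin 2) : Derivation ℝ Sm Sm := Dv (0, EuclideanSpace.single i 1)

/-- The time derivative. -/
abbrev dT : Derivation ℝ Sm Sm := Dv (1, 0)

/-- The derivative in a fixed space direction. -/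
abbrev dK (k : E2) : Derivation ℝ Sm Sm := Dv (0, k)

lemma dK_eq (k : E2) (f : Sm) : dK k f = k 0 • dX 0 f + k 1 • dX 1 f := by
  ext p
  simp only [Sm.add_val, Sm.smul_val, Dv_val]
  have h : ((0 : ℝ), k) = k 0 • ((0 : ℝ), (EuclideanSpace.single 0 1 : E2)) +
      k 1 • ((0 : ℝ), (EuclideanSpace.single 1 1 : E2)) := by
    ext i
    · simp
    · fin_cases i <;> simp
  rw [h, map_add, map_smul, map_smul, smul_eq_mul, smul_eq_mul]

/-- The Laplacian in space. -/
def Lap (f : Sm) : Sm := dX 0 (dX 0 f) + dX 1 (dX 1 f)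

lemma Lap_add (f g : Sm) : Lap (f + g) = Lap f + Lap g := by
  simp only [Lap, map_add]; ring

lemma Lap_smul (c : ℝ) (f : Sm) : Lap (c • f) = c • Lap f := by
  simp only [Lap, Derivation.map_smul, smul_add]

lemma Lap_sum {ι : Type*} (s : Finset ι) (f : ι → Sm) : Lap (∑ i ∈ s, f i) = ∑ i ∈ s, Lap (f i) := by
  simp only [Lap, map_sum, Finset.sum_add_distrib]

lemma Dv_Lap (v : ST) (f : Sm) : Dv v (Lap f) = Lap (Dv v f) := by
  simp only [Lap, map_add]
  rw [Dv_comm v, Dv_comm v _ (dX 1 f), Dv_comm v _ f, Dv_comm v _ f]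

/-! ### Restriction to a fixed time -/

lemma hasFDerivAt_slice (f : Sm) (t : ℝ) (x : E2) :
    HasFDerivAt (fun y => f.1 (t, y)) ((fderiv ℝ f.1 (t, x)).comp (ContinuousLinearMap.inr ℝ ℝ E2))
      x :=
  (f.differentiable (t, x)).hasFDerivAt.comp x (hasFDerivAt_prodMk_right t x)

lemma pd_slice (f : Sm) (t : ℝ) (i : Fin 2) (x : E2) :
    pd i (fun y => f.1 (t, y)) x = (dX i f).1 (t, x) := by
  rw [pd, (hasFDerivAt_slice f t x).fderiv]
  simp [Dv_val]

lemma contDiff_slice (f : Sm) (t : ℝ) : ContDiff ℝ ∞ fun y => f.1 (t, y) :=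
  f.smooth.comp (by fun_prop)

lemma lap_slice (f : Sm) (t : ℝ) (x : E2) : lap (fun y => f.1 (t, y)) x = (Lap f).1 (t, x) := by
  simp only [lap, Lap, Fin.sum_univ_two]
  have h : ∀ i, pd i (fun y => f.1 (t, y)) = fun y => (dX i f).1 (t, y) := fun i =>
    funext fun y => pd_slice f t i y
  rw [h, h, pd_slice, pd_slice]
  rfl

lemma hasDerivAt_time (f : Sm) (t : ℝ) (x : E2) :
    HasDerivAt (fun s => f.1 (s, x)) ((dT f).1 (t, x)) t := by
  have h := ((f.differentiable (t, x)).hasFDerivAt.comp t (hasFDerivAt_prodMk_left t x)).hasDerivAt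
  simpa [Dv_val] using! h

lemma norm_dir_le {v : E2} (hv : ‖v‖ ≤ 1) : ‖((0 : ℝ), v)‖ ≤ 1 := by
  simpa [Prod.norm_def] using hv

protected lemma SB.Dv {N : ℕ} {C D : ℝ} {f : Sm} (h : SB (N + 1) C D f.1) (hD : 0 ≤ D) {v : ST}
    (hv : ‖v‖ ≤ 1) : SB N (C * D) D (Dv v f).1 :=
  h.fderiv_apply v hv hD

lemma norm_dirX (i : Fin 2) : ‖((0 : ℝ), (EuclideanSpace.single i 1 : E2))‖ ≤ 1 :=
  norm_dir_le (by simp)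

protected lemma SB.dX {N : ℕ} {C D : ℝ} {f : Sm} (h : SB (N + 1) C D f.1) (hD : 0 ≤ D) (i : Fin 2) :
    SB N (C * D) D (dX i f).1 :=
  h.Dv hD (norm_dirX i)

protected lemma SB.Lap {N : ℕ} {C D : ℝ} {f : Sm} (h : SB (N + 2) C D f.1) (hD : 0 ≤ D) :
    SB N (2 * (C * D ^ 2)) D (Lap f).1 := by
  have := ((h.dX hD 0).dX hD 0).add ((h.dX hD 1).dX hD 1)
  refine this.mono_left hD (le_of_eq ?_)
  ring

lemma SB.norm_fderiv_slice_le {C D : ℝ} {f : Sm} (h : SB 1 C D f.1) (t : ℝ) (x : E2) :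
    ‖fderiv ℝ (fun y => f.1 (t, y)) x‖ ≤ C * D := by
  rw [(hasFDerivAt_slice f t x).fderiv]
  have h1 : ‖fderiv ℝ f.1 (t, x)‖ ≤ C * D := by
    have := h.bound 1 le_rfl (t, x)
    rwa [norm_iteratedFDeriv_one, pow_one] at this
  refine (ContinuousLinearMap.opNorm_comp_le _ _).trans ?_
  have h2 := ContinuousLinearMap.norm_inr_le_one ℝ ℝ E2
  nlinarith [norm_nonneg (fderiv ℝ f.1 (t, x)),
    norm_nonneg (ContinuousLinearMap.inr ℝ ℝ E2)]

/-! ### Plane waves, functions of time, functions of space -/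

/-- The plane wave `u(ξ · x)` with smooth profile `u`. -/
def wave (u : ℝ → ℝ) (hu : ContDiff ℝ ∞ u) (ξ : E2) : Sm :=
  ⟨fun p => u (inner ℝ ξ p.2), hu.comp (contDiff_const.inner ℝ contDiff_snd)⟩

/-- A smooth function of time. -/
def ofTime (u : ℝ → ℝ) (hu : ContDiff ℝ ∞ u) : Sm := ⟨fun p => u p.1, hu.comp contDiff_fst⟩

/-- A smooth function of space. -/
def ofSpace (χ : E2 → ℝ) (hχ : ContDiff ℝ ∞ χ) : Sm := ⟨fun p => χ p.2, hχ.comp contDiff_snd⟩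

/-- `cos (ξ · x)`. -/
def cosW (ξ : E2) : Sm := wave Real.cos Real.contDiff_cos ξ

/-- `sin (ξ · x)`. -/
def sinW (ξ : E2) : Sm := wave Real.sin Real.contDiff_sin ξ

lemma contDiff_deriv {u : ℝ → ℝ} (hu : ContDiff ℝ ∞ u) : ContDiff ℝ ∞ (deriv u) :=
  ((contDiff_succ_iff_deriv (n := ∞)).1 (by simpa using hu)).2.2

lemma dK_wave (u : ℝ → ℝ) (hu : ContDiff ℝ ∞ u) (ξ k : E2) :
    dK k (wave u hu ξ) = (inner ℝ ξ k : ℝ) • wave (deriv u) (contDiff_deriv hu) ξ := by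
  ext p
  have h1 : HasFDerivAt (fun q : ST => (inner ℝ ξ q.2 : ℝ))
      ((innerSL ℝ ξ).comp (ContinuousLinearMap.snd ℝ ℝ E2)) p :=
    ((innerSL ℝ ξ).comp (ContinuousLinearMap.snd ℝ ℝ E2)).hasFDerivAt
  have h2 := ((hu.differentiable (by simp)) (inner ℝ ξ p.2)).hasDerivAt.comp_hasFDerivAt p h1
  rw [Dv_val]
  change fderiv ℝ (u ∘ fun q : ST => (inner ℝ ξ q.2 : ℝ)) p (0, k) = _
  rw [h2.fderiv]
  simp [wave, mul_comm]

lemma inner_single (ξ : E2) (i : Fin 2) : (inner ℝ ξ (EuclideanSpace.single i 1) : ℝ) = ξ i := by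
  simp [EuclideanSpace.inner_single_right]

lemma dX_wave (u : ℝ → ℝ) (hu : ContDiff ℝ ∞ u) (ξ : E2) (i : Fin 2) :
    dX i (wave u hu ξ) = ξ i • wave (deriv u) (contDiff_deriv hu) ξ := by
  rw [← inner_single]
  exact dK_wave u hu ξ _

lemma dX_cosW (ξ : E2) (i : Fin 2) : dX i (cosW ξ) = -(ξ i • sinW ξ) := by
  rw [cosW, dX_wave]
  ext p
  simp [wave, sinW]

lemma dX_sinW (ξ : E2) (i : Fin 2) : dX i (sinW ξ) = ξ i • cosW ξ := by
  rw [sinW, dX_wave]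
  ext p
  simp [wave, cosW]

lemma dX_ofTime (u : ℝ → ℝ) (hu : ContDiff ℝ ∞ u) (i : Fin 2) : dX i (ofTime u hu) = 0 := by
  ext p
  have h2 := ((hu.differentiable (by simp)) p.1).hasDerivAt.comp_hasFDerivAt p
    (hasFDerivAt_fst (𝕜 := ℝ) (E := ℝ) (F := E2) (p := p))
  rw [Dv_val]
  change fderiv ℝ (u ∘ Prod.fst) p _ = _
  rw [h2.fderiv]
  simp

protected lemma SB.wave {N : ℕ} {C R : ℝ} {u : ℝ → ℝ} (h : SB N C 1 u) (hu : ContDiff ℝ ∞ u) {ξ : E2}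
    (hξ : ‖ξ‖ ≤ R) : SB N C R (wave u hu ξ).1 := by
  have := h.comp_clm zero_le_one ((innerSL ℝ ξ).comp (ContinuousLinearMap.snd ℝ ℝ E2)) (D' := R) (by
    refine (ContinuousLinearMap.opNorm_comp_le _ _).trans ?_
    rw [innerSL_apply_norm]
    have h2 := ContinuousLinearMap.norm_snd_le ℝ ℝ E2
    nlinarith [norm_nonneg ξ])
  rw [one_mul] at this
  exact this

protected lemma SB.cos (N : ℕ) : SB N 1 1 Real.cos := by
  refine ⟨Real.contDiff_cos, fun j _ x => ?_⟩
  rw [norm_iteratedFDeriv_eq_norm_iteratedDeriv, one_pow, mul_one, Real.norm_eq_abs]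
  exact Real.abs_iteratedDeriv_cos_le_one j x

protected lemma SB.sin (N : ℕ) : SB N 1 1 Real.sin := by
  refine ⟨Real.contDiff_sin, fun j _ x => ?_⟩
  rw [norm_iteratedFDeriv_eq_norm_iteratedDeriv, one_pow, mul_one, Real.norm_eq_abs]
  exact Real.abs_iteratedDeriv_sin_le_one j x

protected lemma SB.cosW (N : ℕ) {ξ : E2} {R : ℝ} (hξ : ‖ξ‖ ≤ R) : SB N 1 R (cosW ξ).1 :=
  (SB.cos N).wave _ hξ

protected lemma SB.sinW (N : ℕ) {ξ : E2} {R : ℝ} (hξ : ‖ξ‖ ≤ R) : SB N 1 R (sinW ξ).1 :=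
  (SB.sin N).wave _ hξ

/-! ### Periodicity in space -/

/-- Periodicity in space of a function on space-time. -/
def SPer (f : Sm) : Prop := ∀ t, Periodic2 fun x => f.1 (t, x)

namespace SPer

variable {f g : Sm}

protected lemma add (hf : SPer f) (hg : SPer g) : SPer (f + g) := fun t i x => by
  simp only [Sm.add_val, hf t i x, hg t i x]

protected lemma sub (hf : SPer f) (hg : SPer g) : SPer (f - g) := fun t i x => by
  simp only [Sm.sub_val, hf t i x, hg t i x]

protected lemma mul (hf : SPer f) (hg : SPer g) : SPer (f * g) := fun t i x => by
  simp only [Sm.mul_val, hf t i x, hg t i x]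

protected lemma pow (hf : SPer f) (n : ℕ) : SPer (f ^ n) := fun t i x => by
  simp only [Sm.pow_val, hf t i x]

protected lemma smul (c : ℝ) (hf : SPer f) : SPer (c • f) := fun t i x => by
  simp only [Sm.smul_val, hf t i x]

protected lemma neg (hf : SPer f) : SPer (-f) := fun t i x => by
  simp only [Sm.neg_val, hf t i x]

protected lemma sum {ι : Type*} {s : Finset ι} {f : ι → Sm} (hf : ∀ i ∈ s, SPer (f i)) :
    SPer (∑ i ∈ s, f i) := fun t i x => by
  simp only [Sm.sum_val]
  exact Finset.sum_congr rfl fun k hk => hf k hk t i x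

protected lemma Dv (hf : SPer f) (v : ST) : SPer (Dv v f) := fun t i x => by
  have h : (fun p : ST => f.1 (p + (0, EuclideanSpace.single i (2 * Real.pi)))) = f.1 := by
    funext p
    have h1 : p + (0, EuclideanSpace.single i (2 * Real.pi)) =
        (p.1, p.2 + EuclideanSpace.single i (2 * Real.pi)) := by
      ext <;> simp
    rw [h1]
    exact hf p.1 i p.2
  have h2 := fderiv_comp_add_right (𝕜 := ℝ) (f := f.1) (x := (t, x))
    ((0 : ℝ), (EuclideanSpace.single i (2 * Real.pi) : E2))
  rw [h] at h2
  simp only [Dv_val]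
  rw [h2]
  simp

protected lemma ofTime (u : ℝ → ℝ) (hu : ContDiff ℝ ∞ u) : SPer (ofTime u hu) := fun _ _ _ => rfl

lemma wave_of_periodic {u : ℝ → ℝ} (hu : ContDiff ℝ ∞ u) (hp : Function.Periodic u (2 * Real.pi))
    {ξ : E2} (hξ : ∀ i, ∃ n : ℤ, ξ i = n) : SPer (wave u hu ξ) := fun t i x => by
  obtain ⟨n, hn⟩ := hξ i
  simp only [wave, inner_add_right]
  have h : (inner ℝ ξ (EuclideanSpace.single i (2 * Real.pi)) : ℝ) = n * (2 * Real.pi) := by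
    rw [EuclideanSpace.inner_single_right, ← hn]
    simp
    ring
  rw [h]
  exact hp.int_mul n _

end SPer

section

open MeasureTheory

/-! ### Mollification -/

instance : (volume : Measure ST).IsAddHaarMeasure :=
  inferInstanceAs ((volume : Measure ℝ).prod (volume : Measure E2)).IsAddHaarMeasure

section Convolution

open scoped Convolution

/-- Derivatives of a convolution with a smooth compactly supported function fall on that
function. -/
lemma norm_iteratedFDeriv_convolution_le {f : ST → ℝ} (hf : Continuous f) {A : ℝ}
    (hA : ∀ p, ‖f p‖ ≤ A) (j : ℕ) : ∀ {F : Type} [NormedAddCommGroup F] [NormedSpace ℝ F]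
    [CompleteSpace F] {g : ST → F}, ContDiff ℝ ∞ g → HasCompactSupport g → ∀ p,
    ‖iteratedFDeriv ℝ j (f ⋆[ContinuousLinearMap.lsmul ℝ ℝ, volume] g) p‖ ≤
      A * ∫ z, ‖iteratedFDeriv ℝ j g z‖ := by
  induction j with
  | zero =>
    intro F _ _ _ g hg hc p
    simp only [norm_iteratedFDeriv_zero]
    have hi : Integrable g := hg.continuous.integrable_of_hasCompactSupport hc
    rw [convolution_def]
    have h1 : ∫ z, ‖g z‖ = ∫ z, ‖g (p - z)‖ :=
      (integral_sub_left_eq_self (fun z => ‖g z‖) volume p).symm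
    rw [h1, ← integral_const_mul]
    refine norm_integral_le_of_norm_le ((hi.comp_sub_left p).norm.const_mul A)
      (Filter.Eventually.of_forall fun z => ?_)
    simp only [ContinuousLinearMap.lsmul_apply, norm_smul]
    exact mul_le_mul_of_nonneg_right (hA z) (norm_nonneg _)
  | succ j ih =>
    intro F _ _ _ g hg hc p
    have h1 : fderiv ℝ (f ⋆[ContinuousLinearMap.lsmul ℝ ℝ, volume] g) =
        f ⋆[ContinuousLinearMap.lsmul ℝ ℝ, volume] (fderiv ℝ g) := by
      funext q
      rw [(hc.hasFDerivAt_convolution_right _ hf.locallyIntegrable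
        (hg.of_le (by exact_mod_cast le_top)) q).fderiv]
      rw [convolution_def, convolution_def]
      refine integral_congr_ae (Filter.Eventually.of_forall fun z => ?_)
      refine ContinuousLinearMap.ext fun w => ?_
      simp [ContinuousLinearMap.precompR_apply]
    rw [← norm_iteratedFDeriv_fderiv, h1]
    simp only [← norm_iteratedFDeriv_fderiv (f := g)]
    exact ih (hg.fderiv_right (by simp)) (hc.fderiv ℝ) p

end Convolution

namespace Mollifiers

variable (M : Mollifiers)

/-- The product kernel on space-time. -/
def kernel (z : ST) : ℝ := M.time z.1 * M.space z.2

lemma contDiff_kernel : ContDiff ℝ ∞ M.kernel :=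
  (M.time_smooth.comp contDiff_fst).mul (M.space_smooth.comp contDiff_snd)

lemma kernel_nonneg (z : ST) : 0 ≤ M.kernel z := mul_nonneg (M.time_nonneg _) (M.space_nonneg _)

lemma time_eq_zero {s : ℝ} (hs : s ∉ Set.Ioo (-1) 0) : M.time s = 0 :=
  image_eq_zero_of_notMem_tsupport fun h => hs (M.time_support h)

lemma space_eq_zero {x : E2} (hx : 1 ≤ ‖x‖) : M.space x = 0 :=
  image_eq_zero_of_notMem_tsupport fun h => by
    have := M.space_support h
    rw [mem_ball_zero_iff] at this
    linarith

lemma kernel_eq_zero {z : ST} (hz : 1 < ‖z‖) : M.kernel z = 0 := by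
  rw [Prod.norm_def, lt_max_iff] at hz
  rcases hz with h | h
  · rw [kernel, M.time_eq_zero, zero_mul]
    intro h1
    rw [Real.norm_eq_abs, lt_abs] at h
    rcases h with h | h <;> linarith [h1.1, h1.2]
  · rw [kernel, M.space_eq_zero h.le, mul_zero]

lemma hasCompactSupport_kernel : HasCompactSupport M.kernel :=
  HasCompactSupport.intro (isCompact_closedBall (0 : ST) 1) fun z hz =>
    M.kernel_eq_zero (by rwa [mem_closedBall_zero_iff, not_le] at hz)

lemma integrable_kernel : Integrable M.kernel :=
  M.contDiff_kernel.continuous.integrable_of_hasCompactSupport M.hasCompactSupport_kernel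

lemma integral_kernel : ∫ z, M.kernel z = 1 := by
  have h := integral_prod_mul (μ := (volume : Measure ℝ)) (ν := (volume : Measure E2))
    M.time M.space
  rw [M.time_integral, M.space_integral, one_mul] at h
  exact h

/-- The average of `f` over space-time with the kernel at scale `ℓ`. -/
def smear (ℓ : ℝ) (f : ST → ℝ) (p : ST) : ℝ := ∫ z, M.kernel z * f (p - ℓ • z)

lemma integrable_smear (ℓ : ℝ) {f : ST → ℝ} (hf : Continuous f) (p : ST) :
    Integrable fun z => M.kernel z * f (p - ℓ • z) := by
  refine Continuous.integrable_of_hasCompactSupport ?_ M.hasCompactSupport_kernel.mul_right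
  have := M.contDiff_kernel.continuous
  fun_prop

open scoped Convolution in
/-- Mollification at scale `ℓ` costs `ℓ⁻¹` for each derivative, whatever the smoothness of the
function. -/
lemma exists_smear_bound (N : ℕ) : ∃ c : ℝ, 0 < c ∧ ∀ (ℓ : ℝ) (f : ST → ℝ) (A : ℝ), 0 < ℓ →
    Continuous f → (∀ p, ‖f p‖ ≤ A) → SB N (c * A) ℓ⁻¹ (M.smear ℓ f) := by
  have hint : ∀ j, 0 ≤ ∫ z, ‖iteratedFDeriv ℝ j M.kernel z‖ := fun j =>
    integral_nonneg fun _ => norm_nonneg _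
  refine ⟨∑ j ∈ Finset.range (N + 1), (∫ z, ‖iteratedFDeriv ℝ j M.kernel z‖) + 1, by
    have := Finset.sum_nonneg fun j (_ : j ∈ Finset.range (N + 1)) => hint j
    linarith, fun ℓ f A hℓ hf hA => ?_⟩
  have hA0 : 0 ≤ A := (norm_nonneg _).trans (hA 0)
  set fl : ST → ℝ := fun q => f (ℓ • q) with hfl
  have hflc : Continuous fl := by fun_prop
  set g := fl ⋆[ContinuousLinearMap.lsmul ℝ ℝ, volume] M.kernel with hg
  have hgs : ContDiff ℝ ∞ g := M.hasCompactSupport_kernel.contDiff_convolution_right _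
    hflc.locallyIntegrable M.contDiff_kernel
  have hgb : SB N ((∑ j ∈ Finset.range (N + 1), (∫ z, ‖iteratedFDeriv ℝ j M.kernel z‖) + 1) * A) 1
      g := by
    refine ⟨hgs, fun j hj p => ?_⟩
    refine (norm_iteratedFDeriv_convolution_le hflc (fun q => hA _) j M.contDiff_kernel
      M.hasCompactSupport_kernel p).trans ?_
    rw [one_pow, mul_one, mul_comm]
    refine mul_le_mul_of_nonneg_right ?_ hA0
    have := Finset.single_le_sum (f := fun j => ∫ z, ‖iteratedFDeriv ℝ j M.kernel z‖)
      (fun i _ => hint i) (Finset.mem_range.2 (Nat.lt_succ_of_le hj))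
    linarith
  have heq : M.smear ℓ f = fun p => g ((ℓ⁻¹ • ContinuousLinearMap.id ℝ ST) p) := by
    funext p
    rw [smear, hg, convolution_def]
    simp only [smul_apply, ContinuousLinearMap.id_apply,
      ContinuousLinearMap.lsmul_apply, smul_eq_mul]
    rw [← integral_sub_left_eq_self _ volume (ℓ⁻¹ • p)]
    refine integral_congr_ae (Filter.Eventually.of_forall fun z => ?_)
    simp only [hfl, sub_sub_cancel, smul_sub, smul_smul, mul_inv_cancel₀ hℓ.ne', one_smul]
    rw [mul_comm]
  rw [heq]
  have := hgb.comp_clm zero_le_one (ℓ⁻¹ • ContinuousLinearMap.id ℝ ST) (D' := ℓ⁻¹) (by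
    rw [norm_smul, Real.norm_of_nonneg (inv_nonneg.2 hℓ.le)]
    exact mul_le_of_le_one_right (inv_nonneg.2 hℓ.le) ContinuousLinearMap.norm_id_le)
  rwa [one_mul] at this

/-- The mollification of a continuous bounded function. -/
def smearSm {ℓ : ℝ} (hℓ : 0 < ℓ) {f : ST → ℝ} (hf : Continuous f)
    (hA : ∃ A, ∀ p, ‖f p‖ ≤ A) : Sm :=
  ⟨M.smear ℓ f, by
    obtain ⟨A, hA⟩ := hA
    obtain ⟨c, -, h⟩ := M.exists_smear_bound 0
    exact (h ℓ f A hℓ hf hA).smooth⟩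

lemma abs_smear_sub_le {ℓ : ℝ} (hℓ : 0 < ℓ) {f : ST → ℝ} (hf : Differentiable ℝ f) {B : ℝ}
    (hB : ∀ p, ‖fderiv ℝ f p‖ ≤ B) (p : ST) : |M.smear ℓ f p - f p| ≤ ℓ * B := by
  have hfc := hf.continuous
  have hB0 : 0 ≤ B := (norm_nonneg _).trans (hB 0)
  have h1 : M.smear ℓ f p - f p = ∫ z, M.kernel z * (f (p - ℓ • z) - f p) := by
    have h2 : f p = ∫ z, M.kernel z * f p := by
      rw [integral_mul_const, M.integral_kernel, one_mul]
    conv_lhs => rw [h2]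
    rw [smear, ← integral_sub (M.integrable_smear ℓ hfc p) (M.integrable_kernel.mul_const _)]
    simp only [mul_sub]
  have h3 : ℓ * B = ∫ z, M.kernel z * (ℓ * B) := by
    rw [integral_mul_const, M.integral_kernel, one_mul]
  rw [h1, h3, ← Real.norm_eq_abs]
  refine norm_integral_le_of_norm_le (M.integrable_kernel.mul_const _)
    (Filter.Eventually.of_forall fun z => ?_)
  rw [norm_mul, Real.norm_of_nonneg (M.kernel_nonneg z)]
  by_cases hz : 1 < ‖z‖
  · simp [M.kernel_eq_zero hz]
  refine mul_le_mul_of_nonneg_left ?_ (M.kernel_nonneg z)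
  have h4 := Convex.norm_image_sub_le_of_norm_fderiv_le (𝕜 := ℝ) (f := f) (s := Set.univ)
    (x := p) (y := p - ℓ • z) (C := B) (fun y _ => hf y) (fun y _ => hB y) convex_univ
    trivial trivial
  have h5 : ‖p - ℓ • z - p‖ = ℓ * ‖z‖ := by
    rw [sub_sub_cancel_left, norm_neg, norm_smul, Real.norm_of_nonneg hℓ.le]
  rw [h5] at h4
  refine h4.trans ?_
  rw [mul_comm]
  refine mul_le_mul_of_nonneg_right ?_ hB0
  exact mul_le_of_le_one_right hℓ.le (not_lt.1 hz)

lemma fderiv_smear (ℓ : ℝ) {f : ST → ℝ} (hf : ContDiff ℝ ∞ f) {B : ℝ}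
    (hB : ∀ p, ‖fderiv ℝ f p‖ ≤ B) (p v : ST) :
    fderiv ℝ (M.smear ℓ f) p v = M.smear ℓ (fun q => fderiv ℝ f q v) p := by
  have hfd : Continuous (fderiv ℝ f) := hf.continuous_fderiv (by simp)
  have hk := M.contDiff_kernel.continuous
  have hfc := hf.continuous
  have hd : ∀ z q, HasFDerivAt (fun q => M.kernel z * f (q - ℓ • z))
      (M.kernel z • fderiv ℝ f (q - ℓ • z)) q := by
    intro z q
    have h1 := ((hf.differentiable (by simp) (q - ℓ • z)).hasFDerivAt).comp q
      ((hasFDerivAt_id q).sub_const (ℓ • z))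
    exact h1.const_mul (M.kernel z)
  have hFi : Integrable fun z => M.kernel z • fderiv ℝ f (p - ℓ • z) :=
    Continuous.integrable_of_hasCompactSupport (by fun_prop) M.hasCompactSupport_kernel.smul_right
  have h := hasFDerivAt_integral_of_dominated_of_fderiv_le (𝕜 := ℝ) (μ := (volume : Measure ST))
    (F := fun q z => M.kernel z * f (q - ℓ • z))
    (F' := fun q z => M.kernel z • fderiv ℝ f (q - ℓ • z)) (x₀ := p) (s := Set.univ)
    (bound := fun z => M.kernel z * B) Filter.univ_mem
    (Filter.Eventually.of_forall fun q => (M.integrable_smear ℓ hfc q).aestronglyMeasurable)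
    (M.integrable_smear ℓ hfc p) hFi.aestronglyMeasurable
    (Filter.Eventually.of_forall fun z q _ => by
      rw [norm_smul, Real.norm_of_nonneg (M.kernel_nonneg z)]
      exact mul_le_mul_of_nonneg_left (hB _) (M.kernel_nonneg z))
    (M.integrable_kernel.mul_const B)
    (Filter.Eventually.of_forall fun z q _ => hd z q)
  have h2 : fderiv ℝ (M.smear ℓ f) p = ∫ z, M.kernel z • fderiv ℝ f (p - ℓ • z) := h.fderiv
  rw [h2, ContinuousLinearMap.integral_apply hFi]
  rfl

/-- The amplitudes of the flows are mollifications in space-time; only nonnegative times enter. -/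
lemma amplitude_eq_smear {C₀ ℓ : ℝ} (hℓ : 0 < ℓ) {A : Matrix (Fin 2) (Fin 2) ℝ → ℝ}
    {R : ℝ → E2 → Matrix (Fin 2) (Fin 2) ℝ} {f : ST → ℝ} (hf : Continuous f)
    (h : ∀ s, 0 ≤ s → ∀ y, A (1 + (1 / (1000 * C₀)) • R s y) = f (s, y)) {t : ℝ} (ht : 0 ≤ t)
    (x : E2) : amplitude M C₀ ℓ A R t x = Real.sqrt (2000 * C₀) * M.smear ℓ f (t, x) := by
  rw [amplitude]
  congr 1
  have hin : ∀ s, 0 ≤ s → ∫ y : E2, A (1 + (1 / (1000 * C₀)) • R s (x - y)) * M.spaceScaled ℓ y =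
      ∫ y : E2, M.space y * f (s, x - ℓ • y) := by
    intro s hs
    have h1 := Measure.integral_comp_smul (volume : Measure E2)
      (fun y => M.space (ℓ⁻¹ • y) * f (s, x - y)) ℓ
    simp only [smul_smul, inv_mul_cancel₀ hℓ.ne', one_smul] at h1
    rw [h1, finrank_euclideanSpace_fin, abs_of_nonneg (by positivity), smul_eq_mul,
      ← integral_const_mul]
    refine integral_congr_ae (Filter.Eventually.of_forall fun y => ?_)
    simp only [h s hs, spaceScaled]
    ring
  have h2 : ∫ s in t..(t + ℓ), (∫ y : E2, A (1 + (1 / (1000 * C₀)) • R s (x - y)) *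
      M.spaceScaled ℓ y) * M.timeScaled ℓ (t - s) =
      ∫ s in t..(t + ℓ), (∫ y : E2, M.space y * f (s, x - ℓ • y)) * M.timeScaled ℓ (t - s) := by
    refine intervalIntegral.integral_congr fun s hs => ?_
    rw [Set.uIcc_of_le (by linarith)] at hs
    simp only [hin s (ht.trans hs.1)]
  rw [h2, intervalIntegral.integral_of_le (by linarith)]
  rw [setIntegral_eq_integral_of_forall_compl_eq_zero]
  swap
  · intro s hs
    have : M.timeScaled ℓ (t - s) = 0 := by
      rw [timeScaled, M.time_eq_zero, mul_zero]
      intro h3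
      apply hs
      have h4 := h3.1
      have h5 := h3.2
      rw [lt_div_iff₀ hℓ] at h4
      rw [div_lt_iff₀ hℓ] at h5
      constructor <;> linarith
    rw [this, mul_zero]
  set g : ℝ → ℝ := fun s => ∫ y : E2, M.space y * f (s, x - ℓ • y) with hg
  have h3 : ∫ s, g s * M.timeScaled ℓ (t - s) = ∫ τ, M.time τ * g (t - ℓ * τ) := by
    have e1 := integral_sub_left_eq_self (fun s => g s * M.timeScaled ℓ (t - s)) volume t
    have e2 := Measure.integral_comp_mul_left
      (fun s => g (t - s) * M.timeScaled ℓ (t - (t - s))) ℓ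
    rw [e1, abs_of_nonneg (inv_nonneg.2 hℓ.le), smul_eq_mul] at e2
    rw [eq_comm, inv_mul_eq_iff_eq_mul₀ hℓ.ne'] at e2
    rw [e2, ← integral_const_mul]
    refine integral_congr_ae (Filter.Eventually.of_forall fun τ => ?_)
    simp only [timeScaled, sub_sub_cancel]
    rw [mul_div_cancel_left₀ _ hℓ.ne']
    field_simp
  rw [h3, smear]
  have h4 := integral_prod (μ := (volume : Measure ℝ)) (ν := (volume : Measure E2))
    (fun z : ST => M.kernel z * f ((t, x) - ℓ • z)) (M.integrable_smear ℓ hf (t, x))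
  refine Eq.trans ?_ h4.symm
  refine integral_congr_ae (Filter.Eventually.of_forall fun τ => ?_)
  simp only [hg, kernel]
  rw [← integral_const_mul]
  refine integral_congr_ae (Filter.Eventually.of_forall fun y => ?_)
  simp [mul_assoc]

end Mollifiers

end

/-! ### Algebraic identities -/

/-- The rotated gradient `∇^⊥`. -/
def perp (f : Sm) : Fin 2 → Sm := ![dX 1 f, -dX 0 f]

lemma dX_one_zero (f : Sm) : dX 1 (dX 0 f) = dX 0 (dX 1 f) := Dv_comm _ _ f

lemma div_perp (f : Sm) : dX 0 (perp f 0) + dX 1 (perp f 1) = 0 := by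
  simp [perp, dX_one_zero]

/-- The Euler nonlinearity of `∇^⊥ Y` is a gradient up to the defect of `Y` from being an
eigenfunction of the Laplacian. -/
lemma div_perp_tensor (Y : Sm) (c : ℝ) (i : Fin 2) :
    dX 0 (perp Y i * perp Y 0) + dX 1 (perp Y i * perp Y 1) =
      dX i ((1 / 2 : ℝ) • (dX 0 Y ^ 2 + dX 1 Y ^ 2 + c • Y ^ 2)) -
        (Lap Y + c • Y) * dX i Y := by
  have hc := dX_one_zero Y
  fin_cases i
  · simp only [perp, Fin.zero_eta, Matrix.cons_val_zero, Matrix.cons_val_one,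
      Derivation.map_smul, map_add, Dv_sq, Dv_mul, Derivation.map_neg, hc, Lap]
    ext p
    simp only [Sm.add_val, Sm.sub_val, Sm.mul_val, Sm.neg_val, Sm.smul_val]
    have : (2 : Sm).1 p = 2 := rfl
    rw [this]
    ring
  · simp only [perp, Fin.mk_one, Matrix.cons_val_zero, Matrix.cons_val_one,
      Derivation.map_smul, map_add, Dv_sq, Dv_mul, Derivation.map_neg, hc, Lap]
    ext p
    simp only [Sm.add_val, Sm.sub_val, Sm.mul_val, Sm.neg_val, Sm.smul_val]
    have : (2 : Sm).1 p = 2 := rfl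
    rw [this]
    ring

/-- The Helmholtz operator `Δ + λ²`. -/
def helm (lam : ℝ) (f : Sm) : Sm := Lap f + lam ^ 2 • f

lemma helm_sum {ι : Type*} (lam : ℝ) (s : Finset ι) (f : ι → Sm) :
    helm lam (∑ i ∈ s, f i) = ∑ i ∈ s, helm lam (f i) := by
  simp only [helm, Lap_sum, Finset.smul_sum, Finset.sum_add_distrib]

lemma helm_smul (lam c : ℝ) (f : Sm) : helm lam (c • f) = c • helm lam f := by
  simp only [helm, Lap_smul, smul_add, smul_comm c]

lemma helm_add (lam : ℝ) (f g : Sm) : helm lam (f + g) = helm lam f + helm lam g := by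
  simp only [helm, Lap_add, smul_add]; ring

lemma sq_add_sq_of_norm {k : E2} (hk : ‖k‖ = 1) : k 0 ^ 2 + k 1 ^ 2 = 1 := by
  have h := EuclideanSpace.norm_sq_eq k
  rw [hk, Fin.sum_univ_two] at h
  simp only [Real.norm_eq_abs, sq_abs] at h
  linarith

lemma helm_mul_cos {k : E2} (hk : ‖k‖ = 1) (lam : ℝ) (g : Sm) :
    helm lam (g * cosW (lam • k)) =
      Lap g * cosW (lam • k) - (2 * lam) • (dK k g * sinW (lam • k)) := by
  have h1 := sq_add_sq_of_norm hk
  rw [helm, dK_eq]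
  simp only [Lap, Dv_mul, map_add, dX_cosW, dX_sinW, Derivation.map_neg, Derivation.map_smul]
  ext p
  simp only [Sm.add_val, Sm.sub_val, Sm.mul_val, Sm.neg_val, Sm.smul_val, PiLp.smul_apply,
    smul_eq_mul]
  linear_combination -(lam ^ 2 * g.1 p * (cosW (lam • k)).1 p) * h1

lemma helm_mul_sin {k : E2} (hk : ‖k‖ = 1) (lam : ℝ) (g : Sm) :
    helm lam (g * sinW (lam • k)) =
      Lap g * sinW (lam • k) + (2 * lam) • (dK k g * cosW (lam • k)) := by
  have h1 := sq_add_sq_of_norm hk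
  rw [helm, dK_eq]
  simp only [Lap, Dv_mul, map_add, dX_cosW, dX_sinW, Derivation.map_smul]
  ext p
  simp only [Sm.add_val, Sm.mul_val, Sm.neg_val, Sm.smul_val, PiLp.smul_apply,
    smul_eq_mul]
  linear_combination -(lam ^ 2 * g.1 p * (sinW (lam • k)).1 p) * h1

lemma two_sin_mul_sin (lam : ℝ) (k l : E2) :
    (2 : ℝ) • (sinW (lam • k) * sinW (lam • l)) =
      cosW (lam • (k - l)) - cosW (lam • (k + l)) := by
  ext p
  simp only [Sm.smul_val, Sm.mul_val, Sm.sub_val]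
  simp only [sinW, cosW, wave, inner_smul_left, inner_sub_left, inner_add_left,
    RCLike.conj_to_real, mul_sub, mul_add, Real.cos_sub, Real.cos_add]
  ring

lemma cosW_zero : cosW 0 = 1 := by
  ext p
  simp [cosW, wave]

/-- A derivative in terms of an orthonormal basis. -/
lemma dX_eq_of_orthonormal {k l : E2} (hk : ‖k‖ = 1) (hl : ‖l‖ = 1) (hkl : inner ℝ k l = (0 : ℝ))
    (i : Fin 2) (f : Sm) : dX i f = k i • dK k f + l i • dK l f := by
  have h1 := sq_add_sq_of_norm hk
  have h2 := sq_add_sq_of_norm hl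
  have h3 : k 0 * l 0 + k 1 * l 1 = 0 := by
    have := hkl
    simp only [PiLp.inner_apply, Fin.sum_univ_two, RCLike.inner_apply, conj_trivial] at this
    linarith
  -- The transposed matrix of an orthonormal basis is also orthonormal.
  have hdet : (k 0 * l 1 - k 1 * l 0) ^ 2 = 1 := by
    linear_combination (l 0 ^ 2 + l 1 ^ 2) * h1 + h2 - (k 0 * l 0 + k 1 * l 1) * h3
  have h4 : k 0 ^ 2 + l 0 ^ 2 = 1 := by
    have : (k 1 ^ 2 - l 0 ^ 2) = 0 := by
      have e : (k 1 ^ 2 - l 0 ^ 2) = (k 1 ^ 2) * (l 0 ^ 2 + l 1 ^ 2) - l 0 ^ 2 * (k 0 ^ 2 + k 1 ^ 2) := by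
        rw [h1, h2]; ring
      rw [e]
      linear_combination (k 1 * l 1 - k 0 * l 0) * h3
    linarith
  have h5 : k 1 ^ 2 + l 1 ^ 2 = 1 := by linarith
  have h6 : k 0 * k 1 + l 0 * l 1 = 0 := by
    linear_combination (-(k 0 * k 1)) * h2 + (-(l 0 * l 1)) * h1 + (k 0 * l 1 + k 1 * l 0) * h3
  rw [dK_eq k, dK_eq l]
  ext p
  fin_cases i
  · simp only [Sm.add_val, Sm.smul_val, Fin.zero_eta]
    linear_combination (-(dX 0 f).1 p) * h4 + (-(dX 1 f).1 p) * h6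
  · simp only [Sm.add_val, Sm.smul_val, Fin.mk_one]
    linear_combination (-(dX 1 f).1 p) * h5 + (-(dX 0 f).1 p) * h6

section Quadratic

variable (Λ : Finset E2) (lam : ℝ) (σ : E2 → ℝ) (g : E2 → Sm)

/-- The stream function `∑ σ_k g_k cos(λ k·x)`. -/
def streamSum : Sm := ∑ k ∈ Λ, σ k • (g k * cosW (lam • k))

/-- The interaction of the waves with different directions. -/
def oscPart (i : Fin 2) : Sm := by
  classical
  exact -∑ k ∈ Λ, ∑ l ∈ Λ, (σ k * σ l * l i) • (dK k (g k) * g l *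
    ((if k = l then 0 else cosW (lam • (k - l))) - (if k = -l then 0 else cosW (lam • (k + l)))))

/-- The terms of lower order in the product of the Helmholtz defect and the gradient. -/
def lowerPart (i : Fin 2) : Sm :=
  (lam⁻¹ ^ 2) • (-(∑ k ∈ Λ, σ k • (Lap (g k) * cosW (lam • k))) * dX i (streamSum Λ lam σ g))
  + (2 * lam⁻¹) • ((∑ k ∈ Λ, σ k • (dK k (g k) * sinW (lam • k))) *
      ∑ k ∈ Λ, σ k • (dX i (g k) * cosW (lam • k)))
  + (lam⁻¹ ^ 4) • (helm lam (helm lam (streamSum Λ lam σ g)) * dX i (streamSum Λ lam σ g))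
  + (lam⁻¹ ^ 4) • (helm lam (streamSum Λ lam σ g) * dX i (helm lam (streamSum Λ lam σ g)))
  - (lam⁻¹ ^ 6) • (helm lam (helm lam (streamSum Λ lam σ g)) *
      dX i (helm lam (streamSum Λ lam σ g)))

lemma helm_streamSum (hΛ : ∀ k ∈ Λ, ‖k‖ = 1) : helm lam (streamSum Λ lam σ g) =
    (∑ k ∈ Λ, σ k • (Lap (g k) * cosW (lam • k))) -
      (2 * lam) • ∑ k ∈ Λ, σ k • (dK k (g k) * sinW (lam • k)) := by
  rw [streamSum, helm_sum, Finset.smul_sum, ← Finset.sum_sub_distrib]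
  refine Finset.sum_congr rfl fun k hk => ?_
  rw [helm_smul, helm_mul_cos (hΛ k hk), smul_sub, smul_comm]

lemma dX_streamSum (i : Fin 2) : dX i (streamSum Λ lam σ g) =
    (∑ k ∈ Λ, σ k • (dX i (g k) * cosW (lam • k))) -
      lam • ∑ k ∈ Λ, (σ k * k i) • (g k * sinW (lam • k)) := by
  rw [streamSum, map_sum, Finset.smul_sum, ← Finset.sum_sub_distrib]
  refine Finset.sum_congr rfl fun k _ => ?_
  rw [Derivation.map_smul, Dv_mul, dX_cosW]
  ext p
  simp only [Sm.add_val, Sm.sub_val, Sm.mul_val, Sm.neg_val, Sm.smul_val, PiLp.smul_apply,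
    smul_eq_mul]
  ring

/-- The main part of the product splits into interactions of different directions and the
self-interactions, which do not oscillate. -/
lemma mainPart_eq (hΛ : ∀ k ∈ Λ, -k ∈ Λ) (hσ : ∀ k ∈ Λ, σ k ^ 2 = 1)
    (hσn : ∀ k ∈ Λ, σ (-k) = σ k) (hg : ∀ k ∈ Λ, g (-k) = g k) (i : Fin 2) :
    (-2 : ℝ) • ((∑ k ∈ Λ, σ k • (dK k (g k) * sinW (lam • k))) *
      ∑ k ∈ Λ, (σ k * k i) • (g k * sinW (lam • k))) =
      oscPart Λ lam σ g i - ∑ k ∈ Λ, k i • dK k (g k ^ 2) := by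
  classical
  have h1 : (-2 : ℝ) • ((∑ k ∈ Λ, σ k • (dK k (g k) * sinW (lam • k))) *
      ∑ k ∈ Λ, (σ k * k i) • (g k * sinW (lam • k))) =
      -∑ k ∈ Λ, ∑ l ∈ Λ, (σ k * σ l * l i) • (dK k (g k) * g l *
        (cosW (lam • (k - l)) - cosW (lam • (k + l)))) := by
    rw [Finset.sum_mul_sum, neg_smul, Finset.smul_sum]
    congr 1
    refine Finset.sum_congr rfl fun k _ => ?_
    rw [Finset.smul_sum]
    refine Finset.sum_congr rfl fun l _ => ?_
    rw [← two_sin_mul_sin]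
    ext p
    simp only [Sm.mul_val, Sm.smul_val]
    ring
  have h2 : ∀ k ∈ Λ, ∑ l ∈ Λ, (σ k * σ l * l i) • (dK k (g k) * g l *
        (cosW (lam • (k - l)) - cosW (lam • (k + l)))) =
      (∑ l ∈ Λ, (σ k * σ l * l i) • (dK k (g k) * g l *
        ((if k = l then 0 else cosW (lam • (k - l))) -
          (if k = -l then 0 else cosW (lam • (k + l)))))) + k i • dK k (g k ^ 2) := by
    intro k hk
    have h3 : ∀ l, (σ k * σ l * l i) • (dK k (g k) * g l *
        (cosW (lam • (k - l)) - cosW (lam • (k + l)))) =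
        (σ k * σ l * l i) • (dK k (g k) * g l *
        ((if k = l then 0 else cosW (lam • (k - l))) -
          (if k = -l then 0 else cosW (lam • (k + l))))) +
        ((if k = l then (σ k * σ l * l i) • (dK k (g k) * g l) else 0) -
          (if -k = l then (σ k * σ l * l i) • (dK k (g k) * g l) else 0)) := by
      intro l
      have e1 : cosW (lam • (k - l)) =
          (if k = l then 0 else cosW (lam • (k - l))) + (if k = l then 1 else 0) := by
        split_ifs with h
        · rw [h, sub_self, smul_zero, cosW_zero, zero_add]
        · rw [add_zero]
      have e2 : cosW (lam • (k + l)) =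
          (if k = -l then 0 else cosW (lam • (k + l))) + (if -k = l then 1 else 0) := by
        by_cases h : k = -l
        · rw [if_pos h, if_pos (by rw [h, neg_neg]), h, neg_add_cancel, smul_zero, cosW_zero,
            zero_add]
        · rw [if_neg h, if_neg (fun h' => h (by rw [← h', neg_neg])), add_zero]
      have e3 : ∀ P : Prop, [Decidable P] → (if P then (σ k * σ l * l i) • (dK k (g k) * g l)
          else 0) = (σ k * σ l * l i) • (dK k (g k) * g l * (if P then 1 else 0)) := by
        intro P _
        split_ifs <;> simp
      rw [e3, e3]
      nth_rewrite 1 [e1]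
      nth_rewrite 1 [e2]
      rw [← smul_sub, ← smul_add]
      congr 1
      ring
    simp only [h3, Finset.sum_add_distrib, Finset.sum_sub_distrib, Finset.sum_ite_eq]
    congr 1
    rw [if_pos hk, if_pos (hΛ k hk), hσn k hk, hg k hk, ← sq, hσ k hk, Dv_sq]
    ext p
    have : (2 : Sm).1 p = 2 := rfl
    simp only [Sm.sub_val, Sm.mul_val, Sm.smul_val, PiLp.neg_apply, this]
    ring
  rw [h1, Finset.sum_congr rfl h2, Finset.sum_add_distrib, oscPart]
  ring

/-- The product of the Helmholtz defect and the gradient of the stream function. -/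
lemma helm_mul_dX_eq (hlam : lam ≠ 0) (hΛ1 : ∀ k ∈ Λ, ‖k‖ = 1) (hΛ : ∀ k ∈ Λ, -k ∈ Λ)
    (hσ : ∀ k ∈ Λ, σ k ^ 2 = 1) (hσn : ∀ k ∈ Λ, σ (-k) = σ k) (hg : ∀ k ∈ Λ, g (-k) = g k)
    (i : Fin 2) :
    -((lam⁻¹ ^ 2) • ((helm lam (streamSum Λ lam σ g) -
      (lam⁻¹ ^ 2) • helm lam (helm lam (streamSum Λ lam σ g))) *
      (dX i (streamSum Λ lam σ g) - (lam⁻¹ ^ 2) • dX i (helm lam (streamSum Λ lam σ g))))) =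
      lowerPart Λ lam σ g i + oscPart Λ lam σ g i - ∑ k ∈ Λ, k i • dK k (g k ^ 2) := by
  rw [add_sub_assoc, ← mainPart_eq Λ lam σ g hΛ hσ hσn hg i]
  have hR1 := helm_streamSum Λ lam σ g hΛ1
  have hU := dX_streamSum Λ lam σ g i
  rw [lowerPart]
  set U := streamSum Λ lam σ g
  set R1 := helm lam U
  set R2 := helm lam R1
  set Pc := ∑ k ∈ Λ, σ k • (Lap (g k) * cosW (lam • k))
  set Qs := ∑ k ∈ Λ, σ k • (dK k (g k) * sinW (lam • k))
  set Di := ∑ k ∈ Λ, σ k • (dX i (g k) * cosW (lam • k))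
  set Si := ∑ k ∈ Λ, (σ k * k i) • (g k * sinW (lam • k))
  ext p
  have e1 : R1.1 p = Pc.1 p - 2 * lam * Qs.1 p := by
    rw [hR1]; rfl
  have e2 : (dX i U).1 p = Di.1 p - lam * Si.1 p := by
    rw [hU]; rfl
  simp only [Sm.add_val, Sm.sub_val, Sm.mul_val, Sm.neg_val, Sm.smul_val]
  have e3 : (lam⁻¹ ^ 2) * (R1.1 p * (dX i U).1 p) = (lam⁻¹ ^ 2) * (Pc.1 p * (dX i U).1 p)
      - 2 * lam⁻¹ * (Qs.1 p * Di.1 p) + 2 * (Qs.1 p * Si.1 p) := by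
    rw [e1, e2]
    field_simp
    ring
  linear_combination -e3

end Quadratic

/-- The low-frequency part of the Euler nonlinearity: the self-interactions reproduce the
Reynolds stress `2 R = 2 (∇V + (∇V)ᵀ)`, whose divergence is `2 Δ V`, up to a gradient, the fast
oscillations of the profile and the mollification error. -/
lemma selfInteraction_eq (Λ : Finset E2) (bar : E2 → E2) (g b φ a e : E2 → Sm) (χ : Sm) (K : ℝ)
    (hK : K ≠ 0) (V : Fin 2 → Sm) (R : Fin 2 → Fin 2 → Sm)
    (hΛ1 : ∀ k ∈ Λ, ‖k‖ = 1) (hbar : ∀ k ∈ Λ, ‖bar k‖ = 1)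
    (hin : ∀ k ∈ Λ, inner ℝ k (bar k) = (0 : ℝ))
    (hg : ∀ k ∈ Λ, g k = b k * φ k) (hφ : ∀ k ∈ Λ, dK (bar k) (φ k) = 0)
    (hb : ∀ k ∈ Λ, b k ^ 2 = (2 * K) • (χ ^ 2 * (a k ^ 2 + e k)))
    (hR : ∀ i j, R i j = dX i (V j) + dX j (V i)) (hV : dX 0 (V 0) + dX 1 (V 1) = 0)
    (ha : ∀ i j, ∑ k ∈ Λ, (bar k i * bar k j) • a k ^ 2 =
      (if i = j then 1 else 0) + K⁻¹ • R i j)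
    (hχ : ∀ i j, χ ^ 2 * R i j = R i j) (i : Fin 2) :
    dX i (∑ k ∈ Λ, g k ^ 2) - ∑ k ∈ Λ, k i • dK k (g k ^ 2) =
      (2 * K) • dX i (χ ^ 2) + (2 : ℝ) • Lap (V i)
      + ∑ k ∈ Λ, bar k i • (dK (bar k) (b k ^ 2) * (φ k ^ 2 - 1))
      + ∑ k ∈ Λ, bar k i • dK (bar k) ((2 * K) • (χ ^ 2 * e k)) := by
  have h1 : dX i (∑ k ∈ Λ, g k ^ 2) - ∑ k ∈ Λ, k i • dK k (g k ^ 2) =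
      ∑ k ∈ Λ, bar k i • (dK (bar k) (b k ^ 2) * φ k ^ 2) := by
    rw [map_sum, ← Finset.sum_sub_distrib]
    refine Finset.sum_congr rfl fun k hk => ?_
    rw [dX_eq_of_orthonormal (hΛ1 k hk) (hbar k hk) (hin k hk) i, add_sub_cancel_left, hg k hk,
      mul_pow, Dv_mul, Dv_sq _ (φ k), hφ k hk, mul_zero, mul_zero, zero_add, mul_comm]
  have h2 : ∀ k ∈ Λ, bar k i • (dK (bar k) (b k ^ 2) * φ k ^ 2) =
      bar k i • dK (bar k) ((2 * K) • (χ ^ 2 * a k ^ 2)) +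
      bar k i • (dK (bar k) (b k ^ 2) * (φ k ^ 2 - 1)) +
      bar k i • dK (bar k) ((2 * K) • (χ ^ 2 * e k)) := by
    intro k hk
    have : dK (bar k) (b k ^ 2) = dK (bar k) ((2 * K) • (χ ^ 2 * a k ^ 2)) +
        dK (bar k) ((2 * K) • (χ ^ 2 * e k)) := by
      rw [hb k hk, mul_add, smul_add, map_add]
    rw [add_right_comm, ← smul_add, ← this, ← smul_add]
    congr 1
    ring
  have h3 : ∑ k ∈ Λ, bar k i • dK (bar k) ((2 * K) • (χ ^ 2 * a k ^ 2)) =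
      dX 0 ((2 * K) • (χ ^ 2 * ∑ k ∈ Λ, (bar k i * bar k 0) • a k ^ 2)) +
      dX 1 ((2 * K) • (χ ^ 2 * ∑ k ∈ Λ, (bar k i * bar k 1) • a k ^ 2)) := by
    simp only [Finset.mul_sum, Finset.smul_sum, map_sum]
    rw [← Finset.sum_add_distrib]
    refine Finset.sum_congr rfl fun k _ => ?_
    simp only [mul_smul_comm, Derivation.map_smul]
    rw [dK_eq]
    ext p
    simp only [Sm.add_val, Sm.smul_val]
    ring
  have h4 : ∀ j, (2 * K) • (χ ^ 2 * ((if i = j then 1 else 0) + K⁻¹ • R i j)) =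
      (if i = j then (2 * K) • χ ^ 2 else 0) + (2 : ℝ) • R i j := by
    intro j
    rw [mul_add, mul_smul_comm, hχ, smul_add, smul_smul, mul_assoc, mul_inv_cancel₀ hK, mul_one]
    congr 1
    split_ifs <;> simp
  have h5 : dX 0 (R i 0) + dX 1 (R i 1) = Lap (V i) := by
    have h6 := congrArg (dX i) hV
    rw [map_add, map_zero] at h6
    rw [hR, hR, map_add, map_add, Lap, Dv_comm _ _ (V 0), Dv_comm _ _ (V 1)]
    linear_combination h6
  rw [h1, Finset.sum_congr rfl h2, Finset.sum_add_distrib, Finset.sum_add_distrib, h3]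
  simp only [ha, h4]
  have h6 : dX 0 ((if i = 0 then (2 * K) • χ ^ 2 else 0) + (2 : ℝ) • R i 0) +
      dX 1 ((if i = 1 then (2 * K) • χ ^ 2 else 0) + (2 : ℝ) • R i 1) =
      (2 * K) • dX i (χ ^ 2) + (2 : ℝ) • Lap (V i) := by
    rw [map_add, map_add, Derivation.map_smul, Derivation.map_smul, ← h5, smul_add]
    fin_cases i
    · simp only [Fin.zero_eta, if_true, zero_ne_one, if_false, map_zero,
        Derivation.map_smul, zero_add]
      ring
    · simp only [Fin.mk_one, if_true, one_ne_zero, if_false, map_zero, Derivation.map_smul,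
        zero_add]
      ring
  rw [h6]

section

open MeasureTheory

/-! ### Auxiliary functions -/

/-- There is a smooth function with bounded derivatives that agrees with `e^{-t}` for `t ≥ 0`. -/
lemma exists_decay : ∃ η : ℝ → ℝ, ContDiff ℝ ∞ η ∧ (∀ t, 0 ≤ t → η t = Real.exp (-t)) ∧
    ∀ N, ∃ C, 0 ≤ C ∧ SB N C 1 η := by
  set η : ℝ → ℝ := fun t => Real.smoothTransition (t + 2) * Real.exp (-t) with hη
  have hs : ContDiff ℝ ∞ η :=
    (Real.smoothTransition.contDiff.comp (by fun_prop)).mul (by fun_prop)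
  refine ⟨η, hs, fun t ht => ?_, fun N => SB.of_forall_exists hs (fun j => ?_) N⟩
  · simp only [hη]
    rw [Real.smoothTransition.one_of_one_le (by linarith), one_mul]
  obtain ⟨C, hC⟩ := (isCompact_Icc (a := (-3 : ℝ)) (b := 0)).exists_bound_of_continuousOn
    (hs.continuous_iteratedFDeriv (m := j) (by exact_mod_cast le_top)).continuousOn
  refine ⟨max C 1, fun t => ?_⟩
  rcases lt_or_ge t (-3) with h1 | h1
  · have h2 : η =ᶠ[nhds t] fun _ => 0 := by
      filter_upwards [Iio_mem_nhds h1] with s hs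
      simp only [hη]
      rw [Real.smoothTransition.zero_of_nonpos (by linarith [Set.mem_Iio.1 hs]), zero_mul]
    have h3 : iteratedFDeriv ℝ j η t = 0 := by
      rw [(h2.iteratedFDeriv ℝ j).eq_of_nhds]
      simp
    rw [h3, norm_zero]
    exact zero_le_one.trans (le_max_right _ _)
  rcases lt_or_ge 0 t with h4 | h4
  · have h2 : η =ᶠ[nhds t] fun s => Real.exp (-s) := by
      filter_upwards [Ioi_mem_nhds h4] with s hs
      simp only [hη]
      rw [Real.smoothTransition.one_of_one_le (by linarith [Set.mem_Ioi.1 hs]), one_mul]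
    rw [norm_iteratedFDeriv_eq_norm_iteratedDeriv, h2.iteratedDeriv_eq]
    have h5 := iteratedDeriv_comp_neg j Real.exp t
    rw [h5, iteratedDeriv_eq_iterate, Real.iter_deriv_exp, smul_eq_mul, norm_mul, norm_pow,
      norm_neg, norm_one, one_pow, one_mul, Real.norm_of_nonneg (Real.exp_pos _).le]
    exact (Real.exp_le_one_iff.2 (by linarith)).trans (le_max_right _ _)
  · exact (hC t ⟨h1, h4⟩).trans (le_max_left _ _)

/-- The coefficients `a_k(Id + T)` extend from a neighbourhood of zero in the symmetric matrices to
smooth compactly supported functions of all matrices. -/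
lemma GeometricData.exists_coef_ext (G : GeometricData) {k : E2} (hk : k ∈ G.Λ) :
    ∃ c : Matrix (Fin 2) (Fin 2) ℝ → ℝ, ContDiff ℝ ∞ c ∧ HasCompactSupport c ∧
      ∀ T : Matrix (Fin 2) (Fin 2) ℝ, T.IsSymm → ‖T‖ ≤ 1 / 2000 → c T = G.coef k (1 + T) := by
  let f : ContDiffBump (0 : Matrix (Fin 2) (Fin 2) ℝ) :=
    ⟨1 / 2000, 3 / 4000, by norm_num, by norm_num⟩
  -- Symmetrization makes the coefficient a function on an open set of matrices.
  let S : Matrix (Fin 2) (Fin 2) ℝ → Matrix (Fin 2) (Fin 2) ℝ := fun T => (1 / 2 : ℝ) • (T + Tᵀ)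
  have hS : ContDiff ℝ ∞ S := by
    have : IsLinearMap ℝ S := by
      constructor
      · intro x y
        simp only [S, Matrix.transpose_add, ← smul_add]
        congr 1
        abel
      · intro c x
        simp only [S, Matrix.transpose_smul, ← smul_add]
        rw [smul_comm]
    exact (LinearMap.toContinuousLinearMap (this.mk' S)).contDiff
  have hmem : ∀ T, ‖T‖ < 1 / 1000 → 1 + S T ∈ symBall := by
    intro T hT
    refine ⟨?_, ?_⟩
    · simp only [S, Matrix.IsSymm, Matrix.transpose_smul, Matrix.transpose_add,
        Matrix.transpose_transpose, Matrix.transpose_one, add_comm]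
    · have h2 : ‖Tᵀ‖ = ‖T‖ := Matrix.frobenius_norm_transpose _
      have h3 := norm_add_le T Tᵀ
      have h4 : ‖(1 / 2 : ℝ)‖ = 1 / 2 := by norm_num
      rw [add_sub_cancel_left, norm_smul, h4]
      linarith
  have hsupp : tsupport f = Metric.closedBall 0 (3 / 4000) := f.tsupport_eq
  refine ⟨fun T => f T * G.coef k (1 + S T), ?_, ?_, ?_⟩
  · rw [contDiff_iff_contDiffAt]
    intro T
    by_cases hT : ‖T‖ < 1 / 1000
    · have hnb : Metric.ball (0 : Matrix (Fin 2) (Fin 2) ℝ) (1 / 1000) ∈ nhds T :=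
        Metric.isOpen_ball.mem_nhds (by rwa [mem_ball_zero_iff])
      have h1 : ContDiffOn ℝ ∞ (fun T => G.coef k (1 + S T)) (Metric.ball 0 (1 / 1000)) :=
        (G.coef_smooth k hk).comp (contDiff_const.add hS).contDiffOn
          fun T hT => hmem T (by rwa [mem_ball_zero_iff] at hT)
      exact f.contDiffAt.mul (h1.contDiffAt hnb)
    · have h1 : T ∉ tsupport f := by
        rw [hsupp, mem_closedBall_zero_iff, not_le]
        linarith [not_lt.1 hT]
      have h2 : (fun T => f T * G.coef k (1 + S T)) =ᶠ[nhds T] fun _ => 0 := by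
        filter_upwards [notMem_tsupport_iff_eventuallyEq.1 h1] with T hT
        rw [hT, Pi.zero_apply, zero_mul]
      exact contDiffAt_const.congr_of_eventuallyEq h2
  · exact f.hasCompactSupport.mul_right
  · intro T hT hn
    have h1 : S T = T := by
      simp only [S]
      rw [hT.eq, ← two_smul ℝ T, smul_smul]
      norm_num
    change f T * G.coef k (1 + S T) = G.coef k (1 + T)
    rw [h1, f.one_of_mem_closedBall (by rwa [mem_closedBall_zero_iff]), one_mul]

/-- The fluctuation `φ² - 1` of the profile is the derivative of a periodic function. -/
lemma Profile.exists_primitive (φ : Profile) : ∃ Φ : ℝ → ℝ, ContDiff ℝ ∞ Φ ∧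
    Function.Periodic Φ (2 * Real.pi) ∧ ∀ s, deriv Φ s = φ.toFun s ^ 2 - 1 := by
  set f : ℝ → ℝ := fun s => φ.toFun s ^ 2 - 1 with hf
  have hfs : ContDiff ℝ ∞ f := (φ.smooth.pow 2).sub contDiff_const
  have hfp : Function.Periodic f (2 * Real.pi) := fun s => by simp only [hf, φ.periodic s]
  have hi : ∀ x y, IntervalIntegrable f volume x y := fun x y =>
    hfs.continuous.intervalIntegrable x y
  have hd : ∀ s, HasDerivAt (fun s => ∫ τ in (0 : ℝ)..s, f τ) (f s) s := fun s =>
    intervalIntegral.integral_hasDerivAt_right (hi 0 s)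
      (hfs.continuous.stronglyMeasurableAtFilter _ _) hfs.continuous.continuousAt
  have h0 : ∫ s in (0 : ℝ)..(2 * Real.pi), f s = 0 := by
    have h1 := φ.mean_sq
    have hpi := Real.two_pi_pos
    have h2 := intervalIntegral.integral_sub (μ := volume) (a := 0) (b := 2 * Real.pi)
      (f := fun s => φ.toFun s ^ 2) (g := fun _ => (1 : ℝ))
      ((φ.smooth.continuous.pow 2).intervalIntegrable _ _) intervalIntegrable_const
    rw [hf, h2, intervalIntegral.integral_const]
    rw [one_div, inv_mul_eq_iff_eq_mul₀ hpi.ne'] at h1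
    rw [h1]
    simp
  refine ⟨fun s => ∫ τ in (0 : ℝ)..s, f τ, ?_, fun s => ?_, fun s => (hd s).deriv⟩
  · have h1 : deriv (fun s => ∫ τ in (0 : ℝ)..s, f τ) = f := funext fun s => (hd s).deriv
    have h2 := (contDiff_succ_iff_deriv (n := ∞) (f := fun s => ∫ τ in (0 : ℝ)..s, f τ)).2
      ⟨fun s => (hd s).differentiableAt, by simp, by rw [h1]; exact hfs⟩
    simpa using h2
  · have h1 := hfp.intervalIntegral_add_eq 0 s
    rw [zero_add, h0] at h1
    have h2 := intervalIntegral.integral_add_adjacent_intervals (hi 0 s) (hi s (s + 2 * Real.pi))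
    simp only
    rw [← h2, ← h1, add_zero]

/-! ### The parameters -/

lemma lam_pos (G : GeometricData) {a b : ℕ} (ha : 1 ≤ a) (n : ℕ) : 0 < lam G a b n := by
  have := G.N_pos
  unfold lam
  positivity

lemma le_lam (G : GeometricData) {a b : ℕ} (ha : 1 ≤ a) (hb : 1 ≤ b) (n : ℕ) :
    (a : ℝ) ≤ lam G a b n := by
  have hN : (1 : ℝ) ≤ (G.N : ℝ) ^ 4 := one_le_pow₀ (by exact_mod_cast G.N_pos)
  have ha' : (1 : ℝ) ≤ a := by exact_mod_cast ha
  have h1 : (a : ℝ) ^ 1 ≤ (a : ℝ) ^ (b ^ n) := pow_le_pow_right₀ ha' (Nat.one_le_pow _ _ hb)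
  rw [pow_one] at h1
  unfold lam
  nlinarith

/-- The growth of the frequencies: any fixed power of `λ_n` is below `λ_{n+1}^{1/4}`. -/
lemma lam_pow_le (G : GeometricData) {a b : ℕ} (P : ℕ) (haN : G.N ^ 4 ≤ a) (hb : 8 * P + 1 ≤ b)
    (n : ℕ) : lam G a b n ^ P ≤ lam G a b (n + 1) ^ (1 / 4 : ℝ) := by
  have ha : 1 ≤ a := (Nat.one_le_pow 4 _ G.N_pos).trans haN
  have ha' : (1 : ℝ) ≤ a := by exact_mod_cast ha
  have h0 := lam_pos G (b := b) ha n
  have h1 : lam G a b n ≤ (a : ℝ) ^ (2 * b ^ n) := by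
    have h2 : (G.N : ℝ) ^ 4 ≤ (a : ℝ) ^ (b ^ n) := by
      have h3 : (a : ℝ) ^ 1 ≤ (a : ℝ) ^ (b ^ n) :=
        pow_le_pow_right₀ ha' (Nat.one_le_pow _ _ (by omega))
      rw [pow_one] at h3
      exact le_trans (by exact_mod_cast haN) h3
    rw [two_mul, pow_add, lam]
    exact mul_le_mul_of_nonneg_right h2 (by positivity)
  have h2 : lam G a b n ^ (4 * P) ≤ lam G a b (n + 1) := by
    calc lam G a b n ^ (4 * P) ≤ ((a : ℝ) ^ (2 * b ^ n)) ^ (4 * P) :=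
          pow_le_pow_left₀ h0.le h1 _
      _ = (a : ℝ) ^ (8 * P * b ^ n) := by rw [← pow_mul]; congr 1; ring
      _ ≤ (a : ℝ) ^ (b ^ (n + 1)) := by
          refine pow_le_pow_right₀ ha' ?_
          rw [pow_succ, mul_comm (b ^ n)]
          exact Nat.mul_le_mul_right _ (by omega)
      _ ≤ lam G a b (n + 1) := by
          have hN : (1 : ℝ) ≤ (G.N : ℝ) ^ 4 := one_le_pow₀ (by exact_mod_cast G.N_pos)
          exact le_mul_of_one_le_left (by positivity) hN
  have h3 : lam G a b n ^ P = (lam G a b n ^ (4 * P)) ^ (1 / 4 : ℝ) := by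
    rw [← Real.rpow_natCast _ (4 * P), ← Real.rpow_mul h0.le, ← Real.rpow_natCast]
    congr 1
    push_cast
    ring
  rw [h3]
  exact Real.rpow_le_rpow (by positivity) h2 (by norm_num)

lemma rpow_quarter_pow_four {x : ℝ} (hx : 0 ≤ x) : (x ^ (1 / 4 : ℝ)) ^ 4 = x := by
  rw [← Real.rpow_natCast, ← Real.rpow_mul hx]
  norm_num

/-- `λ_n^{1/4} k` is an integer vector. -/
lemma quarter_smul_mem (G : GeometricData) {a b : ℕ} (hab : ∃ m : ℕ, a ^ b = m ^ 4) {n : ℕ}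
    (hn : 1 ≤ n) {k : E2} (hk : k ∈ G.Λ) (i : Fin 2) :
    ∃ z : ℤ, (lam G a b n ^ (1 / 4 : ℝ) • k) i = z := by
  obtain ⟨m, hm⟩ := hab
  obtain ⟨z, hz⟩ := G.N_mul k hk i
  obtain ⟨j, rfl⟩ := Nat.exists_eq_add_of_le hn
  have h1 : lam G a b (1 + j) = ((G.N : ℝ) * (m : ℝ) ^ (b ^ j)) ^ 4 := by
    have h2 : (a : ℝ) ^ b = (m : ℝ) ^ 4 := by exact_mod_cast hm
    rw [lam, pow_add, pow_one, pow_mul, h2, mul_pow, ← pow_mul, ← pow_mul, mul_comm 4]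
  have h3 : lam G a b (1 + j) ^ (1 / 4 : ℝ) = (G.N : ℝ) * (m : ℝ) ^ (b ^ j) := by
    rw [h1, ← Real.rpow_natCast _ 4, ← Real.rpow_mul (by positivity)]
    norm_num
  refine ⟨(m : ℤ) ^ (b ^ j) * z, ?_⟩
  rw [h3, PiLp.smul_apply, smul_eq_mul]
  push_cast
  rw [← hz]
  ring

/-- `λ_n k` is an integer vector. -/
lemma lam_smul_mem (G : GeometricData) (a b n : ℕ) {k : E2} (hk : k ∈ G.Λ) (i : Fin 2) :
    ∃ z : ℤ, (lam G a b n • k) i = z := by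
  obtain ⟨z, hz⟩ := G.N_mul k hk i
  refine ⟨(G.N : ℤ) ^ 3 * (a : ℤ) ^ (b ^ n) * z, ?_⟩
  rw [lam, PiLp.smul_apply, smul_eq_mul]
  push_cast
  rw [← hz]
  ring

/-- The orientation of the basis `(k, k̄)`. -/
def orient (G : GeometricData) (k : E2) : ℝ := k 0 * G.bar k 1 - k 1 * G.bar k 0

lemma orient_sq (G : GeometricData) {k : E2} (hk : k ∈ G.Λ) : orient G k ^ 2 = 1 := by
  have h1 := sq_add_sq_of_norm (G.norm_eq_one k hk)
  have h2 := sq_add_sq_of_norm (G.norm_bar k hk)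
  have h3 : k 0 * G.bar k 0 + k 1 * G.bar k 1 = 0 := by
    have := G.inner_bar k hk
    simp only [PiLp.inner_apply, Fin.sum_univ_two, RCLike.inner_apply, conj_trivial] at this
    linarith
  rw [orient]
  linear_combination (G.bar k 0 ^ 2 + G.bar k 1 ^ 2) * h1 + h2 -
    (k 0 * G.bar k 0 + k 1 * G.bar k 1) * h3

lemma orient_neg (G : GeometricData) {k : E2} (hk : k ∈ G.Λ) : orient G (-k) = orient G k := by
  simp [orient, G.bar_neg k hk]

lemma curl_planeExp (G : GeometricData) (μ : ℝ) (k x : E2) :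
    curl (fun y i => Complex.I * Complex.exp (Complex.I * ((μ * inner ℝ k y : ℝ) : ℂ)) *
      ((G.bar k i : ℝ) : ℂ)) x =
      -((μ * orient G k : ℝ) : ℂ) * Complex.exp (Complex.I * ((μ * inner ℝ k x : ℝ) : ℂ)) := by
  have key : ∀ (c : ℂ) (j : Fin 2), pd j (fun y => Complex.I *
      Complex.exp (Complex.I * ((μ * inner ℝ k y : ℝ) : ℂ)) * c) x =
      -((μ * k j : ℝ) : ℂ) * Complex.exp (Complex.I * ((μ * inner ℝ k x : ℝ) : ℂ)) * c := by
    intro c j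
    have h1 : HasFDerivAt (fun y : E2 => μ * (inner ℝ k y : ℝ)) (μ • innerSL ℝ k) x :=
      (innerSL ℝ k).hasFDerivAt.const_mul μ
    have h2 := Complex.ofRealCLM.hasFDerivAt.comp x h1
    have h3 := (((h2.const_mul Complex.I).cexp).const_mul Complex.I).mul_const c
    have h4 := h3.fderiv
    simp only [Function.comp_def, Complex.ofRealCLM_apply] at h4
    rw [pd, h4]
    simp only [smul_apply, ContinuousLinearMap.comp_apply, smul_eq_mul,
      innerSL_apply_apply, Complex.ofRealCLM_apply, inner_single]
    have hI := Complex.I_mul_I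
    push_cast
    linear_combination (c * Complex.exp (Complex.I * (μ * (inner ℝ k x : ℝ))) * μ * k j) * hI
  rw [curl, key, key, orient]
  push_cast
  ring

end

section

open MeasureTheory

/-! ### One step of the construction -/

/-- The flow at level `n` comes from the stream function `U`: for nonnegative times the potential is
`λ_n⁻² e^{-λ_n² t} ∇^⊥ U`, where `U` is smooth for all times, of size `Γ` and frequency `λ_n`, and
vanishes near all points where the cutoff `χ_n` differs from one. -/
structure Level (G : GeometricData) (φ : Profile) (M : Mollifiers) (C₀ : ℝ) (a b : ℕ)
    (χ : ℕ → E2 → ℝ) (Γ : ℝ) (n : ℕ) (U : Sm) : Prop where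
  per : SPer U
  bound : SB 5 Γ (4 * lam G a b n) U.1
  pot : ∀ t, 0 ≤ t → ∀ x i, potential G φ M C₀ a b χ n t x i =
    (lam G a b n)⁻¹ ^ 2 * Real.exp (-(lam G a b n) ^ 2 * t) * (perp U i).1 (t, x)
  one : ∀ p : ST, χ n p.2 = 1 ∨ U.1 =ᶠ[nhds p] 0

/-- The ingredients of the passage from level `n` to level `n + 1`: the potential `V` at level `n`,
extended smoothly to all times, the coefficients `A k = a_k(Id + 𝓡/(1000 C₀))`, their mollifications
`As k`, and the cutoff `X`. The number `c` does not depend on `C₀`; constants depending on `C₀` are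
absorbed in powers of `λ_n`. -/
structure Step (G : GeometricData) (φ : Profile) (M : Mollifiers) (C₀ : ℝ) (a b : ℕ)
    (χ : ℕ → E2 → ℝ) (c : ℝ) (n : ℕ) (V : Fin 2 → Sm) (A As : E2 → Sm) (X : Sm) : Prop where
  V_per : ∀ i, SPer (V i)
  V_bound : ∀ i, SB 4 (lam G a b n) (lam G a b n ^ 3) (V i).1
  V_div : dX 0 (V 0) + dX 1 (V 1) = 0
  V_flow : ∀ t, 0 ≤ t → ∀ x i, potential G φ M C₀ a b χ n t x i = (V i).1 (t, x)
  A_sum : ∀ i j, ∑ k ∈ G.Λ, (G.bar k i * G.bar k j) • A k ^ 2 =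
    (if i = j then 1 else 0) + (1000 * C₀)⁻¹ • (dX i (V j) + dX j (V i))
  A_bound : ∀ k ∈ G.Λ, SB 2 (lam G a b n) (lam G a b n ^ 8) (A k).1
  A_per : ∀ k ∈ G.Λ, SPer (A k)
  As_neg : ∀ k ∈ G.Λ, As (-k) = As k
  As_bound : ∀ k ∈ G.Λ, SB 5 c (lam G a b n ^ 50) (As k).1
  As_per : ∀ k ∈ G.Λ, SPer (As k)
  As_sub : ∀ k ∈ G.Λ, ∀ p, |(As k - A k).1 p| ≤ (lam G a b n ^ 41)⁻¹
  dAs_sub : ∀ k ∈ G.Λ, ∀ v, ‖v‖ ≤ 1 → ∀ p, |(Dv v (As k - A k)).1 p| ≤ (lam G a b n ^ 33)⁻¹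
  X_val : ∀ p, X.1 p = χ n p.2
  X_bound : SB 5 c (lam G a b n) X.1
  X_per : SPer X
  X_mul : ∀ i j, X ^ 2 * (dX i (V j) + dX j (V i)) = dX i (V j) + dX j (V i)
  amp : ∀ k ∈ G.Λ, ∀ t, 0 ≤ t → ∀ x, amplitude M C₀ (ell G a b n) (G.coef k)
    (fun s => symGrad (potential G φ M C₀ a b χ n s)) t x =
      Real.sqrt (2000 * C₀) * (As k).1 (t, x)

lemma eventuallyEq_zero_Dv {f : Sm} {p : ST} (h : f.1 =ᶠ[nhds p] 0) (v : ST) :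
    (Dv v f).1 =ᶠ[nhds p] 0 := by
  filter_upwards [h.fderiv (𝕜 := ℝ)] with q hq
  rw [Dv_val, hq]
  simp

lemma eventuallyEq_zero_mul {f g : Sm} {p : ST} (h : g.1 =ᶠ[nhds p] 0) :
    (f * g).1 =ᶠ[nhds p] 0 := by
  filter_upwards [h] with q hq
  rw [Sm.mul_val, hq]
  simp

lemma eventuallyEq_zero_perp {f : Sm} {p : ST} (h : f.1 =ᶠ[nhds p] 0) (i : Fin 2) :
    (perp f i).1 =ᶠ[nhds p] 0 := by
  fin_cases i
  · exact eventuallyEq_zero_Dv h _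
  · filter_upwards [eventuallyEq_zero_Dv h (0, EuclideanSpace.single 0 1)] with q hq
    change -((dX 0 f).1 q) = 0
    rw [hq]
    simp

protected lemma SB.perp {N : ℕ} {C D : ℝ} {f : Sm} (h : SB (N + 1) C D f.1) (hD : 0 ≤ D)
    (i : Fin 2) : SB N (C * D) D (perp f i).1 := by
  fin_cases i
  · exact h.dX hD 1
  · exact (h.dX hD 0).neg

protected lemma SPer.perp {f : Sm} (h : SPer f) (i : Fin 2) : SPer (perp f i) := by
  fin_cases i
  · exact h.Dv _
  · exact (h.Dv _).neg

lemma of_eq_sum_single (R : Fin 2 → Fin 2 → ℝ) :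
    Matrix.of R = ∑ q : Fin 2 × Fin 2, R q.1 q.2 • Matrix.single q.1 q.2 (1 : ℝ) := by
  rw [Fintype.sum_prod_type]
  ext i j
  fin_cases i <;> fin_cases j <;> simp [Fin.sum_univ_two]

lemma contDiff_timeScale {η : ℝ → ℝ} (hη : ContDiff ℝ ∞ η) (κ : ℝ) :
    ContDiff ℝ ∞ fun t => η (κ * t) := hη.comp (by fun_prop)

/-- The potential of level `n`, extended to negative times with the help of a function `η` that
replaces the exponential. -/
def extPotential {η : ℝ → ℝ} (hη : ContDiff ℝ ∞ η) (μ : ℝ) (U : Sm) (i : Fin 2) : Sm :=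
  (μ⁻¹ ^ 2) • (ofTime (fun t => η (μ ^ 2 * t)) (contDiff_timeScale hη _) * perp U i)

section ExtPotential

variable {η : ℝ → ℝ} (hη : ContDiff ℝ ∞ η) {cη μ Γ : ℝ} {U : Sm}

lemma dX_extPotential (i j : Fin 2) : dX j (extPotential hη μ U i) =
    (μ⁻¹ ^ 2) • (ofTime (fun t => η (μ ^ 2 * t)) (contDiff_timeScale hη _) * dX j (perp U i)) := by
  rw [extPotential, Derivation.map_smul, Dv_mul, dX_ofTime, mul_zero, add_zero]

lemma div_extPotential : dX 0 (extPotential hη μ U 0) + dX 1 (extPotential hη μ U 1) = 0 := by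
  rw [dX_extPotential, dX_extPotential, ← smul_add, ← mul_add, div_perp, mul_zero, smul_zero]

lemma SB.timeScale {N : ℕ} (h : SB N cη 1 η) (κ : ℝ) (hκ : 0 ≤ κ) :
    SB N cη κ (ofTime (fun t => η (κ * t)) (contDiff_timeScale hη κ)).1 := by
  have h1 := h.comp_clm zero_le_one (κ • ContinuousLinearMap.fst ℝ ℝ E2) (D' := κ) (by
    rw [norm_smul, Real.norm_of_nonneg hκ]
    exact mul_le_of_le_one_right hκ (ContinuousLinearMap.norm_fst_le ℝ ℝ E2))
  rw [one_mul] at h1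
  exact h1

lemma SB.extPotential (hη4 : SB 4 cη 1 η) (hU : SB 5 Γ (4 * μ) U.1) (hμ : 4 ≤ μ)
    (hμΓ : 4 * cη * Γ ≤ μ) (i : Fin 2) : SB 4 μ (μ ^ 3) (extPotential hη μ U i).1 := by
  have hμ0 : 0 < μ := by linarith
  have h1 := ((SB.timeScale hη hη4 (μ ^ 2) (by positivity)).mul
    (hU.perp (by positivity) i)).const_mul (μ⁻¹ ^ 2)
  refine SB.mono (f := (HeatFlow.extPotential hη μ U i).1) h1 (by positivity) ?_ ?_
  · rw [abs_of_nonneg (by positivity)]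
    have e : μ⁻¹ ^ 2 * (cη * (Γ * (4 * μ))) = (4 * cη * Γ) / μ := by
      field_simp
    rw [e, div_le_iff₀ hμ0]
    nlinarith
  · nlinarith [mul_pos hμ0 hμ0, mul_pos (mul_pos hμ0 hμ0) hμ0]

lemma abs_dX_extPotential_le (hη4 : SB 4 cη 1 η) (hU : SB 5 Γ (4 * μ) U.1) (hμ : 0 < μ)
    (i j : Fin 2) (p : ST) : |(dX j (HeatFlow.extPotential hη μ U i)).1 p| ≤ 16 * cη * Γ := by
  rw [dX_extPotential, Sm.smul_val, Sm.mul_val, abs_mul, abs_mul, abs_of_nonneg (by positivity)]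
  have h1 := (SB.timeScale hη hη4 (μ ^ 2) (by positivity)).norm_le p
  have h2 := ((hU.perp (by positivity) i).dX (by positivity) j).norm_le p
  rw [Real.norm_eq_abs] at h1 h2
  have h3 := mul_le_mul h1 h2 (abs_nonneg _) hη4.nonneg
  calc _ ≤ μ⁻¹ ^ 2 * (cη * (Γ * (4 * μ) * (4 * μ))) :=
        mul_le_mul_of_nonneg_left h3 (by positivity)
    _ = 16 * cη * Γ := by field_simp; ring

end ExtPotential

/-- Smooth functions that extend the coefficients near the identity, with bounded derivatives. -/
lemma GeometricData.exists_coef_family (G : GeometricData) :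
    ∃ (ck : E2 → Matrix (Fin 2) (Fin 2) ℝ → ℝ) (cA : ℝ), 0 ≤ cA ∧ (∀ k, ContDiff ℝ ∞ (ck k)) ∧
      ∀ k ∈ G.Λ, SB 2 cA 1 (ck k) ∧
      ∀ T : Matrix (Fin 2) (Fin 2) ℝ, T.IsSymm → ‖T‖ ≤ 1 / 2000 → ck k T = G.coef k (1 + T) := by
  have h : ∀ k, ∃ (f : Matrix (Fin 2) (Fin 2) ℝ → ℝ) (C : ℝ), 0 ≤ C ∧ ContDiff ℝ ∞ f ∧ (k ∈ G.Λ →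
      SB 2 C 1 f ∧ ∀ T : Matrix (Fin 2) (Fin 2) ℝ, T.IsSymm → ‖T‖ ≤ 1 / 2000 →
        f T = G.coef k (1 + T)) := by
    intro k
    by_cases hk : k ∈ G.Λ
    · obtain ⟨f, hf, hc, h1⟩ := G.exists_coef_ext hk
      obtain ⟨C, hC, h2⟩ := SB.of_hasCompactSupport hf hc 2
      exact ⟨f, C, hC, hf, fun _ => ⟨h2, h1⟩⟩
    · exact ⟨fun _ => 0, 0, le_rfl, contDiff_const, fun h => absurd h hk⟩
  choose ck C hC hs hck using h
  refine ⟨ck, ∑ k ∈ G.Λ, C k, Finset.sum_nonneg fun k _ => hC k, hs, fun k hk => ⟨?_, (hck k hk).2⟩⟩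
  exact (hck k hk).1.mono_left zero_le_one
    (Finset.single_le_sum (f := C) (fun i _ => hC i) hk)

/-- A flow whose stream function has size `Γ` small compared to `C₀` can be continued to the next
level: then `𝓡 / (1000 C₀)` stays in the region near zero where the geometric decomposition holds.
The constant `c` is chosen before `C₀`, whereas the lower bound `L` for the frequency may depend on
`C₀` and `Γ`. -/
theorem exists_step (G : GeometricData) (φ : Profile) (M : Mollifiers) (K : ℕ → ℝ) :
    ∃ c : ℝ, 1 ≤ c ∧ ∀ C₀ : ℝ, 1 ≤ C₀ → ∀ Γ : ℝ, c * Γ ≤ C₀ →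
      ∃ L : ℝ, ∀ a b : ℕ, 1 ≤ a → 1 ≤ b → ∀ χ : ℕ → E2 → ℝ, IsCutoffSequence G φ a b K χ →
        ∀ n, 1 ≤ n → L ≤ lam G a b n → ∀ U : Sm, Level G φ M C₀ a b χ Γ n U →
          ∃ (V : Fin 2 → Sm) (A As : E2 → Sm) (X : Sm), Step G φ M C₀ a b χ c n V A As X := by
  obtain ⟨η, hη, hη1, hηb⟩ := exists_decay
  obtain ⟨cη, hcη, hη4⟩ := hηb 4
  obtain ⟨ck, cA, hcA, hcks, hck⟩ := G.exists_coef_family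
  obtain ⟨cM, hcM, hsm⟩ := M.exists_smear_bound 5
  set s0 : ℝ := ∑ q : Fin 2 × Fin 2, ‖Matrix.single q.1 q.2 (1 : ℝ)‖ with hs0
  have hs0' : 0 ≤ s0 := Finset.sum_nonneg fun _ _ => norm_nonneg _
  set cK : ℝ := ∑ j ∈ Finset.range 6, |K j| with hcK
  have hcK' : 0 ≤ cK := Finset.sum_nonneg fun _ _ => abs_nonneg _
  refine ⟨1 + 64 * cη * s0 + cM * cA + cK, by
    have := mul_nonneg hcη hs0'
    have := mul_nonneg hcM.le hcA
    linarith, fun C₀ hC₀ Γ hΓC => ?_⟩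
  set c := 1 + 64 * cη * s0 + cM * cA + cK with hc
  refine ⟨4 + 4 * cη * |Γ| + 4 * s0 + 2 * cA, fun a b ha hb χ hχ n hn hL U hU => ?_⟩
  set μ := lam G a b n with hμ
  have hΓ0 : 0 ≤ Γ := hU.bound.nonneg
  rw [abs_of_nonneg hΓ0] at hL
  have hp1 := mul_nonneg hcη hs0'
  have hp2 := mul_nonneg hcM.le hcA
  have hp3 := mul_nonneg hcη hΓ0
  have hμ4 : 4 ≤ μ := by nlinarith
  have hμ0 : 0 < μ := by linarith
  have hμ1 : 1 ≤ μ := by linarith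
  have hμΓ : 4 * cη * Γ ≤ μ := by nlinarith
  have hC0 : 0 < C₀ := by linarith
  set V : Fin 2 → Sm := extPotential hη μ U with hV
  have hVb : ∀ i, SB 4 μ (μ ^ 3) (V i).1 := SB.extPotential hη hη4 hU.bound hμ4 hμΓ
  have hVflow : ∀ t, 0 ≤ t → ∀ x i, potential G φ M C₀ a b χ n t x i = (V i).1 (t, x) := by
    intro t ht x i
    rw [hU.pot t ht x i, ← hμ, neg_mul]
    simp only [hV, extPotential, Sm.smul_val, Sm.mul_val, ofTime]
    rw [hη1 _ (by positivity)]
    ring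
  have hVper : ∀ i, SPer (V i) := fun i => ((SPer.ofTime _ _).mul (hU.per.perp i)).smul _
  set R : Fin 2 → Fin 2 → Sm := fun i j => dX i (V j) + dX j (V i) with hR
  have hRsymm : ∀ i j, R i j = R j i := fun i j => add_comm _ _
  have hRper : ∀ i j, SPer (R i j) := fun i j => ((hVper j).Dv _).add ((hVper i).Dv _)
  have hRabs : ∀ i j p, |(R i j).1 p| ≤ 32 * cη * Γ := by
    intro i j p
    have h1 := abs_dX_extPotential_le hη hη4 hU.bound hμ0 j i p
    have h2 := abs_dX_extPotential_le hη hη4 hU.bound hμ0 i j p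
    simp only [hR, Sm.add_val]
    exact (abs_add_le _ _).trans (by linarith)
  set κ : ℝ := 1 / (1000 * C₀) with hκ
  have hκ0 : 0 < κ := by positivity
  have hκ1 : κ ≤ 1 := by
    rw [hκ, div_le_one (by positivity)]; linarith
  set T : ST → Matrix (Fin 2) (Fin 2) ℝ :=
    fun p => κ • Matrix.of fun i j => (R i j).1 p with hT
  have hTeq : T = fun p => ∑ q : Fin 2 × Fin 2,
      (κ * (R q.1 q.2).1 p) • Matrix.single q.1 q.2 (1 : ℝ) := by
    funext p
    simp only [hT]
    rw [of_eq_sum_single, Finset.smul_sum]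
    simp only [smul_smul]
  have hTsymm : ∀ p, (T p).IsSymm := by
    intro p
    ext i j
    simp only [hT, Matrix.transpose_apply, Matrix.smul_apply, Matrix.of_apply, hRsymm j i]
  have hTnorm : ∀ p, ‖T p‖ ≤ 1 / 2000 := by
    intro p
    rw [hTeq]
    have h1 : ‖∑ q : Fin 2 × Fin 2, (κ * (R q.1 q.2).1 p) • Matrix.single q.1 q.2 (1 : ℝ)‖ ≤
        ∑ q : Fin 2 × Fin 2, κ * (32 * cη * Γ) * ‖Matrix.single q.1 q.2 (1 : ℝ)‖ := by
      refine norm_sum_le_of_le _ fun q _ => ?_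
      rw [norm_smul, norm_mul, Real.norm_of_nonneg hκ0.le, Real.norm_eq_abs]
      gcongr
      exact hRabs _ _ _
    rw [← Finset.mul_sum, ← hs0] at h1
    refine h1.trans ?_
    have h2 : 64 * cη * s0 * Γ ≤ C₀ := by
      refine le_trans (mul_le_mul_of_nonneg_right ?_ hΓ0) hΓC
      linarith
    rw [hκ, div_mul_eq_mul_div, div_mul_eq_mul_div, div_le_div_iff₀ (by positivity) (by norm_num)]
    nlinarith
  have hTs : SB 3 (2 * s0 * μ ^ 4) (μ ^ 3) T := by
    rw [hTeq]
    have h1 : ∀ q ∈ (Finset.univ : Finset (Fin 2 × Fin 2)),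
        SB 3 (‖Matrix.single q.1 q.2 (1 : ℝ)‖ * (2 * μ ^ 4)) (μ ^ 3)
          fun p => (κ * (R q.1 q.2).1 p) • Matrix.single q.1 q.2 (1 : ℝ) := by
      intro q _
      have h2 := (((hVb q.2).dX (by positivity) q.1).add
        ((hVb q.1).dX (by positivity) q.2)).const_mul κ
      refine SB.smul_const _ (h2.mono_left (by positivity) ?_)
      rw [abs_of_pos hκ0]
      have : 0 ≤ μ * μ ^ 3 + μ * μ ^ 3 := by positivity
      calc κ * (μ * μ ^ 3 + μ * μ ^ 3) ≤ 1 * (μ * μ ^ 3 + μ * μ ^ 3) :=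
            mul_le_mul_of_nonneg_right hκ1 this
        _ = 2 * μ ^ 4 := by ring
    refine (SB.sum (by positivity) h1).mono_left (by positivity) (le_of_eq ?_)
    rw [← Finset.sum_mul, ← hs0]
    ring
  set A : E2 → Sm := fun k => ⟨fun p => ck k (T p), (hcks k).comp hTs.smooth⟩ with hA
  have hAval : ∀ k ∈ G.Λ, ∀ p, (A k).1 p = G.coef k (1 + T p) := fun k hk p =>
    (hck k hk).2 _ (hTsymm p) (hTnorm p)
  have hTball : ∀ p, 1 + T p ∈ symBall := by
    intro p
    refine ⟨?_, ?_⟩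
    · rw [Matrix.IsSymm, Matrix.transpose_add, Matrix.transpose_one, (hTsymm p).eq]
    · rw [add_sub_cancel_left]
      exact (hTnorm p).trans_lt (by norm_num)
  have hAabs : ∀ k ∈ G.Λ, ∀ p, ‖(A k).1 p‖ ≤ cA := fun k hk p => (hck k hk).1.norm_le _
  have hAb : ∀ k ∈ G.Λ, SB 2 μ (μ ^ 8) (A k).1 := by
    intro k hk
    have h1 := (hck k hk).1.comp (N := 2) hTs.smooth (D := μ ^ 8) (fun j hj1 hj2 p => ?_)
      (by positivity)
    · refine SB.mono_left (f := (A k).1) h1 (by positivity) ?_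
      norm_num [Nat.factorial]
      linarith
    · refine (hTs.bound j (by omega) p).trans ?_
      have h2 : 2 * s0 ≤ μ := by linarith
      calc 2 * s0 * μ ^ 4 * (μ ^ 3) ^ j ≤ μ * μ ^ 4 * (μ ^ 3) ^ j := by gcongr
        _ = μ ^ 5 * (μ ^ 3) ^ j := by ring
        _ ≤ (μ ^ 5) ^ j * (μ ^ 3) ^ j := by
            gcongr
            exact le_self_pow₀ (one_le_pow₀ hμ1) (by omega)
        _ = (μ ^ 8) ^ j := by rw [← mul_pow, ← pow_add]
  have hℓ : 0 < ell G a b n := inv_pos.2 (pow_pos hμ0 50)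
  have hℓinv : (ell G a b n)⁻¹ = μ ^ 50 := inv_inv _
  set As : E2 → Sm := fun k => if hk : k ∈ G.Λ then
    M.smearSm hℓ (A k).continuous ⟨cA, hAabs k hk⟩ else 0 with hAs
  have hAsval : ∀ k ∈ G.Λ, (As k).1 = M.smear (ell G a b n) (A k).1 := by
    intro k hk
    simp only [hAs, dif_pos hk, Mollifiers.smearSm]
  have hAfd : ∀ k ∈ G.Λ, ∀ p, ‖fderiv ℝ (A k).1 p‖ ≤ μ * μ ^ 8 := by
    intro k hk p
    have := (hAb k hk).bound 1 (by norm_num) p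
    rwa [norm_iteratedFDeriv_one, pow_one] at this
  have hAper : ∀ k ∈ G.Λ, SPer (A k) := by
    intro k hk s i y
    have h2 : T (s, y + EuclideanSpace.single i (2 * Real.pi)) = T (s, y) := by
      simp only [hT]
      congr 2
      funext i' j'
      exact hRper i' j' s i y
    simp only [hA, h2]
  have hχs := hχ.smooth n hn
  set X : Sm := ofSpace (χ n) hχs with hX
  have hXb : SB 5 c μ X.1 := by
    have h1 : SB 5 cK (μ ^ (1 / 4 : ℝ)) (χ n) := by
      refine ⟨hχs, fun j hj x => (hχ.bound n hn j x).trans ?_⟩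
      have e : lam G a b n ^ ((j : ℝ) / 4) = (μ ^ (1 / 4 : ℝ)) ^ j := by
        rw [← Real.rpow_natCast, ← Real.rpow_mul hμ0.le]
        congr 1
        ring
      rw [e]
      refine mul_le_mul_of_nonneg_right ((le_abs_self _).trans ?_) (by positivity)
      exact Finset.single_le_sum (f := fun j => |K j|) (fun _ _ => abs_nonneg _)
        (Finset.mem_range.2 (by omega))
    have h2 := h1.comp_clm (by positivity) (ContinuousLinearMap.snd ℝ ℝ E2) (D' := 1)
      (ContinuousLinearMap.norm_snd_le ℝ ℝ E2)
    rw [mul_one] at h2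
    refine SB.mono (f := X.1) h2 (by positivity) (by linarith) ?_
    calc μ ^ (1 / 4 : ℝ) ≤ μ ^ (1 : ℝ) := Real.rpow_le_rpow_of_exponent_le hμ1 (by norm_num)
      _ = μ := Real.rpow_one μ
  refine ⟨V, A, As, X, ?_⟩
  refine
    { V_per := hVper
      V_bound := hVb
      V_div := div_extPotential hη
      V_flow := hVflow
      A_sum := ?_
      A_bound := hAb
      A_per := hAper
      As_neg := ?_
      As_bound := ?_
      As_per := ?_
      As_sub := ?_
      dAs_sub := ?_
      X_val := fun p => rfl
      X_bound := hXb
      X_per := fun t => hχ.periodic n hn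
      X_mul := ?_
      amp := ?_ }
  -- The geometric decomposition at `Id + 𝓡 / (1000 C₀)`.
  · intro i j
    ext p
    have h1 := congrFun (congrFun (G.decomposition _ (hTball p)) i) j
    simp only [Matrix.sum_apply, Matrix.smul_apply, Matrix.vecMulVec_apply, Matrix.add_apply,
      smul_eq_mul, Matrix.one_apply, hT, Matrix.of_apply, hR] at h1
    simp only [Sm.sum_val, Sm.smul_val, Sm.pow_val, Sm.add_val] at h1 ⊢
    have h2 : (if i = j then (1 : Sm) else 0).1 p = if i = j then 1 else 0 := by
      split_ifs <;> rfl
    rw [h2, ← one_div, h1]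
    refine Finset.sum_congr rfl fun k hk => ?_
    rw [hAval k hk p]
    simp only [hT, hR]
    exact mul_comm _ _
  · intro k hk
    have h1 : A (-k) = A k := by
      ext p
      rw [hAval _ (G.neg_mem k hk), hAval k hk, G.coef_neg k hk _ (hTball p)]
    apply Subtype.ext
    rw [hAsval _ (G.neg_mem k hk), hAsval k hk, h1]
  · intro k hk
    rw [hAsval k hk]
    have h1 := hsm _ _ cA hℓ (A k).continuous (hAabs k hk)
    rw [hℓinv] at h1
    exact h1.mono_left (by positivity) (by linarith)
  · intro k hk t i x
    simp only [hAsval k hk, Mollifiers.smear]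
    refine integral_congr_ae (Filter.Eventually.of_forall fun z => ?_)
    have e1 : ((t, x + EuclideanSpace.single i (2 * Real.pi)) : ST) - ell G a b n • z =
        (t - ell G a b n * z.1, x - ell G a b n • z.2 + EuclideanSpace.single i (2 * Real.pi)) :=
      Prod.ext rfl (add_sub_right_comm _ _ _)
    have e2 : ((t, x) : ST) - ell G a b n • z =
      (t - ell G a b n * z.1, x - ell G a b n • z.2) := rfl
    dsimp only
    rw [e1, e2]
    exact congrArg _ (hAper k hk _ i _)
  -- One derivative of `A` is lost against the mollification length `ℓ_n = λ_n⁻⁵⁰`: `50 - 9 = 41`.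
  · intro k hk p
    rw [Sm.sub_val, hAsval k hk]
    refine (M.abs_smear_sub_le hℓ (A k).differentiable (hAfd k hk) p).trans (le_of_eq ?_)
    rw [ell, ← hμ]
    field_simp
  -- A second derivative of `A` costs another factor `λ_n⁸`: `41 - 8 = 33`.
  · intro k hk v hv p
    have hfd := (hAb k hk).fderiv_apply v hv (by positivity)
    have h1 := M.abs_smear_sub_le hℓ (hfd.smooth.differentiable (by simp))
      (B := μ * μ ^ 8 * μ ^ 8) (fun q => by
        have := hfd.bound 1 le_rfl q
        rwa [norm_iteratedFDeriv_one, pow_one] at this) p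
    rw [map_sub, Sm.sub_val, Dv_val, Dv_val, hAsval k hk,
      M.fderiv_smear _ (A k).smooth (hAfd k hk)]
    refine h1.trans (le_of_eq ?_)
    rw [ell, ← hμ]
    field_simp
  -- Where the cutoff differs from one, the stream function vanishes locally, hence so does `V`.
  · intro i j
    ext p
    rw [Sm.mul_val, Sm.pow_val]
    rcases hU.one p with h | h
    · have : X.1 p = 1 := h
      rw [this]; ring
    · have h1 : ∀ i j, (dX j (V i)).1 p = 0 := by
        intro i j
        rw [hV, dX_extPotential, Sm.smul_val,
          (eventuallyEq_zero_mul (eventuallyEq_zero_Dv (eventuallyEq_zero_perp h i) _)).eq_of_nhds]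
        simp
      rw [Sm.add_val, h1, h1]
      ring
  · intro k hk t ht x
    rw [hAsval k hk]
    refine M.amplitude_eq_smear hℓ (A k).continuous (fun s hs y => ?_) ht x
    rw [hAval k hk]
    congr 2
    simp only [hT]
    congr 1
    have h1 : potential G φ M C₀ a b χ n s = fun y i => (V i).1 (s, y) := by
      funext y i
      exact hVflow s hs y i
    rw [h1, symGrad]
    congr 1
    funext i j
    rw [pd_slice, pd_slice]
    rfl

end

/-! ### The stream function of the next level -/

/-- The profile `φ_{k,n+1}` as a function on space-time. -/
def blockWave (G : GeometricData) (φ : Profile) (a b n : ℕ) (k : E2) : Sm :=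
  wave φ.toFun φ.smooth (lam G a b (n + 1) ^ (1 / 4 : ℝ) • k)

/-- The slowly varying part `(2000 C₀)^{1/2} ã_k χ_n` of the amplitudes at level `n + 1`. -/
def slowAmp (C₀ : ℝ) (As : E2 → Sm) (X : Sm) (k : E2) : Sm :=
  Real.sqrt (2000 * C₀) • (As k * X)

/-- The amplitudes of the plane waves at level `n + 1`. -/
def waveAmp (G : GeometricData) (φ : Profile) (C₀ : ℝ) (a b n : ℕ) (As : E2 → Sm) (X : Sm)
    (k : E2) : Sm :=
  slowAmp C₀ As X k * blockWave G φ a b n k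

/-- The stream function at level `n + 1`. -/
def nextStream (G : GeometricData) (φ : Profile) (C₀ : ℝ) (a b n : ℕ) (As : E2 → Sm) (X : Sm) : Sm :=
  streamSum G.Λ (lam G a b (n + 1)) (orient G) (waveAmp G φ C₀ a b n As X)

lemma blockWave_val (G : GeometricData) (φ : Profile) (a b n : ℕ) (k : E2) (p : ST) :
    (blockWave G φ a b n k).1 p = block G φ a b (n + 1) k p.2 := by
  simp only [blockWave, wave, block, inner_smul_left, conj_trivial]

lemma blockWave_neg (G : GeometricData) (φ : Profile) (a b n : ℕ) (k : E2) :
    blockWave G φ a b n (-k) = blockWave G φ a b n k := by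
  ext p
  simp only [blockWave_val, block, inner_neg_left, mul_neg, φ.even]

section Step

variable {G : GeometricData} {φ : Profile} {M : Mollifiers} {C₀ : ℝ} {a b : ℕ} {χ : ℕ → E2 → ℝ}
  {c : ℝ} {n : ℕ} {V : Fin 2 → Sm} {A As : E2 → Sm} {X : Sm}

lemma Step.waveAmp_neg (hS : Step G φ M C₀ a b χ c n V A As X) {k : E2} (hk : k ∈ G.Λ) :
    waveAmp G φ C₀ a b n As X (-k) = waveAmp G φ C₀ a b n As X k := by
  rw [waveAmp, waveAmp, slowAmp, slowAmp, hS.As_neg k hk, blockWave_neg]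

lemma Step.slowAmp_per (hS : Step G φ M C₀ a b χ c n V A As X) {k : E2} (hk : k ∈ G.Λ) :
    SPer (slowAmp C₀ As X k) := ((hS.As_per k hk).mul hS.X_per).smul _

lemma blockWave_per (hab : ∃ m : ℕ, a ^ b = m ^ 4) {k : E2} (hk : k ∈ G.Λ) :
    SPer (blockWave G φ a b n k) :=
  SPer.wave_of_periodic _ φ.periodic fun i => quarter_smul_mem G hab (by omega) hk i

lemma Step.waveAmp_per (hS : Step G φ M C₀ a b χ c n V A As X) (hab : ∃ m : ℕ, a ^ b = m ^ 4)
    {k : E2} (hk : k ∈ G.Λ) : SPer (waveAmp G φ C₀ a b n As X k) :=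
  (hS.slowAmp_per hk).mul (blockWave_per hab hk)

lemma Step.nextStream_per (hS : Step G φ M C₀ a b χ c n V A As X) (hab : ∃ m : ℕ, a ^ b = m ^ 4) :
    SPer (nextStream G φ C₀ a b n As X) :=
  SPer.sum fun _ hk => ((hS.waveAmp_per hab hk).mul (SPer.wave_of_periodic _ Real.cos_periodic
    fun i => lam_smul_mem G a b (n + 1) hk i)).smul _

lemma Step.slowAmp_bound (hS : Step G φ M C₀ a b χ c n V A As X)
    (hμ : 2 ≤ lam G a b n) {k : E2} (hk : k ∈ G.Λ) :
    SB 5 (c ^ 2 * Real.sqrt 2000 * Real.sqrt C₀) (lam G a b n ^ 51) (slowAmp C₀ As X k).1 := by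
  have h := ((hS.As_bound k hk).mul hS.X_bound).const_mul (Real.sqrt (2000 * C₀))
  refine SB.mono (f := (slowAmp C₀ As X k).1) h (by positivity) (le_of_eq ?_) ?_
  · rw [abs_of_nonneg (Real.sqrt_nonneg _), Real.sqrt_mul (by norm_num)]
    ring
  · have h1 : lam G a b n ≤ lam G a b n ^ 50 := le_self_pow₀ (by linarith) (by norm_num)
    calc lam G a b n ^ 50 + lam G a b n ≤ lam G a b n ^ 50 * 2 := by linarith
      _ ≤ lam G a b n ^ 50 * lam G a b n := by gcongr
      _ = lam G a b n ^ 51 := by ring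

lemma blockWave_bound {cφ : ℝ} (hφ : SB 5 cφ 1 φ.toFun) {k : E2} (hk : k ∈ G.Λ)
    (hlam : 0 ≤ lam G a b (n + 1)) :
    SB 5 cφ (lam G a b (n + 1) ^ (1 / 4 : ℝ)) (blockWave G φ a b n k).1 :=
  hφ.wave _ (by
    rw [norm_smul, G.norm_eq_one k hk, mul_one, Real.norm_of_nonneg (by positivity)])

lemma Step.waveAmp_bound (hS : Step G φ M C₀ a b χ c n V A As X)
    (hμ : 2 ≤ lam G a b n) (hμr : lam G a b n ^ 51 ≤ lam G a b (n + 1) ^ (1 / 4 : ℝ))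
    (hlam : 0 ≤ lam G a b (n + 1)) {cφ : ℝ} (hφ : SB 5 cφ 1 φ.toFun) {k : E2} (hk : k ∈ G.Λ) :
    SB 5 (c ^ 2 * Real.sqrt 2000 * Real.sqrt C₀ * cφ) (2 * lam G a b (n + 1) ^ (1 / 4 : ℝ))
      (waveAmp G φ C₀ a b n As X k).1 :=
  SB.mono (f := (waveAmp G φ C₀ a b n As X k).1)
    ((hS.slowAmp_bound hμ hk).mul (blockWave_bound hφ hk hlam)) (by positivity) le_rfl
    (by linarith)

/-- The stream function of the statement, whose terms are complex exponentials, in real form. -/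
lemma Step.stream_eq (hS : Step G φ M C₀ a b χ c n V A As X) {t : ℝ} (ht : 0 ≤ t) (x : E2) :
    stream G φ M C₀ a b χ n (fun s => symGrad (potential G φ M C₀ a b χ n s)) t x =
      -lam G a b (n + 1) * (nextStream G φ C₀ a b n As X).1 (t, x) := by
  rw [stream, Complex.re_sum, nextStream, streamSum, Sm.sum_val, Finset.mul_sum]
  refine Finset.sum_congr rfl fun k hk => ?_
  rw [hS.amp k hk t ht, curl_planeExp, mul_comm Complex.I, Complex.re_ofReal_mul,
    ← Complex.ofReal_neg, Complex.re_ofReal_mul, Complex.exp_ofReal_mul_I_re]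
  simp only [Sm.smul_val, Sm.mul_val, waveAmp, slowAmp, blockWave_val, hS.X_val, cosW, wave,
    inner_smul_left, conj_trivial]
  ring

/-- The potential of the next level has the shape required by `Level`: the sum of the statement
contributes a factor `-λ_{n+1}`, which compensates the sign and one power in `-λ_{n+1}⁻³`. -/
lemma Step.potential_succ (hS : Step G φ M C₀ a b χ c n V A As X) (hn : 1 ≤ n)
    (hlam : lam G a b (n + 1) ≠ 0) {t : ℝ} (ht : 0 ≤ t) (x : E2) (i : Fin 2) :
    potential G φ M C₀ a b χ (n + 1) t x i = (lam G a b (n + 1))⁻¹ ^ 2 *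
      Real.exp (-(lam G a b (n + 1)) ^ 2 * t) *
        (perp (nextStream G φ C₀ a b n As X) i).1 (t, x) := by
  obtain ⟨j, rfl⟩ := Nat.exists_eq_add_of_le' hn
  set U := nextStream G φ C₀ a b (j + 1) As X
  have h1 : potential G φ M C₀ a b χ (j + 2) t x i =
      -(lam G a b (j + 2) ^ 3)⁻¹ * Real.exp (-(lam G a b (j + 2)) ^ 2 * t) *
        perpGrad (stream G φ M C₀ a b χ (j + 1)
          (fun s => symGrad (potential G φ M C₀ a b χ (j + 1) s)) t) x i := rfl
  have h2 : stream G φ M C₀ a b χ (j + 1)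
      (fun s => symGrad (potential G φ M C₀ a b χ (j + 1) s)) t =
        fun y => ((-lam G a b (j + 2)) • U).1 (t, y) := funext fun y => hS.stream_eq ht y
  have h3 : perpGrad (fun y => ((-lam G a b (j + 2)) • U).1 (t, y)) x i =
      -lam G a b (j + 2) * (perp U i).1 (t, x) := by
    rw [perpGrad, pd_slice, pd_slice, Derivation.map_smul, Derivation.map_smul]
    fin_cases i
    · rfl
    · exact (mul_neg _ _).symm
  change potential G φ M C₀ a b χ (j + 2) t x i = (lam G a b (j + 2))⁻¹ ^ 2 *
    Real.exp (-(lam G a b (j + 2)) ^ 2 * t) * (perp U i).1 (t, x)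
  have hlam' : lam G a b (j + 2) ≠ 0 := hlam
  rw [h1, h2, h3]
  field_simp

/-- The stream function of the next level. Its size is of order `√C₀`, whatever the size of the
previous one; it vanishes near the points where `χ_{n+1}` differs from one because the cutoffs are
nested. -/
lemma Step.level_succ {K : ℕ → ℝ} (hχ : IsCutoffSequence G φ a b K χ)
    (hS : Step G φ M C₀ a b χ c n V A As X) (hn : 1 ≤ n) (ha : 1 ≤ a)
    (hab : ∃ m : ℕ, a ^ b = m ^ 4) (hμ : 2 ≤ lam G a b n)
    (hμr : lam G a b n ^ 51 ≤ lam G a b (n + 1) ^ (1 / 4 : ℝ)) (hlam : 1 ≤ lam G a b (n + 1))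
    {cφ : ℝ} (hφ : SB 5 cφ 1 φ.toFun) :
    Level G φ M C₀ a b χ (G.Λ.card * (c ^ 2 * Real.sqrt 2000 * Real.sqrt C₀ * cφ)) (n + 1)
      (nextStream G φ C₀ a b n As X) := by
  have hlam0 : 0 < lam G a b (n + 1) := lam_pos G ha _
  have hr : lam G a b (n + 1) ^ (1 / 4 : ℝ) ≤ lam G a b (n + 1) := by
    calc _ ≤ lam G a b (n + 1) ^ (1 : ℝ) := Real.rpow_le_rpow_of_exponent_le hlam (by norm_num)
      _ = _ := Real.rpow_one _
  refine ⟨hS.nextStream_per hab, ?_, fun t ht x i => hS.potential_succ hn hlam0.ne' ht x i, ?_⟩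
  · have h1 : ∀ k ∈ G.Λ, SB 5 (c ^ 2 * Real.sqrt 2000 * Real.sqrt C₀ * cφ)
        (4 * lam G a b (n + 1)) (orient G k • (waveAmp G φ C₀ a b n As X k *
          cosW (lam G a b (n + 1) • k))).1 := by
      intro k hk
      have h2 := ((hS.waveAmp_bound hμ hμr hlam0.le hφ hk).mul
        (SB.cosW 5 (ξ := lam G a b (n + 1) • k) (R := lam G a b (n + 1)) (by
          rw [norm_smul, G.norm_eq_one k hk, mul_one, Real.norm_of_nonneg hlam0.le]))).const_mul
            (orient G k)
      have h3 : |orient G k| = 1 := (pow_eq_one_iff_of_nonneg (abs_nonneg _)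
        two_ne_zero).1 (by rw [sq_abs, orient_sq G hk])
      rw [h3, one_mul, mul_one] at h2
      exact SB.mono h2 (by positivity) le_rfl (by linarith)
    have h2 := SB.sum_const (by positivity) h1
    have h3 : (nextStream G φ C₀ a b n As X).1 = fun p => ∑ k ∈ G.Λ,
        (orient G k • (waveAmp G φ C₀ a b n As X k * cosW (lam G a b (n + 1) • k))).1 p := by
      funext p
      rw [nextStream, streamSum, Sm.sum_val]
    rw [h3]
    exact h2
  · intro p
    have key : (∀ k ∈ G.Λ, (waveAmp G φ C₀ a b n As X k).1 =ᶠ[nhds p] 0) →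
        (nextStream G φ C₀ a b n As X).1 =ᶠ[nhds p] 0 := by
      intro h
      filter_upwards [(Filter.eventually_all_finset G.Λ).2 h] with q hq
      rw [nextStream, streamSum, Sm.sum_val]
      refine Finset.sum_eq_zero fun k hk => ?_
      rw [Sm.smul_val, Sm.mul_val, hq k hk]
      simp
    by_cases h1 : p.2 ∈ tsupport (χ n)
    · by_cases h2 : p.2 ∈ ⋃ k ∈ G.Λ, Omega G φ a b (n + 1) k
      · exact Or.inl (hχ.nested n hn p.2 h1 h2)
      · refine Or.inr (key fun k hk => eventuallyEq_zero_mul ?_)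
        have h3 : p.2 ∉ tsupport (block G φ a b (n + 1) k) := fun h =>
          h2 (Set.mem_biUnion hk h)
        have h4 := (notMem_tsupport_iff_eventuallyEq.1 h3)
        filter_upwards [continuous_snd.continuousAt.eventually h4] with q hq
        rw [blockWave_val, hq]
        rfl
    · refine Or.inr (key fun k _ => ?_)
      have h4 := (notMem_tsupport_iff_eventuallyEq.1 h1)
      filter_upwards [continuous_snd.continuousAt.eventually h4] with q hq
      rw [waveAmp, slowAmp, Sm.mul_val, Sm.smul_val, Sm.mul_val, hS.X_val, hq]
      simp

end Step

/-- The first flow comes from the stream function `-cos(λ_1 x_1)`; the cutoff `χ_1` equals one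
everywhere. -/
lemma level_one (G : GeometricData) (φ : Profile) (M : Mollifiers) (C₀ : ℝ) {a b : ℕ} (ha : 1 ≤ a)
    {K : ℕ → ℝ} {χ : ℕ → E2 → ℝ} (hχ : IsCutoffSequence G φ a b K χ) {Γ : ℝ} (hΓ : 1 ≤ Γ) :
    Level G φ M C₀ a b χ Γ 1 (-cosW (lam G a b 1 • EuclideanSpace.single 0 1)) := by
  have hlam0 : 0 < lam G a b 1 := lam_pos G ha _
  refine ⟨?_, ?_, ?_, ?_⟩
  · refine (SPer.wave_of_periodic _ Real.cos_periodic fun i => ?_).neg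
    refine ⟨if i = 0 then (G.N : ℤ) ^ 4 * (a : ℤ) ^ (b ^ 1) else 0, ?_⟩
    fin_cases i <;> simp [lam]
  · refine SB.mono (SB.cosW 5 (R := lam G a b 1) ?_).neg hlam0.le hΓ (by linarith)
    rw [norm_smul, Real.norm_of_nonneg hlam0.le]
    simp
  · intro t _ x i
    have h0 : potential G φ M C₀ a b χ 1 t x i = ![0, -(lam G a b 1)⁻¹ *
      Real.exp (-(lam G a b 1) ^ 2 * t) * Real.sin (lam G a b 1 * x 0)] i := rfl
    rw [h0]
    fin_cases i
    · simp [perp, dX_cosW]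
    · have h1 : (perp (-cosW (lam G a b 1 • EuclideanSpace.single 0 1)) 1).1 (t, x) =
          -(lam G a b 1 * Real.sin (lam G a b 1 * x 0)) := by
        change -((dX 0 (-cosW (lam G a b 1 • EuclideanSpace.single 0 1))).1 (t, x)) = _
        rw [map_neg, dX_cosW, neg_neg, Sm.smul_val]
        change -(_ * Real.sin (inner ℝ _ _)) = _
        rw [real_inner_comm, inner_smul_right, inner_single]
        simp
      change -(lam G a b 1)⁻¹ * Real.exp (-(lam G a b 1) ^ 2 * t) *
        Real.sin (lam G a b 1 * x 0) = _ * (perp _ 1).1 (t, x)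
      rw [h1]
      field_simp
  · intro p
    refine Or.inl (hχ.eq_one 1 le_rfl _ ?_)
    simp [OmegaInter]

/-- The construction proceeds through all levels, with constants that are uniform in the level. -/
theorem exists_steps (G : GeometricData) (φ : Profile) (M : Mollifiers) (K : ℕ → ℝ) :
    ∃ c : ℝ, 1 ≤ c ∧ ∃ Cstar : ℝ, 1 ≤ Cstar ∧ ∀ C₀ : ℝ, Cstar ≤ C₀ → ∃ L : ℕ, ∀ a b : ℕ, L ≤ a →
      L ≤ b → (∃ m : ℕ, a ^ b = m ^ 4) → ∀ χ : ℕ → E2 → ℝ, IsCutoffSequence G φ a b K χ →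
        ∀ n, 1 ≤ n → ∃ (V : Fin 2 → Sm) (A As : E2 → Sm) (X : Sm),
          Step G φ M C₀ a b χ c n V A As X := by
  obtain ⟨c, hc, hstep⟩ := exists_step G φ M K
  obtain ⟨cφ, hcφ, hφ⟩ := SB.of_periodic (by positivity) φ.smooth φ.periodic 5
  set c₁ : ℝ := 1 + G.Λ.card * (c ^ 2 * Real.sqrt 2000 * cφ) with hc₁
  have hc₁1 : 1 ≤ c₁ := by
    have : 0 ≤ G.Λ.card * (c ^ 2 * Real.sqrt 2000 * cφ) := by positivity
    linarith
  -- All stream functions have size at most `Γ = c₁ √C₀`, and `c Γ ≤ C₀` as soon as `c c₁ ≤ √C₀`.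
  refine ⟨c, hc, (c * c₁) ^ 2, one_le_pow₀ (by nlinarith), fun C₀ hC₀ => ?_⟩
  have hC1 : 1 ≤ C₀ := (one_le_pow₀ (by nlinarith)).trans hC₀
  have hs1 : 1 ≤ Real.sqrt C₀ := Real.one_le_sqrt.2 hC1
  have hs2 : Real.sqrt C₀ ^ 2 = C₀ := Real.sq_sqrt (by linarith)
  have hcs : c * c₁ ≤ Real.sqrt C₀ := Real.le_sqrt_of_sq_le hC₀
  obtain ⟨L, hL⟩ := hstep C₀ hC1 (c₁ * Real.sqrt C₀) (by nlinarith)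
  refine ⟨2 + ⌈L⌉₊ + G.N ^ 4 + (8 * 51 + 1), fun a b ha hb hab χ hχ => ?_⟩
  have ha1 : 1 ≤ a := by omega
  have hb1 : 1 ≤ b := by omega
  have hlamL : ∀ n, L ≤ lam G a b n := fun n =>
    (Nat.le_ceil L).trans ((by exact_mod_cast (by omega : ⌈L⌉₊ ≤ a) : ((⌈L⌉₊ : ℕ) : ℝ) ≤ a).trans
      (le_lam G ha1 hb1 n))
  have hlam2 : ∀ n, 2 ≤ lam G a b n := fun n =>
    (by exact_mod_cast (by omega : 2 ≤ a) : (2 : ℝ) ≤ a).trans (le_lam G ha1 hb1 n)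
  have hlev : ∀ n, 1 ≤ n → ∃ U, Level G φ M C₀ a b χ (c₁ * Real.sqrt C₀) n U := by
    intro n hn
    induction n, hn using Nat.le_induction with
    | base => exact ⟨_, level_one G φ M C₀ ha1 hχ (by nlinarith)⟩
    | succ n hn ih =>
      obtain ⟨U, hU⟩ := ih
      obtain ⟨V, A, As, X, hS⟩ := hL a b ha1 hb1 χ hχ n hn (hlamL n) U hU
      have h := hS.level_succ hχ hn ha1 hab (hlam2 n)
        (lam_pow_le G 51 (by omega) (by omega) n) (by linarith [hlam2 (n + 1)]) hφ
      refine ⟨_, h.per, h.bound.mono_left (by linarith [hlam2 (n + 1)]) ?_, h.pot, h.one⟩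
      rw [hc₁]
      nlinarith
  intro n hn
  obtain ⟨U, hU⟩ := hlev n hn
  exact hL a b ha1 hb1 χ hχ n hn (hlamL n) U hU

section

open MeasureTheory

/-! ### Besov bounds for functions on space-time -/

lemma blockOp_const_mul (H : SchwartzMap E2 ℂ) (c : ℝ) (j : ℕ) (f : E2 → ℝ) (x : E2) :
    blockOp H j (fun y => ((c * f y : ℝ) : ℂ)) x = c * blockOp H j (fun y => (f y : ℂ)) x := by
  have h : ∀ r, lowPass H r (fun y => ((c * f y : ℝ) : ℂ)) x =
      c * lowPass H r (fun y => (f y : ℂ)) x := by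
    intro r
    rw [lowPass, lowPass, ← integral_const_mul]
    refine integral_congr_ae (Filter.Eventually.of_forall fun z => ?_)
    push_cast
    ring
  cases j with
  | zero => exact h 1
  | succ j => simp only [blockOp, h, mul_sub]

lemma kernelBesov_const_mul (H : SchwartzMap E2 ℂ) (s : ℝ) {c : ℝ} (hc : 0 ≤ c) (f : E2 → ℝ) :
    kernelBesov H s (fun y => c * f y) = ENNReal.ofReal c * kernelBesov H s f := by
  rw [kernelBesov, kernelBesov, ← ENNReal.tsum_mul_left]
  refine tsum_congr fun j => ?_
  simp only [blockOp_const_mul, enorm_mul]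
  rw [← ENNReal.mul_iSup]
  have : ‖(c : ℂ)‖ₑ = ENNReal.ofReal c := by
    rw [← ofReal_norm, Complex.norm_real, Real.norm_of_nonneg hc]
  rw [this]
  ring

/-- The function `f` is bounded, and at all times its norms in `B^0_{∞,1}` and `B^{-1/2}_{∞,1}` are
at most `C Z` and `C W`. -/
structure BesovLe (H : SchwartzMap E2 ℂ) (Z W C : ℝ) (f : Sm) : Prop where
  nonneg : 0 ≤ C
  bdd : ∃ A, ∀ p, ‖f.1 p‖ ≤ A
  high : ∀ t, kernelBesov H 0 (fun x => f.1 (t, x)) ≤ ENNReal.ofReal (C * Z)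
  low : ∀ t, kernelBesov H (-(1 / 2)) (fun x => f.1 (t, x)) ≤ ENNReal.ofReal (C * W)

namespace BesovLe

variable {H : SchwartzMap E2 ℂ} {Z W C C' : ℝ} {f g : Sm}

protected lemma add (hZ : 0 ≤ Z) (hW : 0 ≤ W) (hf : BesovLe H Z W C f) (hg : BesovLe H Z W C' g) :
    BesovLe H Z W (C + C') (f + g) := by
  obtain ⟨A, hA⟩ := hf.bdd
  obtain ⟨B, hB⟩ := hg.bdd
  have key : ∀ s t, kernelBesov H s (fun x => (f + g).1 (t, x)) ≤
      kernelBesov H s (fun x => f.1 (t, x)) + kernelBesov H s (fun x => g.1 (t, x)) := fun s t =>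
    kernelBesov_add_le H s (contDiff_slice f t).continuous (contDiff_slice g t).continuous
      (fun x => hA (t, x)) fun x => hB (t, x)
  refine ⟨add_nonneg hf.nonneg hg.nonneg, ⟨A + B, fun p => ?_⟩, fun t => ?_, fun t => ?_⟩
  · rw [Sm.add_val]
    exact (norm_add_le _ _).trans (add_le_add (hA p) (hB p))
  · rw [add_mul, ENNReal.ofReal_add (mul_nonneg hf.nonneg hZ) (mul_nonneg hg.nonneg hZ)]
    exact (key 0 t).trans (add_le_add (hf.high t) (hg.high t))
  · rw [add_mul, ENNReal.ofReal_add (mul_nonneg hf.nonneg hW) (mul_nonneg hg.nonneg hW)]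
    exact (key _ t).trans (add_le_add (hf.low t) (hg.low t))

lemma mono (hZ : 0 ≤ Z) (hW : 0 ≤ W) (hf : BesovLe H Z W C f) (hC : C ≤ C') :
    BesovLe H Z W C' f :=
  ⟨hf.nonneg.trans hC, hf.bdd,
    fun t => (hf.high t).trans (ENNReal.ofReal_le_ofReal (mul_le_mul_of_nonneg_right hC hZ)),
    fun t => (hf.low t).trans (ENNReal.ofReal_le_ofReal (mul_le_mul_of_nonneg_right hC hW))⟩

lemma zero (hC : 0 ≤ C) : BesovLe H Z W C 0 := by
  have h : ∀ s, kernelBesov H s (fun _ => (0 : ℝ)) = 0 := by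
    intro s
    have := kernelBesov_const_mul H s (c := 0) le_rfl (fun _ => (0 : ℝ))
    simpa using this
  refine ⟨hC, ⟨0, by simp⟩, fun t => ?_, fun t => ?_⟩
  · simp [h]
  · simp [h]

lemma sum {ι : Type*} {s : Finset ι} {f : ι → Sm} (hZ : 0 ≤ Z) (hW : 0 ≤ W)
    (h : ∀ i ∈ s, BesovLe H Z W C (f i)) : BesovLe H Z W (s.card * C) (∑ i ∈ s, f i) := by
  classical
  induction s using Finset.induction_on with
  | empty => simpa using BesovLe.zero le_rfl
  | insert i s hi ih =>
    rw [Finset.sum_insert hi, Finset.card_insert_of_notMem hi]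
    push_cast
    rw [add_mul, one_mul, add_comm]
    have h1 := BesovLe.add hZ hW (h i (Finset.mem_insert_self i s))
      (ih fun j hj => h j (Finset.mem_insert_of_mem hj))
    exact h1.mono hZ hW (by linarith)

end BesovLe

/-- The constant `c` serves in the two bounds that are used for the individual terms: for general
functions, and for the product of a slowly varying amplitude and a fast plane wave `u'(ρ κ·x)`, whose
profile has mean zero. -/
structure BesovConst (H : SchwartzMap E2 ℂ) (c : ℝ) : Prop where
  pos : 0 < c
  smooth : ∀ (f : Sm) (A B Z W C : ℝ), (∀ p, ‖f.1 p‖ ≤ A) →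
    (∀ t x, ‖fderiv ℝ (fun y => f.1 (t, y)) x‖ ≤ B) → A ≤ B → 0 ≤ C → 0 ≤ Z →
      A * B ≤ (C * Z) ^ 2 → A ≤ C * W → BesovLe H Z W (c * C) f
  wave : ∀ (u : ℝ → ℝ) (hu : ContDiff ℝ ∞ u) (cu : ℝ), SB 2 cu 1 u → ∀ (κ : E2), ‖κ‖ = 1 →
    ∀ (h : Sm) (X μ ρ Z W C : ℝ), SB 2 X μ h.1 → 1 ≤ μ → μ ^ 2 ≤ ρ → cu * X ≤ C * Z → 0 ≤ C →
      cu * X ≤ C * W * Real.sqrt ρ →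
        BesovLe H Z W (c * C) (h * wave (deriv u) (contDiff_deriv hu) (ρ • κ))

/-- For the second bound, `h u'(ρ κ·x)` is written as the divergence of `ρ⁻¹ h u(ρ κ·x) κ` minus
`ρ⁻¹ u(ρ κ·x) ∂_κ h`; the field in the divergence is smaller than its divergence by a factor `ρ`,
which gives the gain of `ρ^{-1/2}` in the norm of negative order. -/
lemma exists_besovConst (H : SchwartzMap E2 ℂ) (hH1 : ∫ z, H z = 1) : ∃ c : ℝ, BesovConst H c := by
  obtain ⟨c, hc, h1, h2, h3⟩ := exists_kernelBesov_bound H hH1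
  refine ⟨6 * c, by positivity, ?_, ?_⟩
  · intro f A B Z W C hA hB hAB hC hZ hABZ hAW
    have hA0 : 0 ≤ A := (norm_nonneg _).trans (hA 0)
    refine ⟨by positivity, ⟨A, hA⟩, fun t => ?_, fun t => ?_⟩
    · refine (h2 _ A B (C * Z) ((contDiff_slice f t).differentiable (by simp))
        (fun x => hA (t, x)) (hB t) hAB (by positivity) hABZ).trans (ENNReal.ofReal_le_ofReal ?_)
      nlinarith [mul_nonneg hc.le (mul_nonneg hC hZ)]
    · refine (h1 _ A fun x => hA (t, x)).trans (ENNReal.ofReal_le_ofReal ?_)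
      nlinarith [mul_nonneg hc.le hA0]
  · intro u hu cu hcu κ hκ h X μ ρ Z W C hh hμ hρ hZ hC hW
    have hμ0 : 0 ≤ μ := by linarith
    have hρ1 : 1 ≤ ρ := (one_le_pow₀ hμ).trans hρ
    have hρ0 : 0 < ρ := by linarith
    have hμρ : μ ≤ ρ := (le_self_pow₀ hμ two_ne_zero).trans hρ
    have hcu0 := hcu.nonneg
    have hX0 := hh.nonneg
    have hy0 : 0 ≤ cu * X := mul_nonneg hcu0 hX0
    have hnξ : ‖ρ • κ‖ ≤ ρ := by rw [norm_smul, hκ, mul_one, Real.norm_of_nonneg hρ0.le]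
    set w := wave u hu (ρ • κ) with hw
    set w' := wave (deriv u) (contDiff_deriv hu) (ρ • κ) with hw'
    have hwb : SB 2 cu ρ w.1 := hcu.wave hu hnξ
    have hwb' : SB 1 cu ρ w'.1 := by
      have h4 := hcu.fderiv_apply (1 : ℝ) (by simp) zero_le_one
      rw [mul_one] at h4
      have h5 : SB 1 cu 1 (deriv u) := h4
      exact h5.wave _ hnξ
    have hdw : dK κ w = ρ • w' := by
      rw [hw, dK_wave, inner_smul_left, real_inner_self_eq_norm_sq, hκ]
      simp
      rfl
    -- `h u'(ρ κ·x)` is a divergence up to the term where the derivative falls on `h`.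
    set F : Fin 2 → Sm := fun i => (ρ⁻¹ * κ i) • (h * w) with hF
    set g : Sm := -(ρ⁻¹ • (w * dK κ h)) with hg
    have hdiv : dX 0 (F 0) + dX 1 (F 1) = h * w' - g := by
      have e : dX 0 (F 0) + dX 1 (F 1) = ρ⁻¹ • dK κ (h * w) := by
        rw [dK_eq κ (h * w), smul_add, smul_smul, smul_smul]
        exact congrArg₂ (· + ·) (Derivation.map_smul _ _ _) (Derivation.map_smul _ _ _)
      rw [e, Dv_mul, hdw, hg, smul_add, mul_smul_comm, smul_smul, inv_mul_cancel₀ hρ0.ne', one_smul]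
      ring
    have hgb : SB 1 (ρ⁻¹ * (cu * (X * μ))) (2 * ρ) g.1 := by
      have h4 := (((hwb.order one_le_two).mul (hh.Dv hμ0 (norm_dir_le hκ.le))).const_mul ρ⁻¹).neg
      rw [abs_of_pos (inv_pos.2 hρ0)] at h4
      exact SB.mono (f := g.1) h4 (by positivity) le_rfl (by linarith)
    have hfb : SB 1 (cu * X) (2 * ρ) (h * w').1 := by
      have h4 := (hh.order one_le_two).mul hwb'
      exact SB.mono (f := (h * w').1) h4 (by positivity) (by linarith) (by linarith)
    have hg1 : ρ⁻¹ * (cu * (X * μ)) ≤ cu * X := by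
      rw [inv_mul_le_iff₀ hρ0]
      nlinarith
    have hdb : SB 1 (2 * (cu * X)) (2 * ρ) (h * w' - g).1 :=
      SB.mono (f := (h * w' - g).1) (hfb.sub hgb) (by positivity) (by linarith) le_rfl
    have hFb : ∀ i, SB 1 (cu * X / ρ) (2 * ρ) (F i).1 := by
      intro i
      have h4 := ((hh.order one_le_two).mul (hwb.order one_le_two)).const_mul (ρ⁻¹ * κ i)
      refine SB.mono (f := (F i).1) h4 (by positivity) ?_ (by linarith)
      have h5 : |κ i| ≤ 1 := by
        have := PiLp.norm_apply_le κ i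
        rwa [hκ] at this
      rw [abs_mul, abs_of_pos (inv_pos.2 hρ0), div_eq_inv_mul, mul_assoc]
      refine mul_le_mul_of_nonneg_left ?_ (by positivity)
      nlinarith [abs_nonneg (κ i)]
    have hpd : ∀ t, (fun y => pd 0 (fun y => (F 0).1 (t, y)) y + pd 1 (fun y => (F 1).1 (t, y)) y) =
        fun y => (h * w' - g).1 (t, y) := by
      intro t
      funext y
      rw [pd_slice, pd_slice, ← hdiv]
      rfl
    have hs0 : 0 < Real.sqrt ρ := Real.sqrt_pos.2 hρ0
    have hsq : Real.sqrt ρ * Real.sqrt ρ = ρ := Real.mul_self_sqrt hρ0.le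
    have hμs : μ ≤ Real.sqrt ρ := Real.le_sqrt_of_sq_le hρ
    have hWs : cu * X / Real.sqrt ρ ≤ C * W := (div_le_iff₀ hs0).2 hW
    have hmain := fun t => h3 (fun i y => (F i).1 (t, y)) (4 * (cu * X)) ρ (cu * X / ρ * (2 * ρ))
      (fun i => (contDiff_slice (F i) t).of_le (by exact_mod_cast le_top)) hρ1
      (by rw [hpd t]; exact (contDiff_slice _ t).differentiable (by simp))
      (fun i x => ((hFb i).norm_le _).trans
        (div_le_div_of_nonneg_right (by linarith) hρ0.le))
      (fun i x => (hFb i).norm_fderiv_slice_le t x)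
      (fun x => by
        rw [congrFun (hpd t) x]
        exact (hdb.norm_le _).trans (by linarith))
      (fun x => by
        rw [hpd t]
        exact (hdb.norm_fderiv_slice_le t x).trans (by linarith))
    have hsplit : ∀ s t, kernelBesov H s (fun x => (h * w').1 (t, x)) ≤
        kernelBesov H s (fun x => (h * w' - g).1 (t, x)) +
          kernelBesov H s (fun x => g.1 (t, x)) := by
      intro s t
      refine le_trans (le_of_eq ?_) (kernelBesov_add_le H s (contDiff_slice (h * w' - g) t).continuous
        (contDiff_slice g t).continuous (fun x => hdb.norm_le _) fun x => hgb.norm_le _)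
      congr 1
      funext x
      rw [Sm.sub_val, sub_add_cancel]
    have hA0 : 0 ≤ ρ⁻¹ * (cu * (X * μ)) := by positivity
    refine ⟨by positivity, ⟨_, hfb.norm_le⟩, fun t => ?_, fun t => ?_⟩
    · have e1 := (hmain t).1
      rw [hpd t] at e1
      have e2 := h2 (fun x => g.1 (t, x)) _ _ (2 * (cu * X))
        ((contDiff_slice g t).differentiable (by simp)) (fun x => hgb.norm_le _)
        (hgb.norm_fderiv_slice_le t) (by nlinarith) (by positivity) (by
          have : ρ⁻¹ * (cu * (X * μ)) * (ρ⁻¹ * (cu * (X * μ)) * (2 * ρ)) =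
            2 * (cu * X) ^ 2 * (μ ^ 2 / ρ) := by field_simp
          rw [this]
          have h6 : μ ^ 2 / ρ ≤ 1 := (div_le_one hρ0).2 hρ
          nlinarith [sq_nonneg (cu * X)])
      refine (hsplit 0 t).trans ((add_le_add e1 e2).trans ?_)
      rw [← ENNReal.ofReal_add (by positivity) (by positivity)]
      refine ENNReal.ofReal_le_ofReal ?_
      nlinarith
    · have e1 := (hmain t).2
      rw [hpd t] at e1
      have e2 := h1 (fun x => g.1 (t, x)) _ fun x => hgb.norm_le _
      refine (hsplit _ t).trans ((add_le_add e1 e2).trans ?_)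
      rw [← ENNReal.ofReal_add (by positivity) (by positivity)]
      refine ENNReal.ofReal_le_ofReal ?_
      have h6 : ρ⁻¹ * (cu * (X * μ)) ≤ cu * X / Real.sqrt ρ := by
        rw [inv_mul_le_iff₀ hρ0, mul_div_assoc', le_div_iff₀ hs0]
        calc cu * (X * μ) * Real.sqrt ρ = cu * X * (μ * Real.sqrt ρ) := by ring
          _ ≤ cu * X * (Real.sqrt ρ * Real.sqrt ρ) := by gcongr
          _ = ρ * (cu * X) := by rw [hsq]; ring
      have h7 : 4 * (cu * X) / Real.sqrt ρ = 4 * (cu * X / Real.sqrt ρ) := mul_div_assoc _ _ _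
      rw [h7]
      have h8 : 0 ≤ cu * X / Real.sqrt ρ := by positivity
      nlinarith

end

section

open MeasureTheory

/-! ### The error terms -/

lemma abs_eq_one_of_sq {s : ℝ} (h : s ^ 2 = 1) : |s| = 1 :=
  (pow_eq_one_iff_of_nonneg (abs_nonneg _) two_ne_zero).1 (by rw [sq_abs, h])

protected lemma SB.smul {N : ℕ} {C D : ℝ} {f : Sm} (h : SB N C D f.1) (s : ℝ) :
    SB N (|s| * C) D (s • f).1 := h.const_mul s

protected lemma SB.smul_of_abs_le {N : ℕ} {C D : ℝ} {f : Sm} (h : SB N C D f.1) (hD : 0 ≤ D) {s : ℝ}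
    (hs : |s| ≤ 1) : SB N C D (s • f).1 :=
  (h.smul s).mono_left hD (mul_le_of_le_one_left h.nonneg hs)

protected lemma SB.sq {N : ℕ} {C D : ℝ} {f : Sm} (h : SB N C D f.1) :
    SB N (C * C) (2 * D) (f ^ 2).1 := by
  have h1 := h.mul h
  rw [← two_mul] at h1
  have e : (f ^ 2).1 = fun p => f.1 p * f.1 p := by
    funext p
    rw [Sm.pow_val, pow_two]
  rw [e]
  exact h1

lemma SB.sum_sm {N : ℕ} {C D : ℝ} {s : Finset E2} {f : E2 → Sm} (hD : 0 ≤ D)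
    (h : ∀ k ∈ s, SB N C D (f k).1) : SB N (s.card * C) D (∑ k ∈ s, f k).1 := by
  have e : (∑ k ∈ s, f k).1 = fun p => ∑ k ∈ s, (f k).1 p := funext fun p => Sm.sum_val s f p
  rw [e]
  exact SB.sum_const hD h

lemma BesovConst.of_SB {H : SchwartzMap E2 ℂ} {c : ℝ} (hB : BesovConst H c) {f : Sm}
    {A D Z W C : ℝ} (hf : SB 1 A D f.1) (hD : 1 ≤ D) (hC : 0 ≤ C) (hZ : 0 ≤ Z)
    (hAZ : A * (A * D) ≤ (C * Z) ^ 2) (hAW : A ≤ C * W) : BesovLe H Z W (c * C) f :=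
  hB.smooth f A (A * D) Z W C hf.norm_le hf.norm_fderiv_slice_le
    (le_mul_of_one_le_right hf.nonneg hD) hC hZ hAZ hAW

/-- Sums of waves of frequency `λ` with amplitudes of size `C` and frequency `D`. -/
def IsTrigSum (Λ : Finset E2) (lam : ℝ) (N : ℕ) (C D : ℝ) (f : Sm) : Prop :=
  ∃ p q : E2 → Sm, (∀ k ∈ Λ, SB N C D (p k).1) ∧ (∀ k ∈ Λ, SB N C D (q k).1) ∧
    f = ∑ k ∈ Λ, (p k * cosW (lam • k) + q k * sinW (lam • k))

section TrigSum

variable {Λ : Finset E2} {lam : ℝ} {N : ℕ} {C D : ℝ} {f : Sm}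

lemma SB.zero_sm (N : ℕ) (hC : 0 ≤ C) (hD : 0 ≤ D) : SB N C D (0 : Sm).1 := by
  have h := SB.const (E := ST) N hD (0 : ℝ)
  rw [norm_zero] at h
  exact SB.mono_left (f := (0 : Sm).1) h hD hC

lemma IsTrigSum.of_cos {σ : E2 → ℝ} (hσ : ∀ k ∈ Λ, σ k ^ 2 = 1) {p : E2 → Sm} (hC : 0 ≤ C)
    (hD : 0 ≤ D) (hp : ∀ k ∈ Λ, SB N C D (p k).1) :
    IsTrigSum Λ lam N C D (∑ k ∈ Λ, σ k • (p k * cosW (lam • k))) := by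
  refine ⟨fun k => σ k • p k, fun _ => 0, fun k hk =>
    (hp k hk).smul_of_abs_le hD (abs_eq_one_of_sq (hσ k hk)).le, fun _ _ => SB.zero_sm N hC hD,
    Finset.sum_congr rfl fun k _ => ?_⟩
  rw [zero_mul, add_zero, smul_mul_assoc]

lemma IsTrigSum.of_sin {σ : E2 → ℝ} (hσ : ∀ k ∈ Λ, σ k ^ 2 = 1) {p : E2 → Sm} (hC : 0 ≤ C)
    (hD : 0 ≤ D) (hp : ∀ k ∈ Λ, SB N C D (p k).1) :
    IsTrigSum Λ lam N C D (∑ k ∈ Λ, σ k • (p k * sinW (lam • k))) := by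
  refine ⟨fun _ => 0, fun k => σ k • p k, fun _ _ => SB.zero_sm N hC hD, fun k hk =>
    (hp k hk).smul_of_abs_le hD (abs_eq_one_of_sq (hσ k hk)).le,
    Finset.sum_congr rfl fun k _ => ?_⟩
  rw [zero_mul, zero_add, smul_mul_assoc]

lemma IsTrigSum.bound (h : IsTrigSum Λ lam N C D f) (hΛ : ∀ k ∈ Λ, ‖k‖ = 1) (hD : 0 ≤ D)
    (hDl : D ≤ lam) : SB N (2 * (Λ.card * C)) (2 * lam) f.1 := by
  obtain ⟨p, q, hp, hq, rfl⟩ := h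
  have hl : 0 ≤ lam := hD.trans hDl
  have hn : ∀ k ∈ Λ, ‖lam • k‖ ≤ lam := fun k hk => by
    rw [norm_smul, hΛ k hk, mul_one, Real.norm_of_nonneg hl]
  have h1 : ∀ k ∈ Λ, SB N (2 * C) (2 * lam)
      (p k * cosW (lam • k) + q k * sinW (lam • k)).1 := by
    intro k hk
    have h2 := (((hp k hk).mul (SB.cosW N (hn k hk))).add ((hq k hk).mul (SB.sinW N (hn k hk))))
    exact SB.mono (f := (p k * cosW (lam • k) + q k * sinW (lam • k)).1) h2 (by positivity)
      (by linarith) (by linarith)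
  exact (SB.sum_sm (by positivity) h1).mono_left (by positivity) (by linarith)

/-- On waves of frequency `λ` the operator `Δ + λ²` costs only one factor `λ` and one derivative of
the amplitudes. -/
lemma IsTrigSum.helm (h : IsTrigSum Λ lam (N + 2) C D f) (hΛ : ∀ k ∈ Λ, ‖k‖ = 1) (hD : 0 ≤ D)
    (hDl : D ≤ lam) (hC : 0 ≤ C) : IsTrigSum Λ lam N (4 * C * D * lam) D (helm lam f) := by
  obtain ⟨p, q, hp, hq, rfl⟩ := h
  have hl : 0 ≤ lam := hD.trans hDl
  have hCD : C * (D * D) ≤ C * (D * lam) := by gcongr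
  have hb : ∀ u v : E2 → Sm, (∀ k ∈ Λ, SB (N + 2) C D (u k).1) →
      (∀ k ∈ Λ, SB (N + 2) C D (v k).1) → ∀ k ∈ Λ, ∀ s : ℝ, |s| ≤ 2 * lam →
        SB N (4 * C * D * lam) D (Lap (u k) + s • dK k (v k)).1 := by
    intro u v hu hv k hk s hs
    have h1 := ((hu k hk).Lap hD).add
      ((((hv k hk).order (Nat.le_succ _)).Dv hD (norm_dir_le (hΛ k hk).le)).smul s)
    refine SB.mono_left (f := (Lap (u k) + s • dK k (v k)).1) h1 hD ?_
    have h2 : |s| * (C * D) ≤ 2 * lam * (C * D) := by gcongr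
    nlinarith
  refine ⟨fun k => Lap (p k) + (2 * lam) • dK k (q k), fun k => Lap (q k) + (-(2 * lam)) • dK k (p k),
    fun k hk => hb p q hp hq k hk _ (by rw [abs_of_nonneg (by positivity)]),
    fun k hk => hb q p hq hp k hk _ (by rw [abs_neg, abs_of_nonneg (by positivity)]), ?_⟩
  rw [helm_sum]
  refine Finset.sum_congr rfl fun k hk => ?_
  rw [helm_add, helm_mul_cos (hΛ k hk), helm_mul_sin (hΛ k hk), add_mul, add_mul, smul_mul_assoc,
    smul_mul_assoc, neg_smul]
  ring

end TrigSum

/-- In the lower order terms at least two derivatives fall on the amplitudes, one more than in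
`oscPart`; hence their size is `D² / λ` in place of `D`. -/
lemma SB.lowerPart {Λ : Finset E2} {lam C D : ℝ} {σ : E2 → ℝ} {g : E2 → Sm}
    (hΛ : ∀ k ∈ Λ, ‖k‖ = 1) (hσ : ∀ k ∈ Λ, σ k ^ 2 = 1) (hg : ∀ k ∈ Λ, SB 5 C D (g k).1)
    (hC : 0 ≤ C) (hD : 0 ≤ D) (hDl : D ≤ lam) (hl : 0 < lam) (i : Fin 2) :
    SB 1 (800 * (Λ.card * C) ^ 2 * (D ^ 2 / lam)) (4 * lam) (lowerPart Λ lam σ g i).1 := by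
  set y : ℝ := Λ.card * C with hy
  have hy0 : 0 ≤ y := by positivity
  have tU : IsTrigSum Λ lam 5 C D (streamSum Λ lam σ g) := IsTrigSum.of_cos hσ hC hD hg
  have tR1 := tU.helm hΛ hD hDl hC
  have tR2 := tR1.helm hΛ hD hDl (by positivity)
  have bP := ((IsTrigSum.of_cos (lam := lam) hσ (by positivity) hD fun k hk =>
    (hg k hk).Lap hD).bound hΛ hD hDl).order (M := 1) (by norm_num)
  have bQ := ((IsTrigSum.of_sin (lam := lam) hσ (by positivity) hD fun k hk =>
    (hg k hk).Dv hD (norm_dir_le (hΛ k hk).le)).bound hΛ hD hDl).order (M := 1) (by norm_num)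
  have bE := ((IsTrigSum.of_cos (lam := lam) hσ (by positivity) hD fun k hk =>
    (hg k hk).dX hD i).bound hΛ hD hDl).order (M := 1) (by norm_num)
  have bU := ((tU.bound hΛ hD hDl).dX (by positivity) i).order (M := 1) (by norm_num)
  have bR1 := (tR1.bound hΛ hD hDl).order (M := 1) (by norm_num)
  have bR1' := ((tR1.bound hΛ hD hDl).dX (by positivity) i).order (M := 1) (by norm_num)
  have bR2 := tR2.bound hΛ hD hDl
  have ha := ((bP.neg.mul bU).const_mul (lam⁻¹ ^ 2))
  have hb := ((bQ.mul bE).const_mul (2 * lam⁻¹))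
  have hc := ((bR2.mul bU).const_mul (lam⁻¹ ^ 4))
  have hd := ((bR1.mul bR1').const_mul (lam⁻¹ ^ 4))
  have he := ((bR2.mul bR1').const_mul (lam⁻¹ ^ 6))
  have h := (((ha.add hb).add hc).add hd).sub he
  refine SB.mono (f := (HeatFlow.lowerPart Λ lam σ g i).1) h (by positivity) ?_ (by linarith)
  rw [abs_of_nonneg (by positivity), abs_of_nonneg (by positivity), abs_of_nonneg (by positivity),
    abs_of_nonneg (by positivity)]
  have hDD : D ^ 3 / lam ^ 2 ≤ D ^ 2 / lam := by
    rw [div_le_div_iff₀ (by positivity) hl]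
    nlinarith [mul_nonneg (mul_nonneg (sq_nonneg D) hl.le) (sub_nonneg.2 hDl)]
  have e : lam⁻¹ ^ 2 * (2 * (Λ.card * (2 * (C * D ^ 2))) * (2 * (Λ.card * C) * (2 * lam))) +
      2 * lam⁻¹ * (2 * (Λ.card * (C * D)) * (2 * (Λ.card * (C * D)))) +
      lam⁻¹ ^ 4 * (2 * (Λ.card * (4 * (4 * C * D * lam) * D * lam)) *
        (2 * (Λ.card * C) * (2 * lam))) +
      lam⁻¹ ^ 4 * (2 * (Λ.card * (4 * C * D * lam)) * (2 * (Λ.card * (4 * C * D * lam)) * (2 * lam))) +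
      lam⁻¹ ^ 6 * (2 * (Λ.card * (4 * (4 * C * D * lam) * D * lam)) *
        (2 * (Λ.card * (4 * C * D * lam)) * (2 * lam))) =
      280 * y ^ 2 * (D ^ 2 / lam) + 512 * y ^ 2 * (D ^ 3 / lam ^ 2) := by
    rw [hy]
    field_simp
    ring
  refine (le_of_eq e).trans ?_
  have h1 : 512 * y ^ 2 * (D ^ 3 / lam ^ 2) ≤ 512 * y ^ 2 * (D ^ 2 / lam) := by gcongr
  have h2 : 0 ≤ y ^ 2 * (D ^ 2 / lam) := by positivity
  linarith

lemma cosW_eq_wave (ξ : E2) : cosW ξ = wave (deriv Real.sin) (contDiff_deriv Real.contDiff_sin) ξ := by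
  ext p
  simp [cosW, wave, Real.deriv_sin]

/-- Products of waves of different directions oscillate with a frequency comparable to `λ`. -/
lemma BesovConst.oscPart {H : SchwartzMap E2 ℂ} {c : ℝ} (hB : BesovConst H c) {Λ : Finset E2}
    {lam m C D Z W x : ℝ} {σ : E2 → ℝ} {g : E2 → Sm} (hΛ : ∀ k ∈ Λ, ‖k‖ = 1)
    (hΛn : ∀ k ∈ Λ, -k ∈ Λ) (hσ : ∀ k ∈ Λ, σ k ^ 2 = 1) (hg : ∀ k ∈ Λ, SB 5 C D (g k).1)
    (hm : ∀ k ∈ Λ, ∀ l ∈ Λ, k ≠ l → m ≤ ‖k - l‖) (hm0 : 0 < m) (hl : 0 < lam) (hD : 1 ≤ D)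
    (hDl : (2 * D) ^ 2 ≤ lam * m) (hZ : 0 ≤ Z) (hW : 0 ≤ W) (hx : 0 ≤ x)
    (hxZ : C ^ 2 * D ≤ x * Z) (hxW : C ^ 2 * D ≤ x * W * Real.sqrt (lam * m)) (i : Fin 2) :
    BesovLe H Z W (Λ.card * (Λ.card * (c * x + c * x))) (HeatFlow.oscPart Λ lam σ g i) := by
  classical
  have hone : ∀ k ∈ Λ, ∀ i, |k i| ≤ 1 := fun k hk i => by
    have := PiLp.norm_apply_le k i
    rwa [hΛ k hk] at this
  have key : ∀ h : Sm, SB 4 (C * D * C) (D + D) h.1 → ∀ k ∈ Λ, ∀ l ∈ Λ, k ≠ l →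
      BesovLe H Z W (c * x) (h * cosW (lam • (k - l))) := by
    intro h hh k hk l hl' hkl
    have hmk := hm k hk l hl' hkl
    have hn0 : 0 < ‖k - l‖ := hm0.trans_le hmk
    have e : lam • (k - l) = (lam * ‖k - l‖) • (‖k - l‖⁻¹ • (k - l)) := by
      rw [smul_smul, mul_assoc, mul_inv_cancel₀ hn0.ne', mul_one]
    rw [cosW_eq_wave, e]
    have hρ : lam * m ≤ lam * ‖k - l‖ := by gcongr
    refine hB.wave Real.sin Real.contDiff_sin 1 (SB.sin 2) _ ?_ h (C * D * C) (D + D) _ Z W x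
      (hh.order (by norm_num)) (by linarith) ?_ (by linarith) hx ?_
    · rw [norm_smul, norm_inv, norm_norm, inv_mul_cancel₀ hn0.ne']
    · rw [← two_mul]
      exact hDl.trans hρ
    · have h1 : x * W * Real.sqrt (lam * m) ≤ x * W * Real.sqrt (lam * ‖k - l‖) :=
        mul_le_mul_of_nonneg_left (Real.sqrt_le_sqrt hρ) (by positivity)
      linarith
  have hcx : 0 ≤ c * x := mul_nonneg hB.pos.le hx
  have hterm : ∀ k ∈ Λ, ∀ l ∈ Λ, BesovLe H Z W (c * x + c * x)
      ((-(σ k * σ l * l i)) • (dK k (g k) * g l * ((if k = l then 0 else cosW (lam • (k - l))) -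
        (if k = -l then 0 else cosW (lam • (k + l)))))) := by
    intro k hk l hl'
    have hs : |-(σ k * σ l * l i)| ≤ 1 := by
      rw [abs_neg, abs_mul, abs_mul, abs_eq_one_of_sq (hσ k hk), abs_eq_one_of_sq (hσ l hl')]
      simpa using hone l hl' i
    have hh : SB 4 (C * D * C) (D + D) ((-(σ k * σ l * l i)) • (dK k (g k) * g l)).1 := by
      have h1 := ((hg k hk).Dv (by linarith) (norm_dir_le (hΛ k hk).le)).mul
        ((hg l hl').order (M := 4) (by norm_num))
      exact SB.smul_of_abs_le (f := dK k (g k) * g l) h1 (by linarith) hs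
    set h := (-(σ k * σ l * l i)) • (dK k (g k) * g l) with hdef
    rw [← smul_mul_assoc, ← hdef, mul_sub, sub_eq_add_neg, ← neg_mul]
    refine BesovLe.add hZ hW ?_ ?_
    · split_ifs with h1
      · rw [mul_zero]
        exact BesovLe.zero hcx
      · exact key h hh k hk l hl' h1
    · split_ifs with h1
      · rw [mul_zero]
        exact BesovLe.zero hcx
      · rw [← sub_neg_eq_add k l]
        exact key (-h) hh.neg k hk (-l) (hΛn l hl') h1
  have h1 := BesovLe.sum hZ hW fun k hk => BesovLe.sum hZ hW fun l hl' => hterm k hk l hl'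
  have e : HeatFlow.oscPart Λ lam σ g i = ∑ k ∈ Λ, ∑ l ∈ Λ, (-(σ k * σ l * l i)) • (dK k (g k) * g l *
      ((if k = l then 0 else cosW (lam • (k - l))) -
        (if k = -l then 0 else cosW (lam • (k + l))))) := by
    rw [HeatFlow.oscPart]
    simp only [neg_smul, Finset.sum_neg_distrib]
  rw [e]
  exact h1

end

section

open MeasureTheory

section Step

variable {G : GeometricData} {φ : Profile} {M : Mollifiers} {C₀ : ℝ} {a b : ℕ} {χ : ℕ → E2 → ℝ}
  {c : ℝ} {n : ℕ} {V : Fin 2 → Sm} {A As : E2 → Sm} {X : Sm}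

lemma abs_bar_le (G : GeometricData) {k : E2} (hk : k ∈ G.Λ) (i : Fin 2) : |G.bar k i| ≤ 1 := by
  have := PiLp.norm_apply_le (G.bar k) i
  rwa [G.norm_bar k hk] at this

/-- The fluctuation `φ_k² - 1` is the derivative of a periodic function of `λ^{1/4} k·x`. -/
lemma blockWave_sq_sub_one {Φ : ℝ → ℝ} (hΦ : ContDiff ℝ ∞ Φ)
    (hd : ∀ s, deriv Φ s = φ.toFun s ^ 2 - 1) (k : E2) :
    blockWave G φ a b n k ^ 2 - 1 =
      wave (deriv Φ) (contDiff_deriv hΦ) (lam G a b (n + 1) ^ (1 / 4 : ℝ) • k) := by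
  ext p
  simp [blockWave, wave, hd]

/-- The fluctuation of the profile oscillates at the frequency `λ^{1/4}`, which is far above the
frequencies of the slow amplitudes. -/
lemma BesovConst.profileTerm {H : SchwartzMap E2 ℂ} {cB : ℝ} (hB : BesovConst H cB)
    {Φ : ℝ → ℝ} (hΦ : ContDiff ℝ ∞ Φ) (hd : ∀ s, deriv Φ s = φ.toFun s ^ 2 - 1) {cΦ : ℝ}
    (hΦb : SB 2 cΦ 1 Φ) {k : E2} (hk : k ∈ G.Λ) (i : Fin 2) {f : Sm} {B D Z W x : ℝ}
    (hf : SB 5 B D f.1) (hD : 1 ≤ D) (hDr : (2 * D) ^ 2 ≤ lam G a b (n + 1) ^ (1 / 4 : ℝ))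
    (hx : 0 ≤ x) (hZ : cΦ * (2 * (B ^ 2 * D)) ≤ x * Z)
    (hW : cΦ * (2 * (B ^ 2 * D)) ≤ x * W * Real.sqrt (lam G a b (n + 1) ^ (1 / 4 : ℝ))) :
    BesovLe H Z W (cB * x)
      (G.bar k i • (dK (G.bar k) (f ^ 2) * (blockWave G φ a b n k ^ 2 - 1))) := by
  rw [blockWave_sq_sub_one hΦ hd, ← smul_mul_assoc]
  refine hB.wave Φ hΦ cΦ hΦb k (G.norm_eq_one k hk) _ (2 * (B ^ 2 * D)) (2 * D) _ Z W x ?_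
    (by linarith) hDr hZ hx hW
  have h1 := (hf.sq.Dv (by linarith) (norm_dir_le (G.norm_bar k hk).le)).order (M := 2)
    (by norm_num)
  exact (h1.smul_of_abs_le (by linarith) (abs_bar_le G hk i)).mono_left (by linarith)
    (by linarith)

/-- The product rule for the derivative of `X² (d² + 2 A d)`, where `d` is a mollification error,
primes denote derivatives, and `ι = μ⁻¹`: the worst term is `A d'`, of size `μ ι³³`. -/
lemma abs_dK_mollification_le {μ ι c A A' d d' X X' : ℝ} (hμι : μ * ι = 1) (hι : 0 ≤ ι) (hι1 : ι ≤ 1)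
    (hA : |A| ≤ μ) (hA' : |A'| ≤ μ * μ ^ 8) (hd : |d| ≤ ι ^ 41) (hd' : |d'| ≤ ι ^ 33)
    (hX : |X| ≤ c) (hX' : |X'| ≤ c * μ) :
    |X ^ 2 * (2 * d * d' + 2 * (A * d' + d * A')) + (d ^ 2 + 2 * (A * d)) * (2 * X * X')| ≤
      12 * c ^ 2 * ι ^ 32 := by
  have hμ : 0 ≤ μ := (abs_nonneg _).trans hA
  have hc : 0 ≤ c := (abs_nonneg _).trans hX
  have hp : ∀ m l : ℕ, l ≤ m → ι ^ m ≤ ι ^ l := fun m l h => pow_le_pow_of_le_one hι hι1 h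
  have h1 : |d * d'| ≤ ι ^ 32 := by
    rw [abs_mul]
    calc |d| * |d'| ≤ ι ^ 41 * ι ^ 33 := by gcongr
      _ = ι ^ 74 := by ring
      _ ≤ ι ^ 32 := hp _ _ (by norm_num)
  have h2 : |A * d'| ≤ ι ^ 32 := by
    rw [abs_mul]
    calc |A| * |d'| ≤ μ * ι ^ 33 := by gcongr
      _ = (μ * ι) * ι ^ 32 := by ring
      _ = ι ^ 32 := by rw [hμι, one_mul]
  have h3 : |d * A'| ≤ ι ^ 32 := by
    rw [abs_mul]
    calc |d| * |A'| ≤ ι ^ 41 * (μ * μ ^ 8) := by gcongr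
      _ = (μ * ι) ^ 9 * ι ^ 32 := by ring
      _ = ι ^ 32 := by rw [hμι, one_pow, one_mul]
  have h4 : |d ^ 2| ≤ ι ^ 40 := by
    rw [abs_pow]
    calc |d| ^ 2 ≤ (ι ^ 41) ^ 2 := by gcongr
      _ = ι ^ 82 := by ring
      _ ≤ ι ^ 40 := hp _ _ (by norm_num)
  have h5 : |A * d| ≤ ι ^ 40 := by
    rw [abs_mul]
    calc |A| * |d| ≤ μ * ι ^ 41 := by gcongr
      _ = (μ * ι) * ι ^ 40 := by ring
      _ = ι ^ 40 := by rw [hμι, one_mul]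
  have h6 : |2 * d * d' + 2 * (A * d' + d * A')| ≤ 6 * ι ^ 32 := by
    rw [abs_le] at h1 h2 h3 ⊢
    constructor <;> nlinarith
  have h7 : |d ^ 2 + 2 * (A * d)| ≤ 3 * ι ^ 40 := by
    rw [abs_le] at h4 h5 ⊢
    constructor <;> nlinarith
  have h8 : |X ^ 2 * (2 * d * d' + 2 * (A * d' + d * A'))| ≤ 6 * c ^ 2 * ι ^ 32 := by
    rw [abs_mul, abs_pow]
    calc |X| ^ 2 * |2 * d * d' + 2 * (A * d' + d * A')| ≤ c ^ 2 * (6 * ι ^ 32) := by gcongr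
      _ = _ := by ring
  have h9 : |(d ^ 2 + 2 * (A * d)) * (2 * X * X')| ≤ 6 * c ^ 2 * ι ^ 32 := by
    rw [abs_mul, abs_mul, abs_mul, abs_two]
    calc |d ^ 2 + 2 * (A * d)| * (2 * |X| * |X'|) ≤ 3 * ι ^ 40 * (2 * c * (c * μ)) := by gcongr
      _ = 6 * c ^ 2 * ((μ * ι) * ι ^ 39) := by ring
      _ = 6 * c ^ 2 * ι ^ 39 := by rw [hμι, one_mul]
      _ ≤ 6 * c ^ 2 * ι ^ 32 :=
          mul_le_mul_of_nonneg_left (hp 39 32 (by norm_num)) (by positivity)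
  exact (abs_add_le _ _).trans (by linarith)

/-- The error made by mollifying the coefficients is small, by the choice of the length `ℓ_n`, and it
lives at frequencies far below `λ_{n+1}`. -/
lemma Step.mollificationTerm (hS : Step G φ M C₀ a b χ c n V A As X) {H : SchwartzMap E2 ℂ} {cB : ℝ}
    (hB : BesovConst H cB) (hc : 1 ≤ c) (hC₀ : 1 ≤ C₀) (hμ4 : 4 ≤ lam G a b n)
    (hμc : c ≤ lam G a b n) {r : ℝ} (hμr : lam G a b n ^ 36 ≤ r) {k : E2} (hk : k ∈ G.Λ) (i : Fin 2) :
    BesovLe H (C₀ * r) (C₀ * (lam G a b n ^ 15)⁻¹) (cB * (24000 * c ^ 2))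
      (G.bar k i • dK (G.bar k) ((2 * (1000 * C₀)) • (X ^ 2 * (As k ^ 2 - A k ^ 2)))) := by
  set μ := lam G a b n with hμ
  have hμ0 : 0 < μ := by linarith
  have hμ1 : 1 ≤ μ := by linarith
  have hr0 : 0 ≤ r := (by positivity : 0 ≤ μ ^ 36).trans hμr
  have hbi := abs_bar_le G hk i
  have hv := norm_dir_le (G.norm_bar k hk).le
  have hinv : ∀ m : ℕ, (μ ^ m)⁻¹ = μ⁻¹ ^ m := fun m => (inv_pow μ m).symm
  have hXb := hS.X_bound
  have hAb := hS.A_bound k hk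
  have hAsb := hS.As_bound k hk
  have hsmall := hS.As_sub k hk
  have hdsmall := hS.dAs_sub k hk _ hv
  rw [← hμ] at hXb hAb hAsb hsmall
  simp only [← hμ, hinv] at hsmall hdsmall
  set f := dK (G.bar k) ((2 * (1000 * C₀)) • (X ^ 2 * (As k ^ 2 - A k ^ 2))) with hf
  have hfval : ∀ p, |f.1 p| ≤ 24000 * c ^ 2 * C₀ * μ⁻¹ ^ 32 := by
    intro p
    set d := As k - A k with hd
    have e1 : As k ^ 2 - A k ^ 2 = d ^ 2 + (2 : ℝ) • (A k * d) := by
      have : (2 : ℝ) • (A k * d) = A k * d + A k * d := two_smul ℝ _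
      rw [this, hd]
      ring
    have e2 : f.1 p = 2 * (1000 * C₀) * (X.1 p ^ 2 * (2 * d.1 p * (dK (G.bar k) d).1 p +
        2 * ((A k).1 p * (dK (G.bar k) d).1 p + d.1 p * (dK (G.bar k) (A k)).1 p)) +
        (d.1 p ^ 2 + 2 * ((A k).1 p * d.1 p)) * (2 * X.1 p * (dK (G.bar k) X).1 p)) := by
      have h2 : ∀ q, (2 : Sm).1 q = 2 := fun q => by
        rw [← one_add_one_eq_two, Sm.add_val, Sm.one_val]
        norm_num
      rw [hf, e1]
      simp only [Derivation.map_smul, Dv_mul, Dv_sq, map_add, Sm.smul_val, Sm.add_val, Sm.mul_val,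
        Sm.pow_val, h2]
    rw [e2, abs_mul, abs_of_nonneg (by positivity)]
    have h3 := abs_dK_mollification_le (mul_inv_cancel₀ hμ0.ne') (by positivity)
      (inv_le_one_of_one_le₀ hμ1) (hAb.norm_le p)
      ((hAb.Dv (by positivity) hv).norm_le p) (hsmall p) (hdsmall p) (hXb.norm_le p)
      ((hXb.Dv (by positivity) hv).norm_le p)
    calc _ ≤ 2 * (1000 * C₀) * (12 * c ^ 2 * μ⁻¹ ^ 32) := by gcongr
      _ = _ := by ring
  have hfb : SB 1 (24000 * c ^ 2 * C₀ * μ ^ 53) (μ ^ 51) f.1 := by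
    have h50 : μ ≤ μ ^ 50 := le_self_pow₀ hμ1 (by norm_num)
    have h8 : μ ^ 8 ≤ μ ^ 50 := pow_le_pow_right₀ hμ1 (by norm_num)
    have h1 := ((hXb.sq).order (M := 2) (by norm_num)).mul
      (((hAsb.sq).order (M := 2) (by norm_num)).sub
        (hAb.sq.mono (by positivity) le_rfl (D' := 2 * μ ^ 50) (by linarith)))
    have h2 := h1.const_mul (2 * (1000 * C₀))
    have h51 : 2 * μ + 2 * μ ^ 50 ≤ μ ^ 51 := by
      calc 2 * μ + 2 * μ ^ 50 ≤ 4 * μ ^ 50 := by linarith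
        _ ≤ μ * μ ^ 50 := by gcongr
        _ = μ ^ 51 := by ring
    have h3 : SB 2 (4000 * c ^ 2 * C₀ * μ ^ 2) (μ ^ 51)
        ((2 * (1000 * C₀)) • (X ^ 2 * (As k ^ 2 - A k ^ 2))).1 := by
      refine SB.mono (f := ((2 * (1000 * C₀)) • (X ^ 2 * (As k ^ 2 - A k ^ 2))).1) h2
        (by positivity) ?_ h51
      rw [abs_of_nonneg (by positivity)]
      have h5 : c * c + μ * μ ≤ 2 * μ ^ 2 := by nlinarith
      calc 2 * (1000 * C₀) * (c * c * (c * c + μ * μ)) ≤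
            2 * (1000 * C₀) * (c * c * (2 * μ ^ 2)) := by gcongr
        _ = _ := by ring
    refine (h3.Dv (by positivity) hv).mono_left (by positivity) ?_
    have : 0 ≤ c ^ 2 * C₀ * μ ^ 53 := by positivity
    calc 4000 * c ^ 2 * C₀ * μ ^ 2 * μ ^ 51 = 4000 * (c ^ 2 * C₀ * μ ^ 53) := by ring
      _ ≤ _ := by linarith
  have hle : ∀ m : ℕ, μ⁻¹ ^ m ≤ 1 := fun m =>
    pow_le_one₀ (by positivity) (inv_le_one_of_one_le₀ hμ1)
  refine hB.smooth _ (24000 * c ^ 2 * C₀ * μ⁻¹ ^ 32) (24000 * c ^ 2 * C₀ * μ ^ 53 * μ ^ 51) _ _ _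
    (fun p => ?_) ((hfb.smul_of_abs_le (by positivity) hbi).norm_fderiv_slice_le) ?_ (by positivity)
    (by positivity) ?_ ?_
  · rw [Sm.smul_val, Real.norm_eq_abs, abs_mul]
    exact (mul_le_of_le_one_left (abs_nonneg _) hbi).trans (hfval p)
  · calc 24000 * c ^ 2 * C₀ * μ⁻¹ ^ 32 ≤ 24000 * c ^ 2 * C₀ * 1 := by gcongr; exact hle 32
      _ ≤ 24000 * c ^ 2 * C₀ * (μ ^ 53 * μ ^ 51) := by
          gcongr
          exact one_le_mul_of_one_le_of_one_le (one_le_pow₀ hμ1) (one_le_pow₀ hμ1)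
      _ = _ := by ring
  · calc 24000 * c ^ 2 * C₀ * μ⁻¹ ^ 32 * (24000 * c ^ 2 * C₀ * μ ^ 53 * μ ^ 51) =
          (24000 * c ^ 2 * C₀) ^ 2 * ((μ⁻¹ * μ) ^ 32 * (μ ^ 36) ^ 2) := by ring
      _ = (24000 * c ^ 2 * C₀) ^ 2 * (μ ^ 36) ^ 2 := by
          rw [inv_mul_cancel₀ hμ0.ne', one_pow, one_mul]
      _ ≤ (24000 * c ^ 2 * C₀) ^ 2 * r ^ 2 := by gcongr
      _ = _ := by ring
  · rw [hinv, mul_assoc]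
    have : μ⁻¹ ^ 32 ≤ μ⁻¹ ^ 15 :=
      pow_le_pow_of_le_one (by positivity) (inv_le_one_of_one_le₀ hμ1) (by norm_num)
    gcongr

/-- The time derivative of the previous flow is bounded by a power of `λ_n`, which the factor
`λ_{n+1}⁻²` makes negligible. -/
lemma Step.timeTerm (hS : Step G φ M C₀ a b χ c n V A As X) {H : SchwartzMap E2 ℂ} {cB : ℝ}
    (hB : BesovConst H cB) (hC₀ : 1 ≤ C₀) (hμ1 : 1 ≤ lam G a b n) {r lam' : ℝ}
    (hμr : lam G a b n ^ 15 ≤ r) (hrl : r ≤ lam') (i : Fin 2) :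
    BesovLe H (C₀ * r) (C₀ * (lam G a b n ^ 15)⁻¹) (cB * 2)
      ((lam'⁻¹ ^ 2) • dT (Lap (V i))) := by
  set μ := lam G a b n with hμ
  have hμ0 : 0 < μ := by linarith
  have hr1 : 1 ≤ r := (one_le_pow₀ hμ1).trans hμr
  have hl1 : 1 ≤ lam' := hr1.trans hrl
  have hl0 : 0 < lam' := by linarith
  have h10 : μ ^ 10 ≤ lam' := ((pow_le_pow_right₀ hμ1 (by norm_num)).trans hμr).trans hrl
  have hv : ‖((1 : ℝ), (0 : E2))‖ ≤ 1 := by simp [Prod.norm_def]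
  have h1 := (((hS.V_bound i).Lap (by positivity)).Dv (by positivity) hv).smul (lam'⁻¹ ^ 2)
  rw [← hμ] at h1
  have h2 : SB 1 (2 * lam'⁻¹) (μ ^ 3) ((lam'⁻¹ ^ 2) • dT (Lap (V i))).1 := by
    refine h1.mono_left (by positivity) ?_
    rw [abs_of_nonneg (by positivity)]
    calc lam'⁻¹ ^ 2 * (2 * (μ * (μ ^ 3) ^ 2) * μ ^ 3) = 2 * (lam'⁻¹ ^ 2 * μ ^ 10) := by ring
      _ ≤ 2 * (lam'⁻¹ ^ 2 * lam') := by gcongr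
      _ = 2 * lam'⁻¹ := by field_simp
  have hli : lam'⁻¹ ≤ 1 := inv_le_one_of_one_le₀ hl1
  refine hB.of_SB h2 (one_le_pow₀ hμ1) (by norm_num) (by positivity) ?_ ?_
  · have h3 : μ ^ 3 ≤ r := (pow_le_pow_right₀ hμ1 (by norm_num)).trans hμr
    calc 2 * lam'⁻¹ * (2 * lam'⁻¹ * μ ^ 3) ≤ 2 * 1 * (2 * 1 * r) := by gcongr
      _ ≤ 2 ^ 2 * (1 * r) ^ 2 := by nlinarith
      _ ≤ 2 ^ 2 * (C₀ * r) ^ 2 := by gcongr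
      _ = _ := by ring
  · have h3 : lam'⁻¹ ≤ (μ ^ 15)⁻¹ := inv_anti₀ (by positivity) (hμr.trans hrl)
    have h4 : (μ ^ 15)⁻¹ ≤ C₀ * (μ ^ 15)⁻¹ := le_mul_of_one_le_left (by positivity) hC₀
    linarith

end Step

end

section

open MeasureTheory

/-- The error term, up to the factor `λ² e^{-2λ²t}`, where `λ = λ_{n+1}`. -/
def errorTerm (G : GeometricData) (φ : Profile) (C₀ : ℝ) (a b n : ℕ) (V : Fin 2 → Sm)
    (A As : E2 → Sm) (X : Sm) (i : Fin 2) : Sm :=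
  lowerPart G.Λ (lam G a b (n + 1)) (orient G) (waveAmp G φ C₀ a b n As X) i +
  oscPart G.Λ (lam G a b (n + 1)) (orient G) (waveAmp G φ C₀ a b n As X) i +
  ∑ k ∈ G.Λ, G.bar k i • (dK (G.bar k) (slowAmp C₀ As X k ^ 2) * (blockWave G φ a b n k ^ 2 - 1)) +
  ∑ k ∈ G.Λ, G.bar k i • dK (G.bar k) ((2 * (1000 * C₀)) • (X ^ 2 * (As k ^ 2 - A k ^ 2))) +
  ((lam G a b (n + 1))⁻¹ ^ 2) • dT (Lap (V i))

/-- Different directions in a finite set are separated. -/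
lemma exists_separation (Λ : Finset E2) :
    ∃ m : ℝ, 0 < m ∧ ∀ k ∈ Λ, ∀ l ∈ Λ, k ≠ l → m ≤ ‖k - l‖ := by
  have h : ∀ S : Finset (E2 × E2), ∃ m : ℝ, 0 < m ∧ ∀ p ∈ S, p.1 ≠ p.2 → m ≤ ‖p.1 - p.2‖ := by
    classical
    intro S
    induction S using Finset.induction_on with
    | empty => exact ⟨1, one_pos, by simp⟩
    | insert p S _ ih =>
      obtain ⟨m, hm, h⟩ := ih
      by_cases hp : p.1 = p.2
      · refine ⟨m, hm, fun q hq hne => ?_⟩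
        rcases Finset.mem_insert.1 hq with rfl | hq
        · exact absurd hp hne
        · exact h q hq hne
      · refine ⟨min m ‖p.1 - p.2‖, lt_min hm (norm_pos_iff.2 (sub_ne_zero.2 hp)),
          fun q hq hne => ?_⟩
        rcases Finset.mem_insert.1 hq with rfl | hq
        · exact min_le_right _ _
        · exact (min_le_left _ _).trans (h q hq hne)
  obtain ⟨m, hm, h⟩ := h (Λ ×ˢ Λ)
  exact ⟨m, hm, fun k hk l hl hne => h (k, l) (Finset.mem_product.2 ⟨hk, hl⟩) hne⟩

/-- The error term is bounded in both Besov spaces, with a constant that depends neither on `C₀` nor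
on the frequencies. -/
theorem exists_errorTerm_bound (G : GeometricData) (φ : Profile) {H : SchwartzMap E2 ℂ} {cB : ℝ}
    (hB : BesovConst H cB) {c : ℝ} (hc : 1 ≤ c) :
    ∃ C L : ℝ, 0 < C ∧ ∀ (M : Mollifiers) (C₀ : ℝ), 1 ≤ C₀ → ∀ (a b : ℕ) (χ : ℕ → E2 → ℝ)
      (n : ℕ) (V : Fin 2 → Sm) (A As : E2 → Sm) (X : Sm), Step G φ M C₀ a b χ c n V A As X →
        1 ≤ a → L ≤ lam G a b n → lam G a b n ^ 200 ≤ lam G a b (n + 1) ^ (1 / 4 : ℝ) →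
          ∀ i, BesovLe H (C₀ * lam G a b (n + 1) ^ (1 / 4 : ℝ)) (C₀ * (lam G a b n ^ 15)⁻¹) C
            (errorTerm G φ C₀ a b n V A As X i) := by
  obtain ⟨cφ, hcφ, hφ⟩ := SB.of_periodic (by positivity) φ.smooth φ.periodic 5
  obtain ⟨Φ, hΦ, hΦp, hΦd⟩ := φ.exists_primitive
  obtain ⟨cΦ, hcΦ, hΦb⟩ := SB.of_periodic (by positivity) hΦ hΦp 2
  obtain ⟨m, hm, hsep⟩ := exists_separation G.Λ
  have hcB := hB.pos
  set N : ℝ := (G.Λ.card : ℝ) with hN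
  set Y : ℝ := N ^ 2 * (2000 * c ^ 4 * cφ ^ 2) with hY
  set x₁ : ℝ := 6400 * Y with hx₁
  set x₂ : ℝ := 4000 * c ^ 4 * cφ ^ 2 * (1 + (Real.sqrt m)⁻¹) with hx₂
  set x₃ : ℝ := 4000 * cΦ * c ^ 4 with hx₃
  have hN0 : 0 ≤ N := Nat.cast_nonneg _
  have hY0 : 0 ≤ Y := by positivity
  have hx₁0 : 0 ≤ x₁ := by positivity
  have hx₂0 : 0 ≤ x₂ := by positivity
  have hx₃0 : 0 ≤ x₃ := by positivity
  refine ⟨cB * x₁ + N * (N * (cB * x₂ + cB * x₂)) + N * (cB * x₃) + N * (cB * (24000 * c ^ 2)) +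
    cB * 2, 4 + c + 16 / m, by positivity, fun M C₀ hC₀ a b χ n V A As X hS ha hL hr i => ?_⟩
  set μ := lam G a b n with hμ
  set lam' := lam G a b (n + 1) with hlam'
  set r := lam' ^ (1 / 4 : ℝ) with hrdef
  have hm16 : 0 < 16 / m := by positivity
  have hμ4 : 4 ≤ μ := by linarith
  have hμ1 : 1 ≤ μ := by linarith
  have hμ0 : 0 < μ := by linarith
  have hl0 : 0 < lam' := lam_pos G ha _
  have hpow : ∀ j, j ≤ 200 → μ ^ j ≤ r := fun j hj => (pow_le_pow_right₀ hμ1 hj).trans hr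
  have hμr : μ ≤ r := by simpa using hpow 1 (by norm_num)
  have hr1 : 1 ≤ r := by linarith
  have hr0 : 0 < r := by linarith
  have hr4 : r ^ 4 = lam' := rpow_quarter_pow_four hl0.le
  have hrl : r ≤ lam' := by rw [← hr4]; exact le_self_pow₀ hr1 (by norm_num)
  have hC0 : 0 < C₀ := by linarith
  set Z := C₀ * r with hZ
  set W := C₀ * (μ ^ 15)⁻¹ with hW
  have hZ0 : 0 ≤ Z := by positivity
  have hW0 : 0 ≤ W := by positivity
  set B : ℝ := c ^ 2 * Real.sqrt 2000 * Real.sqrt C₀ with hBdef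
  have hB0 : 0 ≤ B := by positivity
  have hB2 : B ^ 2 = 2000 * c ^ 4 * C₀ := by
    rw [hBdef, mul_pow, mul_pow, Real.sq_sqrt (by norm_num), Real.sq_sqrt hC0.le]
    ring
  have hσ : ∀ k ∈ G.Λ, orient G k ^ 2 = 1 := fun k hk => orient_sq G hk
  have hg : ∀ k ∈ G.Λ, SB 5 (B * cφ) (2 * r) (waveAmp G φ C₀ a b n As X k).1 := fun k hk =>
    hS.waveAmp_bound (by linarith) (hpow 51 (by norm_num)) hl0.le hφ hk
  have hW15 : 1 ≤ (μ ^ 15)⁻¹ * r := by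
    rw [inv_mul_eq_div, one_le_div (by positivity)]
    exact hpow 15 (by norm_num)
  -- All powers of `λ_n` are measured against `r = λ_{n+1}^{1/4}`; the amplitudes have frequency at
  -- most `2 r`, because they contain the profiles, and `λ_{n+1} = r ^ 4`.
  refine BesovLe.add hZ0 hW0 (BesovLe.add hZ0 hW0 (BesovLe.add hZ0 hW0 (BesovLe.add hZ0 hW0
    ?_ ?_) ?_) ?_) ?_
  · have h2r : 2 * r ≤ lam' := by
      rw [← hr4]
      calc 2 * r ≤ r * r := by nlinarith
        _ ≤ r * r ^ 3 := by gcongr; exact le_self_pow₀ hr1 (by norm_num)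
        _ = r ^ 4 := by ring
    have h1 := SB.lowerPart G.norm_eq_one hσ hg (by positivity) (by positivity) h2r hl0 i
    have e : 800 * (G.Λ.card * (B * cφ)) ^ 2 * ((2 * r) ^ 2 / lam') = 3200 * Y * C₀ * (r ^ 2)⁻¹ := by
      rw [← hN, mul_pow, mul_pow B, hB2, hY, ← hr4]
      field_simp
      ring
    rw [e] at h1
    refine hB.of_SB h1 (by linarith) hx₁0 hZ0 ?_ ?_
    · have e2 : 3200 * Y * C₀ * (r ^ 2)⁻¹ * (3200 * Y * C₀ * (r ^ 2)⁻¹ * (4 * lam')) =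
          (x₁ * (C₀ * 1)) ^ 2 := by
        rw [← hr4, hx₁]
        field_simp
        ring
      rw [e2, hZ]
      gcongr
    · have h2 : (r ^ 2)⁻¹ ≤ (μ ^ 15)⁻¹ :=
        inv_anti₀ (by positivity) ((hpow 15 (by norm_num)).trans (le_self_pow₀ hr1 two_ne_zero))
      calc 3200 * Y * C₀ * (r ^ 2)⁻¹ ≤ 6400 * Y * C₀ * (μ ^ 15)⁻¹ := by
            gcongr
            norm_num
        _ = x₁ * W := by rw [hx₁, hW]; ring
  · have hs0 : 0 < Real.sqrt m := Real.sqrt_pos.2 hm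
    have hD2 : (2 * (2 * r)) ^ 2 ≤ lam' * m := by
      have h1 : 16 ≤ r * m := by
        rw [← div_le_iff₀ hm]
        linarith
      rw [← hr4]
      calc (2 * (2 * r)) ^ 2 = 16 * r ^ 2 := by ring
        _ ≤ (r * m) * r ^ 2 := by gcongr
        _ = m * r ^ 3 := by ring
        _ ≤ m * r ^ 4 := by gcongr; norm_num
        _ = r ^ 4 * m := by ring
    have hCD : (B * cφ) ^ 2 * (2 * r) = 4000 * c ^ 4 * cφ ^ 2 * (C₀ * r) := by
      rw [mul_pow, hB2]
      ring
    refine hB.oscPart G.norm_eq_one G.neg_mem hσ hg hsep hm hl0 (by linarith) hD2 hZ0 hW0 hx₂0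
      ?_ ?_ i
    · rw [hCD, hx₂]
      have : 0 ≤ (Real.sqrt m)⁻¹ := by positivity
      have h1 : 0 ≤ 4000 * c ^ 4 * cφ ^ 2 := by positivity
      exact mul_le_mul_of_nonneg_right (le_mul_of_one_le_right h1 (by linarith)) hZ0
    · have hsq : Real.sqrt (lam' * m) = r ^ 2 * Real.sqrt m := by
        rw [Real.sqrt_mul hl0.le, ← hr4, show r ^ 4 = (r ^ 2) ^ 2 by ring,
          Real.sqrt_sq (by positivity)]
      rw [hCD, hsq, hx₂]
      have h1 : 0 ≤ 4000 * c ^ 4 * cφ ^ 2 * (C₀ * r) := by positivity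
      have e : 4000 * c ^ 4 * cφ ^ 2 * (1 + (Real.sqrt m)⁻¹) * W * (r ^ 2 * Real.sqrt m) =
          4000 * c ^ 4 * cφ ^ 2 * (C₀ * r) * (((μ ^ 15)⁻¹ * r) * (Real.sqrt m + 1)) := by
        rw [hW]
        field_simp
      rw [e]
      exact le_mul_of_one_le_right h1 (one_le_mul_of_one_le_of_one_le hW15 (by linarith))
  · refine BesovLe.sum hZ0 hW0 fun k hk => ?_
    have h51 : (2 * μ ^ 51) ^ 2 ≤ r := by
      refine le_trans ?_ (hpow 103 (by norm_num))
      calc (2 * μ ^ 51) ^ 2 = 4 * μ ^ 102 := by ring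
        _ ≤ μ * μ ^ 102 := by gcongr
        _ = μ ^ 103 := by ring
    have hBD : cΦ * (2 * (B ^ 2 * μ ^ 51)) = x₃ * (C₀ * μ ^ 51) := by
      rw [hB2, hx₃]
      ring
    refine hB.profileTerm hΦ hΦd hΦb hk i (hS.slowAmp_bound (by linarith) hk) (one_le_pow₀ hμ1)
      h51 hx₃0 ?_ ?_
    · rw [hBD, hZ]
      have := hpow 51 (by norm_num)
      gcongr
    · rw [hBD]
      have h1 : μ ^ 66 ≤ Real.sqrt r := by
        refine Real.le_sqrt_of_sq_le ?_
        rw [← pow_mul]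
        exact hpow _ (by norm_num)
      have e : C₀ * μ ^ 51 = W * μ ^ 66 := by
        rw [hW]
        field_simp
      rw [e, mul_assoc x₃ W]
      exact mul_le_mul_of_nonneg_left (mul_le_mul_of_nonneg_left h1 hW0) hx₃0
  · exact BesovLe.sum hZ0 hW0 fun k hk => hS.mollificationTerm hB hc hC₀ hμ4 (by linarith)
      (hpow 36 (by norm_num)) hk i
  · exact hS.timeTerm hB hC₀ hμ1 (hpow 15 (by norm_num)) hrl i

/-! ### The identity -/

section Step

variable {G : GeometricData} {φ : Profile} {M : Mollifiers} {C₀ : ℝ} {a b : ℕ} {χ : ℕ → E2 → ℝ}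
  {c : ℝ} {n : ℕ} {V : Fin 2 → Sm} {A As : E2 → Sm} {X : Sm}

protected lemma SPer.Lap {f : Sm} (h : SPer f) : SPer (Lap f) :=
  ((h.Dv _).Dv _).add ((h.Dv _).Dv _)

protected lemma SPer.helm {f : Sm} (h : SPer f) (l : ℝ) : SPer (helm l f) := h.Lap.add (h.smul _)

lemma Step.errorTerm_per (hS : Step G φ M C₀ a b χ c n V A As X) (hab : ∃ m : ℕ, a ^ b = m ^ 4)
    (i : Fin 2) : SPer (errorTerm G φ C₀ a b n V A As X i) := by
  classical
  have hU := hS.nextStream_per (φ := φ) hab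
  have hg := fun k hk => hS.waveAmp_per (φ := φ) hab (k := k) hk
  have hc : ∀ k ∈ G.Λ, SPer (cosW (lam G a b (n + 1) • k)) := fun k hk =>
    SPer.wave_of_periodic _ Real.cos_periodic fun i => lam_smul_mem G a b (n + 1) hk i
  have hs : ∀ k ∈ G.Λ, SPer (sinW (lam G a b (n + 1) • k)) := fun k hk =>
    SPer.wave_of_periodic _ Real.sin_periodic fun i => lam_smul_mem G a b (n + 1) hk i
  have hcc : ∀ k ∈ G.Λ, ∀ l ∈ G.Λ, SPer (cosW (lam G a b (n + 1) • (k - l))) ∧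
      SPer (cosW (lam G a b (n + 1) • (k + l))) := by
    intro k hk l hl
    refine ⟨SPer.wave_of_periodic _ Real.cos_periodic fun i => ?_,
      SPer.wave_of_periodic _ Real.cos_periodic fun i => ?_⟩
    all_goals
      obtain ⟨z, hz⟩ := lam_smul_mem G a b (n + 1) hk i
      obtain ⟨z', hz'⟩ := lam_smul_mem G a b (n + 1) hl i
    · refine ⟨z - z', ?_⟩
      rw [smul_sub, PiLp.sub_apply, hz, hz']
      push_cast
      rfl
    · refine ⟨z + z', ?_⟩
      rw [smul_add, PiLp.add_apply, hz, hz']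
      push_cast
      rfl
  have h0 : SPer 0 := fun _ _ _ => rfl
  have h1 : SPer 1 := fun _ _ _ => rfl
  refine SPer.add (SPer.add (SPer.add (SPer.add ?_ ?_) ?_) ?_) ?_
  · have hP : SPer (∑ k ∈ G.Λ, orient G k • (Lap (waveAmp G φ C₀ a b n As X k) *
        cosW (lam G a b (n + 1) • k))) :=
      SPer.sum fun k hk => ((hg k hk).Lap.mul (hc k hk)).smul _
    have hQ : SPer (∑ k ∈ G.Λ, orient G k • (dK k (waveAmp G φ C₀ a b n As X k) *
        sinW (lam G a b (n + 1) • k))) :=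
      SPer.sum fun k hk => (((hg k hk).Dv _).mul (hs k hk)).smul _
    have hD : SPer (∑ k ∈ G.Λ, orient G k • (dX i (waveAmp G φ C₀ a b n As X k) *
        cosW (lam G a b (n + 1) • k))) :=
      SPer.sum fun k hk => (((hg k hk).Dv _).mul (hc k hk)).smul _
    exact (((((hP.neg.mul (hU.Dv _)).smul _).add ((hQ.mul hD).smul _)).add
      ((((hU.helm _).helm _).mul (hU.Dv _)).smul _)).add
        (((hU.helm _).mul ((hU.helm _).Dv _)).smul _)).sub
          ((((hU.helm _).helm _).mul ((hU.helm _).Dv _)).smul _)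
  · refine SPer.neg (SPer.sum fun k hk => SPer.sum fun l hl => SPer.smul _ ?_)
    refine (((hg k hk).Dv _).mul (hg l hl)).mul (SPer.sub ?_ ?_)
    · split_ifs
      · exact h0
      · exact (hcc k hk l hl).1
    · split_ifs
      · exact h0
      · exact (hcc k hk l hl).2
  · exact SPer.sum fun k hk => ((((hS.slowAmp_per hk).pow 2).Dv _).mul
      (((blockWave_per hab hk).pow 2).sub h1)).smul _
  · exact SPer.sum fun k hk => (((hS.X_per.pow 2).mul
      (((hS.As_per k hk).pow 2).sub ((hS.A_per k hk).pow 2))).smul _ |>.Dv _).smul _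
  · exact ((hS.V_per i).Lap.Dv _).smul _

/-- The pressure, up to the factor `e^{-2λ²t}`. -/
def pressureTerm (G : GeometricData) (φ : Profile) (C₀ : ℝ) (a b n : ℕ) (As : E2 → Sm) (X : Sm) :
    Sm :=
  ((lam G a b (n + 1))⁻¹ ^ 4) • ((1 / 2 : ℝ) • (dX 0 (Lap (nextStream G φ C₀ a b n As X)) ^ 2 +
    dX 1 (Lap (nextStream G φ C₀ a b n As X)) ^ 2 +
      (lam G a b (n + 1) ^ 2) • Lap (nextStream G φ C₀ a b n As X) ^ 2)) -
  (lam G a b (n + 1) ^ 2) • ∑ k ∈ G.Λ, waveAmp G φ C₀ a b n As X k ^ 2 +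
  (lam G a b (n + 1) ^ 2) • (2 * (1000 * C₀)) • X ^ 2

/-- The heart of the matter: for the flow `λ⁻² ∇^⊥ ΔU` of level `n + 1`, stripped of its decay in
time, the divergence of the tensor square plus the derivative of `ΔV` against the weight
`e^{-2λ²t}` is a small error plus a gradient. The term `2 λ² ΔV` produced by the self-interactions
cancels the one produced by the derivative of the weight. -/
lemma Step.identity (hS : Step G φ M C₀ a b χ c n V A As X) (hC₀ : 0 < C₀)
    (hlam : lam G a b (n + 1) ≠ 0) (i : Fin 2) :
    ((lam G a b (n + 1))⁻¹ ^ 4) •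
      (dX 0 (perp (Lap (nextStream G φ C₀ a b n As X)) i *
          perp (Lap (nextStream G φ C₀ a b n As X)) 0) +
        dX 1 (perp (Lap (nextStream G φ C₀ a b n As X)) i *
          perp (Lap (nextStream G φ C₀ a b n As X)) 1)) +
      (dT (Lap (V i)) - (2 * lam G a b (n + 1) ^ 2) • Lap (V i)) =
      (lam G a b (n + 1) ^ 2) • errorTerm G φ C₀ a b n V A As X i +
        dX i (pressureTerm G φ C₀ a b n As X) := by
  have hI := helm_mul_dX_eq G.Λ (lam G a b (n + 1)) (orient G) (waveAmp G φ C₀ a b n As X) hlam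
    G.norm_eq_one G.neg_mem (fun k hk => orient_sq G hk) (fun k hk => orient_neg G hk)
    (fun k hk => hS.waveAmp_neg hk) i
  have hII := selfInteraction_eq G.Λ G.bar (waveAmp G φ C₀ a b n As X) (slowAmp C₀ As X)
    (blockWave G φ a b n) A (fun k => As k ^ 2 - A k ^ 2) X (1000 * C₀) (by positivity) V
    (fun i j => dX i (V j) + dX j (V i)) G.norm_eq_one G.norm_bar G.inner_bar (fun k _ => rfl)
    (fun k hk => by
      rw [blockWave, dK_wave, inner_smul_left, G.inner_bar k hk, mul_zero, zero_smul])
    (fun k _ => by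
      rw [slowAmp]
      ext p
      simp only [Sm.pow_val, Sm.smul_val, Sm.mul_val, Sm.add_val, Sm.sub_val]
      rw [mul_pow, Real.sq_sqrt (by positivity)]
      ring)
    (fun i j => rfl) hS.V_div hS.A_sum hS.X_mul i
  have hIII := div_perp_tensor (Lap (nextStream G φ C₀ a b n As X)) (lam G a b (n + 1) ^ 2) i
  rw [errorTerm, pressureTerm, hIII]
  rw [← nextStream] at hI
  beta_reduce at hII
  set U := nextStream G φ C₀ a b n As X
  set lam' := lam G a b (n + 1)
  generalize lowerPart G.Λ lam' (orient G) (waveAmp G φ C₀ a b n As X) i = E₁ at hI ⊢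
  generalize oscPart G.Λ lam' (orient G) (waveAmp G φ C₀ a b n As X) i = E₂ at hI ⊢
  generalize ∑ k ∈ G.Λ, k i • dK k (waveAmp G φ C₀ a b n As X k ^ 2) = S at hI hII
  generalize ∑ k ∈ G.Λ, waveAmp G φ C₀ a b n As X k ^ 2 = T at hII ⊢
  generalize ∑ k ∈ G.Λ, G.bar k i • (dK (G.bar k) (slowAmp C₀ As X k ^ 2) *
    (blockWave G φ a b n k ^ 2 - 1)) = E₃ at hII ⊢
  generalize ∑ k ∈ G.Λ, G.bar k i • dK (G.bar k) ((2 * (1000 * C₀)) •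
    (X ^ 2 * (As k ^ 2 - A k ^ 2))) = E₄ at hII ⊢
  generalize (1 / 2 : ℝ) • (dX 0 (Lap U) ^ 2 + dX 1 (Lap U) ^ 2 + lam' ^ 2 • Lap U ^ 2) = P
  simp only [helm, Lap_add, Lap_smul, Derivation.map_smul, map_add, map_sub] at hI ⊢
  ext p
  have e1 := congrArg (fun f : Sm => f.1 p) hI
  have e2 := congrArg (fun f : Sm => f.1 p) hII
  simp only [Sm.add_val, Sm.sub_val, Sm.mul_val, Sm.neg_val, Sm.smul_val] at e1 e2 ⊢
  generalize (dX i (X ^ 2)).1 p = x at e2 ⊢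
  have e3 : -(lam'⁻¹ ^ 4 * ((lam'⁻¹ ^ 2 * (Lap (Lap U)).1 p + (Lap U).1 p) *
      (dX i (Lap U)).1 p)) = E₁.1 p + E₂.1 p - S.1 p := by
    rw [← e1]
    field_simp
    ring
  have e4 : lam'⁻¹ ^ 4 * ((dX i P).1 p - ((Lap (Lap U)).1 p + lam' ^ 2 * (Lap U).1 p) *
      (dX i (Lap U)).1 p) = lam'⁻¹ ^ 4 * (dX i P).1 p + lam' ^ 2 *
        -(lam'⁻¹ ^ 4 * ((lam'⁻¹ ^ 2 * (Lap (Lap U)).1 p + (Lap U).1 p) *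
      (dX i (Lap U)).1 p)) := by
    field_simp
    ring
  have e5 : lam' ^ 2 * (lam'⁻¹ ^ 2 * (dT (Lap (V i))).1 p) = (dT (Lap (V i))).1 p := by
    field_simp
  rw [e4, e3]
  linear_combination lam' ^ 2 * e2 - e5

end Step

end

section

open MeasureTheory

/-! ### The flows as functions on space-time -/

lemma contDiff_exp_mul (κ : ℝ) : ContDiff ℝ ∞ fun t : ℝ => Real.exp (κ * t) := by fun_prop

/-- The function `e^{κ t}`. -/
def expT (κ : ℝ) : Sm := ofTime _ (contDiff_exp_mul κ)

lemma expT_val (κ : ℝ) (p : ST) : (expT κ).1 p = Real.exp (κ * p.1) := rfl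

lemma dT_expT (κ : ℝ) : dT (expT κ) = κ • expT κ := by
  ext p
  have h1 := hasDerivAt_time (expT κ) p.1 p.2
  have h2 : HasDerivAt (fun s => (expT κ).1 (s, p.2)) (Real.exp (κ * p.1) * (κ * 1)) p.1 :=
    ((hasDerivAt_id p.1).const_mul κ).exp
  rw [Sm.smul_val, expT_val]
  have h3 := h1.unique h2
  rw [mul_one, mul_comm] at h3
  exact h3

lemma Lap_perp (f : Sm) (i : Fin 2) : Lap (perp f i) = perp (Lap f) i := by
  fin_cases i
  · exact (Dv_Lap _ f).symm
  · change Lap (-dX 0 f) = -dX 0 (Lap f)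
    rw [Dv_Lap, ← neg_one_smul ℝ, Lap_smul, neg_one_smul]

lemma smoothST_of_eq {f : ℝ → E2 → ℝ} (g : Sm) (h : ∀ t, 0 ≤ t → ∀ x, f t x = g.1 (t, x)) :
    SmoothST f :=
  g.smooth.contDiffOn.congr fun p hp => h p.1 hp.1 p.2

lemma smoothST_pi_of_eq {f : ℝ → E2 → Fin 2 → ℝ} (g : Fin 2 → Sm)
    (h : ∀ t, 0 ≤ t → ∀ x i, f t x i = (g i).1 (t, x)) : SmoothST f :=
  contDiffOn_pi.2 fun i => (g i).smooth.contDiffOn.congr fun p hp => h p.1 hp.1 p.2 i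

/-- The weight `λ² e^{-2λ²t}` has integral `1/2` over the positive times, so that a bound that is
uniform in time becomes a bound in `L¹`, uniformly in `λ`. -/
lemma LittlewoodPaley.L1besov_le (θ : LittlewoodPaley) {H : SchwartzMap E2 ℂ}
    (hH : ∀ ξ : E2, ∫ z, H z * planeExp (-ξ) z = (θ.toFun ξ : ℂ)) {f : Sm} (hf : SPer f) {s B lam : ℝ}
    (hlam : 0 < lam)
    (hB : ∀ t, kernelBesov H s (fun x => f.1 (t, x)) ≤ ENNReal.ofReal B) :
    θ.L1besov s (fun t x => lam ^ 2 * Real.exp (-2 * lam ^ 2 * t) * f.1 (t, x)) ≤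
      ENNReal.ofReal B := by
  have hneg : -2 * lam ^ 2 < 0 := by nlinarith [pow_pos hlam 2]
  have h1 : ∀ t, θ.besov s (fun x => lam ^ 2 * Real.exp (-2 * lam ^ 2 * t) * f.1 (t, x)) ≤
      ENNReal.ofReal (lam ^ 2 * Real.exp (-2 * lam ^ 2 * t)) * ENNReal.ofReal B := by
    intro t
    rw [θ.besov_eq_kernelBesov hH s
      (f := fun x => lam ^ 2 * Real.exp (-2 * lam ^ 2 * t) * f.1 (t, x))
      (continuous_const.mul (contDiff_slice f t).continuous)
      (fun i x => congrArg (lam ^ 2 * Real.exp (-2 * lam ^ 2 * t) * ·) (hf t i x)),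
      kernelBesov_const_mul H s (by positivity)]
    exact mul_le_mul_right (hB t) _
  have h2 : ∫⁻ t in Set.Ioi (0 : ℝ), ENNReal.ofReal (lam ^ 2 * Real.exp (-2 * lam ^ 2 * t)) ≤ 1 := by
    rw [← ofReal_integral_eq_lintegral_ofReal ((integrableOn_exp_mul_Ioi hneg 0).const_mul _)
      (Filter.Eventually.of_forall fun t => by positivity), integral_const_mul,
      integral_exp_mul_Ioi hneg]
    refine ENNReal.ofReal_le_one.2 (le_of_eq_of_le (b := 1 / 2) ?_ (by norm_num))
    rw [mul_zero, Real.exp_zero]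
    field_simp
  calc θ.L1besov s (fun t x => lam ^ 2 * Real.exp (-2 * lam ^ 2 * t) * f.1 (t, x)) ≤
      ∫⁻ t in Set.Ioi (0 : ℝ),
        ENNReal.ofReal (lam ^ 2 * Real.exp (-2 * lam ^ 2 * t)) * ENNReal.ofReal B :=
        lintegral_mono h1
    _ = (∫⁻ t in Set.Ioi (0 : ℝ), ENNReal.ofReal (lam ^ 2 * Real.exp (-2 * lam ^ 2 * t))) *
        ENNReal.ofReal B := lintegral_mul_const _ (by fun_prop)
    _ ≤ 1 * ENNReal.ofReal B := mul_le_mul_left h2 _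
    _ = ENNReal.ofReal B := one_mul _

section Step

variable {G : GeometricData} {φ : Profile} {M : Mollifiers} {C₀ : ℝ} {a b : ℕ} {χ : ℕ → E2 → ℝ}
  {c : ℝ} {n : ℕ} {V : Fin 2 → Sm} {A As : E2 → Sm} {X : Sm}

lemma Step.pressureTerm_per (hS : Step G φ M C₀ a b χ c n V A As X)
    (hab : ∃ m : ℕ, a ^ b = m ^ 4) : SPer (pressureTerm G φ C₀ a b n As X) := by
  have hU := (hS.nextStream_per (φ := φ) hab).Lap
  exact ((((((hU.Dv _).pow 2).add ((hU.Dv _).pow 2)).add ((hU.pow 2).smul _)).smul _).smul _ |>.sub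
    ((SPer.sum fun k hk => (hS.waveAmp_per hab hk).pow 2).smul _)).add
      (((hS.X_per.pow 2).smul _).smul _)

lemma Step.wP_eq (hS : Step G φ M C₀ a b χ c n V A As X) {t : ℝ} (ht : 0 ≤ t) (x : E2) (i : Fin 2) :
    wP G φ M C₀ a b χ n t x i = (Lap (V i)).1 (t, x) := by
  rw [wP, ← lap_slice]
  congr 1
  funext y
  exact hS.V_flow t ht y i

lemma Step.wP_succ_eq (hS : Step G φ M C₀ a b χ c n V A As X) (hn : 1 ≤ n)
    (hlam : lam G a b (n + 1) ≠ 0) {t : ℝ} (ht : 0 ≤ t) (x : E2) (i : Fin 2) :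
    wP G φ M C₀ a b χ (n + 1) t x i = (lam G a b (n + 1))⁻¹ ^ 2 *
      Real.exp (-(lam G a b (n + 1)) ^ 2 * t) *
        (perp (Lap (nextStream G φ C₀ a b n As X)) i).1 (t, x) := by
  have h : (fun y => potential G φ M C₀ a b χ (n + 1) t y i) = fun y =>
      (((lam G a b (n + 1))⁻¹ ^ 2 * Real.exp (-(lam G a b (n + 1)) ^ 2 * t)) •
        perp (nextStream G φ C₀ a b n As X) i).1 (t, y) :=
    funext fun y => hS.potential_succ hn hlam ht y i
  rw [wP, h, lap_slice, Lap_smul, Sm.smul_val, Lap_perp]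

lemma Step.wS_succ_eq (hS : Step G φ M C₀ a b χ c n V A As X) {t : ℝ} (ht : 0 ≤ t) (x : E2)
    (i : Fin 2) : wS G φ M C₀ a b χ (n + 1) t x i =
      (expT (-2 * lam G a b (n + 1) ^ 2) * Lap (V i)).1 (t, x) := by
  rw [wS, Nat.add_sub_cancel, hS.wP_eq ht, Sm.mul_val, expT_val]

lemma Step.derivWithin_wS (hS : Step G φ M C₀ a b χ c n V A As X) {t : ℝ} (ht : 0 ≤ t) (x : E2)
    (i : Fin 2) : derivWithin (fun s => wS G φ M C₀ a b χ (n + 1) s x i) (Set.Ici 0) t =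
      Real.exp (-2 * lam G a b (n + 1) ^ 2 * t) * ((dT (Lap (V i))).1 (t, x) -
        2 * lam G a b (n + 1) ^ 2 * (Lap (V i)).1 (t, x)) := by
  have h1 := (hasDerivAt_time (expT (-2 * lam G a b (n + 1) ^ 2) * Lap (V i)) t x).hasDerivWithinAt
    (s := Set.Ici 0)
  have h2 := h1.congr (fun s hs => hS.wS_succ_eq hs x i) (hS.wS_succ_eq ht x i)
  rw [h2.derivWithin (uniqueDiffOn_Ici 0 t ht), Dv_mul, dT_expT]
  simp only [Sm.add_val, Sm.mul_val, Sm.smul_val, expT_val]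
  ring

lemma Step.divT_wP (hS : Step G φ M C₀ a b χ c n V A As X) (hn : 1 ≤ n)
    (hlam : lam G a b (n + 1) ≠ 0) {t : ℝ} (ht : 0 ≤ t) (x : E2) (i : Fin 2) :
    divT (fun y => Matrix.vecMulVec (wP G φ M C₀ a b χ (n + 1) t y)
      (wP G φ M C₀ a b χ (n + 1) t y)) x i = Real.exp (-2 * lam G a b (n + 1) ^ 2 * t) *
        ((lam G a b (n + 1))⁻¹ ^ 4 *
          (dX 0 (perp (Lap (nextStream G φ C₀ a b n As X)) i *
              perp (Lap (nextStream G φ C₀ a b n As X)) 0) +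
            dX 1 (perp (Lap (nextStream G φ C₀ a b n As X)) i *
              perp (Lap (nextStream G φ C₀ a b n As X)) 1)).1 (t, x)) := by
  set Y := Lap (nextStream G φ C₀ a b n As X)
  have he : Real.exp (-2 * lam G a b (n + 1) ^ 2 * t) =
      Real.exp (-(lam G a b (n + 1)) ^ 2 * t) * Real.exp (-(lam G a b (n + 1)) ^ 2 * t) := by
    rw [← Real.exp_add]
    congr 1
    ring
  have h : ∀ j, (fun y => Matrix.vecMulVec (wP G φ M C₀ a b χ (n + 1) t y)
      (wP G φ M C₀ a b χ (n + 1) t y) i j) = fun y =>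
        ((Real.exp (-2 * lam G a b (n + 1) ^ 2 * t) * (lam G a b (n + 1))⁻¹ ^ 4) •
          (perp Y i * perp Y j)).1 (t, y) := by
    intro j
    funext y
    rw [Matrix.vecMulVec_apply, hS.wP_succ_eq hn hlam ht, hS.wP_succ_eq hn hlam ht, Sm.smul_val,
      Sm.mul_val, he]
    ring
  simp only [divT, Fin.sum_univ_two, h]
  rw [pd_slice, pd_slice, Derivation.map_smul, Derivation.map_smul]
  simp only [Sm.smul_val, Sm.add_val]
  ring

/-- The statement for one level, given the bounds on the error term. -/
lemma Step.exists_decomposition (hS : Step G φ M C₀ a b χ c n V A As X) (hn : 1 ≤ n) (hC₀ : 0 < C₀)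
    (hlam : 0 < lam G a b (n + 1)) (hab : ∃ m : ℕ, a ^ b = m ^ 4) (θ : LittlewoodPaley)
    {H : SchwartzMap E2 ℂ} (hH : ∀ ξ : E2, ∫ z, H z * planeExp (-ξ) z = (θ.toFun ξ : ℂ)) {Z W C : ℝ}
    (hB : ∀ i, BesovLe H Z W C (errorTerm G φ C₀ a b n V A As X i)) :
    SmoothST (wP G φ M C₀ a b χ (n + 1)) ∧ SmoothST (wS G φ M C₀ a b χ (n + 1)) ∧
      ∃ (F : ℝ → E2 → Fin 2 → ℝ) (P : ℝ → E2 → ℝ), SmoothST F ∧ SmoothST P ∧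
        (∀ t : ℝ, 0 ≤ t → Periodic2 (F t) ∧ Periodic2 (P t)) ∧
        (∀ t : ℝ, 0 ≤ t → ∀ (x : E2) (i : Fin 2),
          divT (fun y => Matrix.vecMulVec (wP G φ M C₀ a b χ (n + 1) t y)
              (wP G φ M C₀ a b χ (n + 1) t y)) x i
            + derivWithin (fun s => wS G φ M C₀ a b χ (n + 1) s x i) (Set.Ici 0) t
            = F t x i + pd i (P t) x) ∧
        (∀ i : Fin 2, θ.L1besov (-(1 / 2)) (fun t x => F t x i) ≤ ENNReal.ofReal (C * W)) ∧
        (∀ i : Fin 2, θ.L1besov 0 (fun t x => F t x i) ≤ ENNReal.ofReal (C * Z)) := by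
  have hE := hS.errorTerm_per (φ := φ) hab
  have hP := hS.pressureTerm_per (φ := φ) hab
  set lam' := lam G a b (n + 1) with hlam'
  set E := errorTerm G φ C₀ a b n V A As X
  set Q := pressureTerm G φ C₀ a b n As X
  refine ⟨smoothST_pi_of_eq (fun i => (lam'⁻¹ ^ 2) • (expT (-lam' ^ 2) *
      perp (Lap (nextStream G φ C₀ a b n As X)) i)) fun t ht x i => ?_,
    smoothST_pi_of_eq _ fun t ht x i => hS.wS_succ_eq ht x i,
    fun t x i => lam' ^ 2 * Real.exp (-2 * lam' ^ 2 * t) * (E i).1 (t, x),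
    fun t x => (expT (-2 * lam' ^ 2) * Q).1 (t, x), ?_, smoothST_of_eq _ fun _ _ _ => rfl,
    fun t _ => ⟨fun i x => ?_, ((SPer.ofTime _ _).mul hP) t⟩, fun t ht x i => ?_,
    fun i => θ.L1besov_le hH (hE i) hlam (hB i).low, fun i => θ.L1besov_le hH (hE i) hlam (hB i).high⟩
  · rw [hS.wP_succ_eq hn hlam.ne' ht, Sm.smul_val, Sm.mul_val, expT_val]
    ring
  · refine smoothST_pi_of_eq (fun i => (lam' ^ 2) • (expT (-2 * lam' ^ 2) * E i))
      fun t _ x i => ?_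
    rw [Sm.smul_val, Sm.mul_val, expT_val]
    ring
  · funext j
    exact congrArg (lam' ^ 2 * Real.exp (-2 * lam' ^ 2 * t) * ·) (hE j t i x)
  · have h := congrArg (fun f : Sm => f.1 (t, x)) (hS.identity (φ := φ) hC₀ hlam.ne' i)
    simp only [Sm.add_val, Sm.sub_val, Sm.smul_val] at h
    rw [hS.divT_wP hn hlam.ne' ht, hS.derivWithin_wS ht, pd_slice,
      Dv_mul _ (expT (-2 * lam' ^ 2)) Q]
    have h0 : dX i (expT (-2 * lam' ^ 2)) = 0 := dX_ofTime _ _ i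
    rw [h0, mul_zero, add_zero, Sm.mul_val, expT_val, Sm.add_val]
    linear_combination Real.exp (-2 * lam' ^ 2 * t) * h

end Step

end

end HeatFlow

end

theorem proposition3 (G : HeatFlow.GeometricData) (φ : HeatFlow.Profile) (M : HeatFlow.Mollifiers)
    (θ : HeatFlow.LittlewoodPaley) (K : ℕ → ℝ) :
    ∃ C : ℝ, 0 < C ∧ ∃ Cstar : ℝ, ∀ C₀ : ℝ, Cstar ≤ C₀ →
      ∃ L : ℕ, ∀ a b : ℕ, L ≤ a → L ≤ b → (∃ n : ℕ, a ^ b = n ^ 4) →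
        ∀ χ : ℕ → HeatFlow.E2 → ℝ, HeatFlow.IsCutoffSequence G φ a b K χ →
          ∀ q : ℕ, 1 ≤ q →
            HeatFlow.SmoothST (HeatFlow.wP G φ M C₀ a b χ (2 * q)) ∧
            HeatFlow.SmoothST (HeatFlow.wS G φ M C₀ a b χ (2 * q)) ∧
            ∃ (F : ℝ → HeatFlow.E2 → Fin 2 → ℝ) (P : ℝ → HeatFlow.E2 → ℝ),
              HeatFlow.SmoothST F ∧ HeatFlow.SmoothST P ∧
              (∀ t : ℝ, 0 ≤ t → HeatFlow.Periodic2 (F t) ∧ HeatFlow.Periodic2 (P t)) ∧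
              (∀ t : ℝ, 0 ≤ t → ∀ (x : HeatFlow.E2) (i : Fin 2),
                HeatFlow.divT (fun y => Matrix.vecMulVec (HeatFlow.wP G φ M C₀ a b χ (2 * q) t y)
                    (HeatFlow.wP G φ M C₀ a b χ (2 * q) t y)) x i
                  + derivWithin (fun s => HeatFlow.wS G φ M C₀ a b χ (2 * q) s x i) (Set.Ici 0) t
                  = F t x i + HeatFlow.pd i (P t) x) ∧
              (∀ i : Fin 2, θ.L1besov (-(1 / 2)) (fun t x => F t x i) ≤
                ENNReal.ofReal (C * C₀ * (HeatFlow.lam G a b (2 * q - 1) ^ 15)⁻¹)) ∧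
              (∀ i : Fin 2, θ.L1besov 0 (fun t x => F t x i) ≤
                ENNReal.ofReal (C * C₀ * HeatFlow.lam G a b (2 * q) ^ (1 / 4 : ℝ))) := by
  obtain ⟨H, hH⟩ := θ.exists_kernel
  have hH1 : ∫ z, H z = 1 := by
    have h := hH 0
    rw [θ.eq_one 0 (by norm_num)] at h
    simpa [HeatFlow.planeExp] using h
  obtain ⟨cB, hB⟩ := HeatFlow.exists_besovConst H hH1
  obtain ⟨c, hc, Cstar, hCstar, hsteps⟩ := HeatFlow.exists_steps G φ M K
  obtain ⟨C, L₁, hC, herr⟩ := HeatFlow.exists_errorTerm_bound G φ hB hc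
  refine ⟨C, hC, Cstar, fun C₀ hC₀ => ?_⟩
  have hC₀1 : 1 ≤ C₀ := hCstar.trans hC₀
  obtain ⟨L, hL⟩ := hsteps C₀ hC₀
  refine ⟨L + ⌈L₁⌉₊ + G.N ^ 4 + (8 * 200 + 1), fun a b ha hb hab χ hχ q hq => ?_⟩
  have ha1 : 1 ≤ a := by omega
  obtain ⟨n, hn⟩ : ∃ n, 2 * q = n + 1 := ⟨2 * q - 1, by omega⟩
  have hn1 : 1 ≤ n := by omega
  obtain ⟨V, A, As, X, hS⟩ := hL a b (by omega) (by omega) hab χ hχ n hn1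
  have hL₁ : L₁ ≤ HeatFlow.lam G a b n :=
    (Nat.le_ceil L₁).trans (le_trans (by exact_mod_cast (by omega : ⌈L₁⌉₊ ≤ a))
      (HeatFlow.le_lam G ha1 (by omega) n))
  have h := hS.exists_decomposition (φ := φ) hn1 (by linarith) (HeatFlow.lam_pos G ha1 _) hab θ hH
    (herr M C₀ hC₀1 a b χ n V A As X hS ha1 hL₁
      (HeatFlow.lam_pow_le G 200 (by omega) (by omega) n))
  rw [hn, Nat.add_sub_cancel]
  rw [← mul_assoc, ← mul_assoc] at h
  exact h
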